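/- **Theorem (local convergence of bi-level distributed ALADIN).** Consider the problem $$\min_{x}\ \sum_{i=1}^N f_i(x_i)\quad\text{s.t.}\quad h_i(x_i)\le 0\ (i=1,\dots,N),\qquad \sum_{i=1}^N A_ix_i=0,$$ with $f_i:\mathbb R^{n_i}\to\mathbb R$ and $h_i:\mathbb R^{n_i}\to\mathbb R^{n_{h_i}}$ twice continuously differentiable, $A_i\in\mathbb R^{n_c\times n_i}$, and Lagrangian $\mathcal L(x,\lambda,\kappa)=\sum_i\big(f_i(x_i)+\lambda^\top A_ix_i+\kappa_i^\top h_i(x_i)\big)$. All vector norms are Euclidean. Fix $\rho>0$ and symmetric positive definite matrices $\Sigma_i$. *The algorithm.* For $p=(x,\lambda,\kappa)$ let $C_i$ be the Jacobian of the constraints of $h_i$ that are active at $x_i$, $g_i=\nabla f_i(x_i)$, and $$m(p)=\big(-(g_i+C_i^\top\kappa_i+A_i^\top\lambda)_{i},\ -\textstyle\sum_iA_ix_i,\ 0\big).$$ (In products with $C_i$ only the entries of $\kappa_i$ for active constraints are used.) Given $\delta>0$, penalties $\mu^k>0$, tolerances $\eta^k\ge0$ and symmetric matrices $H_i^k$,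 iteration $k=0,1,2,\dots$ goes from $q^k=(z^k,\lambda^k,\kappa^{\mathrm{QP},k-1})$ to $p^k=(x^k,\lambda^k,\kappa^k)$ and then to $q^{k+1}=(z^{k+1},\lambda^{k+1},\kappa^{\mathrm{QP},k})$ as follows ($\kappa^{\mathrm{QP},-1}$ is an arbitrary initial guess). 1. For each $i$, $x_i^k$ is a local minimizer, with $\|x_i^k-z_i^k\|<\delta$, of $f_i(y)+(\lambda^k)^\top A_iy+\frac\rho2(y-z_i^k)^\top\Sigma_i(y-z_i^k)$ subject to $h_i(y)\le0$, and $\kappa_i^k$ is a Karush–Kuhn–Tucker (KKT) multiplier for it. 2. Let the columns of $Z_i$ form a basis of $\ker C_i$ at $p^k$, and put $\bar H_i=Z_i^\top H_i^kZ_i$, $\bar g_i=Z_i^\top g_i$, $\bar A_i=A_iZ_i$, $S_i=\bar A_i\bar H_i^{-1}\bar A_i^\top$, $s_i=A_ix_i^k-\bar A_i\bar H_i^{-1}\bar g_i$. The vector $\lambda^{k+1}$ solves the condensed system inexactly: $$\Big\|\Big(\tfrac1{\mu^k}I+\sum_iS_i\Big)\lambda^{k+1}-\tfrac1{\mu^k}\lambda^k-\sum_is_i\Big\|\le\eta^k\,\|m(p^k)\|.$$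 3. $z_i^{k+1}=x_i^k+\Delta x_i^k$ with $\Delta x_i^k=Z_i\bar H_i^{-1}(-\bar A_i^\top\lambda^{k+1}-\bar g_i)$, and $\kappa_i^{\mathrm{QP},k}$ is the multiplier of the constraint $C_i\Delta x_i=0$ in the coordination QP, i.e. $H_i^k\Delta x_i^k+g_i+A_i^\top\lambda^{k+1}+C_i^\top\kappa_i^{\mathrm{QP},k}=0$, with zero entries for inactive constraints. *Assumptions.* Let $p^\star=(x^\star,\lambda^\star,\kappa^\star)$ be a KKT point of the problem at which the following hold: the gradients of all consensus constraints and all active inequality constraints are linearly independent (LICQ); $\kappa^\star_{ij}>0$ whenever $h_{ij}(x_i^\star)=0$ (strict complementarity, SCC); and, for every $i$, $\nabla^2(f_i+\kappa_i^{\star\top}h_i)(x_i^\star)$ is positive definite on the null space of the Jacobian of the active constraints of $h_i$ (second-order sufficiency, SOSC). Let $\nabla\mathcal L$ and $\nabla^2\mathcal L$ be Lipschitz in a neighbourhood of $p^\star$. *Conclusion.* There are $\delta,\chi,\bar\eta>0$ and $c\in(0,1)$ such that for all constants $c_\mu>0$, $c_H\ge0$ the following hold. * (Well-posedness.) There is $\varepsilon>0$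 such that for every $q=(z,\lambda,\kappa)$ with $\|q-p^\star\|<\varepsilon$, step 1 at $q$ has a solution $p$ such that, for all $\mu>0$ and all symmetric $H_i$ that differ entrywise by at most $c_H\|q-p^\star\|$ from the Hessians of the local Lagrangians $f_i+\kappa_i^\top h_i$ at $p$, steps 2 and 3 can be carried out exactly (with $\eta=0$). * (Linear rate.) There is $\varepsilon>0$ such that every sequence of iterates with $\|q^0-p^\star\|<\varepsilon$ that satisfies, for all $k$, (i) $1/\mu^k\le c_\mu\|q^k-p^\star\|$ if $q^k\ne p^\star$, (ii) the entries of $H_i^k$ differ from those of $\nabla^2(f_i+\kappa_i^{k\top}h_i)(x_i^k)$ by at most $c_H\|q^k-p^\star\|$ (exact Hessians: $c_H=0$), (iii) $\eta^k<\bar\eta$, has $q^k\to p^\star$, $p^k\to p^\star$ and, for all $k$, $\|q^{k+1}-p^\star\|\le c\|q^k-p^\star\|$ and $\|p^k-p^\star\|\le\chi\|q^k-p^\star\|$. * (Quadratic rate.) For every $c_\eta>0$ there are $\varepsilon,C>0$ such that every sequence of iterates with $\|q^0-p^\star\|<\varepsilon$ that satisfies (i), (ii) and $\eta^k\le c_\eta\|q^k-p^\star\|$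 for all $k$ has $q^k\to p^\star$, $p^k\to p^\star$ and, for all $k$, $\|q^{k+1}-p^\star\|\le C\|q^k-p^\star\|^2$ and $\|p^k-p^\star\|\le\chi\|q^k-p^\star\|$. -/

import Mathlib

open Filter Topology

noncomputable section

/-- Data of the separable problem
`min ∑ i, f i (x i)` subject to `h i (x i) ≤ 0` for all `i` and `∑ i, A i * x i = 0`. -/
structure SepProblem where
  /-- number of subproblems -/
  N : ℕ
  /-- number of decision variables of each subproblem -/
  n : Fin N → ℕ
  /-- number of inequality constraints of each subproblem -/
  nh : Fin N → ℕ
  /-- number of consensus constraints -/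
  nc : ℕ
  f : ∀ i, EuclideanSpace ℝ (Fin (n i)) → ℝ
  h : ∀ i, EuclideanSpace ℝ (Fin (n i)) → EuclideanSpace ℝ (Fin (nh i))
  A : ∀ i, Matrix (Fin nc) (Fin (n i)) ℝ

namespace SepProblem

variable (P : SepProblem)

/-- Local decision space. -/
abbrev Xi (i : Fin P.N) : Type := EuclideanSpace ℝ (Fin (P.n i))

/-- The space of overall decision vectors `x = (x_1, …, x_N)`, with the Euclidean norm. -/
abbrev X : Type := PiLp 2 fun i : Fin P.N => EuclideanSpace ℝ (Fin (P.n i))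

/-- The space of multipliers of the consensus constraint. -/
abbrev Lam : Type := EuclideanSpace ℝ (Fin P.nc)

/-- The space of multipliers `κ = (κ_1, …, κ_N)` of the inequality constraints. -/
abbrev Kap : Type := PiLp 2 fun i : Fin P.N => EuclideanSpace ℝ (Fin (P.nh i))

/-- Primal-dual vectors `(x, λ, κ)`, with the Euclidean norm. -/
abbrev PD : Type := WithLp 2 (P.X × WithLp 2 (P.Lam × P.Kap))

variable {P}

/-- The vector `(x, λ, κ)`. -/
def pd (x : P.X) (l : P.Lam) (κ : P.Kap) : P.PD := WithLp.toLp 2 (x, WithLp.toLp 2 (l, κ))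

/-- Primal part of `(x, λ, κ)`. -/
def PD.x (p : P.PD) : P.X := p.fst

/-- Consensus multiplier part of `(x, λ, κ)`. -/
def PD.lam (p : P.PD) : P.Lam := p.snd.fst

/-- Inequality multiplier part of `(x, λ, κ)`. -/
def PD.kap (p : P.PD) : P.Kap := p.snd.snd

variable (P)

/-- The Lagrangian `f(x) + λᵀ A x + κᵀ h(x)`. -/
def lagrangian (p : P.PD) : ℝ :=
  ∑ i, (P.f i (PD.x p i) + (PD.lam p).ofLp ⬝ᵥ (P.A i).mulVec (PD.x p i).ofLp
    + (PD.kap p i).ofLp ⬝ᵥ (P.h i (PD.x p i)).ofLp)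

/-- The gradient of the `j`-th inequality constraint of subproblem `i`. -/
def gradh (i : Fin P.N) (j : Fin (P.nh i)) (y : P.Xi i) : P.Xi i :=
  gradient (fun w => P.h i w j) y

/-- The Hessian matrix of the local Lagrangian `f_i + κ_iᵀ h_i` at `y`. -/
def hess (i : Fin P.N) (y : P.Xi i) (κ : EuclideanSpace ℝ (Fin (P.nh i))) :
    Matrix (Fin (P.n i)) (Fin (P.n i)) ℝ :=
  Matrix.of fun a b =>
    fderiv ℝ (fderiv ℝ fun w : P.Xi i => P.f i w + κ.ofLp ⬝ᵥ (P.h i w).ofLp) y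
      (EuclideanSpace.single a 1) (EuclideanSpace.single b 1)

/-- The Jacobian of the active constraints of subproblem `i` at `y`. It is stored with one row for
every constraint, the rows of inactive constraints being zero. -/
def Cact (i : Fin P.N) (y : P.Xi i) : Matrix (Fin (P.nh i)) (Fin (P.n i)) ℝ :=
  open Classical in
  Matrix.of fun j a => if P.h i y j = 0 then P.gradh i j y a else 0

/-! ### Regularity of a primal-dual point -/

/-- `(x, λ, κ)` satisfies the KKT conditions. -/
structure IsKKT (p : P.PD) : Prop where
  stationary : ∀ i, (gradient (P.f i) (PD.x p i)).ofLp + (P.A i).transpose.mulVec (PD.lam p).ofLp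
    + ∑ j, PD.kap p i j • (P.gradh i j (PD.x p i)).ofLp = 0
  feasible : ∀ i j, P.h i (PD.x p i) j ≤ 0
  consensus : ∑ i, (P.A i).mulVec (PD.x p i).ofLp = 0
  nonneg : ∀ i j, 0 ≤ PD.kap p i j
  compl : ∀ i j, PD.kap p i j * P.h i (PD.x p i) j = 0

/-- LICQ: the gradients of the consensus constraints and of all active inequality constraints,
as vectors in the overall decision space, are linearly independent. -/
def LICQ (x : P.X) : Prop :=
  LinearIndependent ℝ
    (Sum.elim
      (fun c : Fin P.nc => (WithLp.toLp 2 fun i => WithLp.toLp 2 (P.A i c) : P.X))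
      (fun s : Σ i : Fin P.N, {j : Fin (P.nh i) // P.h i (x i) j = 0} =>
        (WithLp.toLp 2 (Pi.single s.1 (P.gradh s.1 s.2 (x s.1))) : P.X)))

/-- Strict complementarity: active inequality constraints have positive multipliers. -/
def SCC (p : P.PD) : Prop :=
  ∀ i j, P.h i (PD.x p i) j = 0 → 0 < PD.kap p i j

/-- SOSC: the Hessian of each local Lagrangian is positive definite on the null space of the
active constraint Jacobian of that subproblem. -/
def SOSC (p : P.PD) : Prop :=
  ∀ i, ∀ v : Fin (P.n i) → ℝ, v ≠ 0 → (P.Cact i (PD.x p i)).mulVec v = 0 →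
    0 < v ⬝ᵥ (P.hess i (PD.x p i) (PD.kap p i)).mulVec v

/-! ### The algorithm -/

/-- Objective `f_i(y) + λᵀ A_i y + (ρ/2) ‖y - z_i‖²_{Σ_i}` of the `i`-th local problem. -/
def localObj (Sig : ∀ i, Matrix (Fin (P.n i)) (Fin (P.n i)) ℝ) (ρ : ℝ)
    (z : P.X) (l : P.Lam) (i : Fin P.N) (y : P.Xi i) : ℝ :=
  P.f i y + l.ofLp ⬝ᵥ (P.A i).mulVec y.ofLp
    + ρ / 2 * ((y - z i).ofLp ⬝ᵥ (Sig i).mulVec (y - z i).ofLp)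

/-- Parallelizable step: from `q = (z, λ, ·)` to `p = (x, λ, κ)`, where `x_i` is a local minimizer
of the `i`-th local problem at distance less than `δ` from `z_i`, and `κ_i` is a multiplier of the
constraint `h_i ≤ 0` in that problem. -/
structure LocalStep (Sig : ∀ i, Matrix (Fin (P.n i)) (Fin (P.n i)) ℝ) (ρ δ : ℝ)
    (q p : P.PD) : Prop where
  lam_eq : PD.lam p = PD.lam q
  near : ∀ i, dist (PD.x p i) (PD.x q i) < δ
  feasible : ∀ i j, P.h i (PD.x p i) j ≤ 0
  localMin : ∀ i, IsLocalMinOn (P.localObj Sig ρ (PD.x q) (PD.lam q) i)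
    {y | ∀ j, P.h i y j ≤ 0} (PD.x p i)
  stationary : ∀ i, gradient (P.localObj Sig ρ (PD.x q) (PD.lam q) i) (PD.x p i)
    + ∑ j, PD.kap p i j • P.gradh i j (PD.x p i) = 0
  nonneg : ∀ i j, 0 ≤ PD.kap p i j
  compl : ∀ i j, PD.kap p i j * P.h i (PD.x p i) j = 0

/-- The columns of `Z` form a basis of the null space of `C`. -/
def IsNullBasis {a b d : ℕ} (C : Matrix (Fin a) (Fin b) ℝ) (Z : Matrix (Fin b) (Fin d) ℝ) : Prop :=
  LinearIndependent ℝ Z.col ∧ Submodule.span ℝ (Set.range Z.col) = LinearMap.ker C.mulVecLin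

section Condensed

variable {d : Fin P.N → ℕ} (Z : ∀ i, Matrix (Fin (P.n i)) (Fin (d i)) ℝ)
  (H : ∀ i, Matrix (Fin (P.n i)) (Fin (P.n i)) ℝ)

/-- Reduced Hessian `Z_iᵀ H_i Z_i`. -/
def Hbar (i : Fin P.N) : Matrix (Fin (d i)) (Fin (d i)) ℝ := (Z i).transpose * H i * Z i

/-- Reduced gradient `Z_iᵀ ∇f_i(x_i)`. -/
def gbar (x : P.X) (i : Fin P.N) : Fin (d i) → ℝ :=
  (Z i).transpose.mulVec (gradient (P.f i) (x i)).ofLp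

/-- Reduced coupling matrix `A_i Z_i`. -/
def Abar (i : Fin P.N) : Matrix (Fin P.nc) (Fin (d i)) ℝ := P.A i * Z i

/-- Schur complement `S_i`. -/
def schur (i : Fin P.N) : Matrix (Fin P.nc) (Fin P.nc) ℝ :=
  P.Abar Z i * (P.Hbar Z H i)⁻¹ * (P.Abar Z i).transpose

/-- Condensed vector `s_i = A_i x_i - Abar_i Hbar_i⁻¹ gbar_i`. -/
def svec (x : P.X) (i : Fin P.N) : Fin P.nc → ℝ :=
  (P.A i).mulVec (x i).ofLp - (P.Abar Z i).mulVec ((P.Hbar Z H i)⁻¹.mulVec (P.gbar Z x i))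

/-- Residual of the condensed system `(μ⁻¹ I + ∑ S_i) lQP = μ⁻¹ λ + ∑ s_i` at `lQP`. -/
def condensedResidual (μ : ℝ) (p : P.PD) (lQP : P.Lam) : P.Lam :=
  WithLp.toLp 2 ((μ⁻¹ • (1 : Matrix (Fin P.nc) (Fin P.nc) ℝ) + ∑ i, P.schur Z H i).mulVec lQP.ofLp
    - μ⁻¹ • (PD.lam p).ofLp - ∑ i, P.svec Z H (PD.x p) i)

/-- Back substitution `Δx_i = Z_i Hbar_i⁻¹ (-Abar_iᵀ lQP - gbar_i)`. -/
def backSub (x : P.X) (lQP : P.Lam) (i : Fin P.N) : Fin (P.n i) → ℝ :=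
  (Z i).mulVec ((P.Hbar Z H i)⁻¹.mulVec
    (-(P.Abar Z i).transpose.mulVec lQP.ofLp - P.gbar Z x i))

end Condensed

/-- Right-hand side `m(p) = (-g - Cᵀ κ - Aᵀ λ, -A x, 0)` of the optimality system of the
coordination QP, `C` being the Jacobian of the active constraints. -/
def mvec (p : P.PD) : P.PD :=
  pd
    (WithLp.toLp 2 fun i => WithLp.toLp 2
      (-(gradient (P.f i) (PD.x p i)).ofLp
        - (P.Cact i (PD.x p i)).transpose.mulVec (PD.kap p i).ofLp
        - (P.A i).transpose.mulVec (PD.lam p).ofLp))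
    (WithLp.toLp 2 (-∑ i, (P.A i).mulVec (PD.x p i).ofLp))
    0

/-- The matrix-vector product `M(p) Δ`, where `M(p)` is the KKT matrix
`[H, Aᵀ, Cᵀ; A, -μ⁻¹ I, 0; C, 0, 0]` of the coordination QP. -/
def Mmap (μ : ℝ) (H : ∀ i, Matrix (Fin (P.n i)) (Fin (P.n i)) ℝ) (p Δ : P.PD) : P.PD :=
  pd
    (WithLp.toLp 2 fun i => WithLp.toLp 2
      ((H i).mulVec (PD.x Δ i).ofLp + (P.A i).transpose.mulVec (PD.lam Δ).ofLp
        + (P.Cact i (PD.x p i)).transpose.mulVec (PD.kap Δ i).ofLp))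
    (WithLp.toLp 2 (∑ i, (P.A i).mulVec (PD.x Δ i).ofLp - μ⁻¹ • (PD.lam Δ).ofLp))
    (WithLp.toLp 2 fun i => WithLp.toLp 2 ((P.Cact i (PD.x p i)).mulVec (PD.x Δ i).ofLp))

/-- The residual `r_p = M(p) (q' - p) - m(p)`. -/
def kktResidual (μ : ℝ) (H : ∀ i, Matrix (Fin (P.n i)) (Fin (P.n i)) ℝ) (p q' : P.PD) : P.PD :=
  P.Mmap μ H p (q' - p) - P.mvec p

/-- Coordination and update step without its tolerance: `q' = (z', λ', κ')` is obtained from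
`p = (x, λ, κ)` and an approximate solution `λ'` of the condensed system, where `z' = x + Δx` by back
substitution and `κ'` is the multiplier of the linearized active constraints in the coordination QP:
it is determined by the stationarity condition of that QP and is zero for inactive constraints.
The columns of the `Z i` are any bases of the null spaces of the active constraint Jacobians. -/
structure Update {d : Fin P.N → ℕ} (Z : ∀ i, Matrix (Fin (P.n i)) (Fin (d i)) ℝ)
    (H : ∀ i, Matrix (Fin (P.n i)) (Fin (P.n i)) ℝ) (p q' : P.PD) : Prop where
  basis : ∀ i, IsNullBasis (P.Cact i (PD.x p i)) (Z i)
  primal : ∀ i, (PD.x q' i).ofLp = (PD.x p i).ofLp + P.backSub Z H (PD.x p) (PD.lam q') i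
  stationary : ∀ i, (H i).mulVec (PD.x q' i - PD.x p i).ofLp + (gradient (P.f i) (PD.x p i)).ofLp
    + (P.A i).transpose.mulVec (PD.lam q').ofLp
    + (P.Cact i (PD.x p i)).transpose.mulVec (PD.kap q' i).ofLp = 0
  inactive : ∀ i j, P.h i (PD.x p i) j ≠ 0 → PD.kap q' i j = 0

/-- Only the consensus row of the residual `r_p` is nonzero, and it is, up to sign, the residual of
the condensed system. So bounding one residual is the same as bounding the other. -/
theorem norm_kktResidual {d : Fin P.N → ℕ} {Z : ∀ i, Matrix (Fin (P.n i)) (Fin (d i)) ℝ}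
    {H : ∀ i, Matrix (Fin (P.n i)) (Fin (P.n i)) ℝ} {p q' : P.PD} (μ : ℝ)
    (hu : P.Update Z H p q') :
    ‖P.kktResidual μ H p q'‖ = ‖P.condensedResidual Z H μ p (PD.lam q')‖ := by
  have hx : ∀ i, (PD.x (q' - p) i).ofLp = P.backSub Z H (PD.x p) (PD.lam q') i := by
    intro i
    have := hu.primal i
    change (PD.x q' i).ofLp - (PD.x p i).ofLp = _
    rw [this]; simp
  have key : P.kktResidual μ H p q' = pd 0 (-P.condensedResidual Z H μ p (PD.lam q')) 0 := by
    have e1 : PD.x (P.kktResidual μ H p q') = 0 := by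
      ext i a
      have h1 := congrFun (hu.stationary i) a
      change (((H i).mulVec (PD.x q' i - PD.x p i).ofLp
        + (P.A i).transpose.mulVec ((PD.lam q').ofLp - (PD.lam p).ofLp)
        + (P.Cact i (PD.x p i)).transpose.mulVec ((PD.kap q' i).ofLp - (PD.kap p i).ofLp))
        - (-(gradient (P.f i) (PD.x p i)).ofLp
          - (P.Cact i (PD.x p i)).transpose.mulVec (PD.kap p i).ofLp
          - (P.A i).transpose.mulVec (PD.lam p).ofLp)) a = 0
      rw [Matrix.mulVec_sub, Matrix.mulVec_sub]
      simp only [Pi.add_apply, Pi.sub_apply, Pi.neg_apply, Pi.zero_apply] at h1 ⊢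
      linarith
    have e3 : PD.kap (P.kktResidual μ H p q') = 0 := by
      ext i a
      change ((P.Cact i (PD.x p i)).mulVec (PD.x (q' - p) i).ofLp - 0) a = 0
      rw [hx, sub_zero]
      have hz : (P.Cact i (PD.x p i)) * Z i = 0 := by
        ext r c
        have hc : (Z i).col c ∈ LinearMap.ker (P.Cact i (PD.x p i)).mulVecLin := by
          rw [← (hu.basis i).2]
          exact Submodule.subset_span ⟨c, rfl⟩
        exact congrFun (LinearMap.mem_ker.1 hc) r
      rw [backSub, Matrix.mulVec_mulVec, hz]
      simp
    have e2 : PD.lam (P.kktResidual μ H p q') = -P.condensedResidual Z H μ p (PD.lam q') := by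
      have h2 : (PD.lam (P.kktResidual μ H p q')).ofLp
          = (∑ i, (P.A i).mulVec (PD.x (q' - p) i).ofLp
              - μ⁻¹ • ((PD.lam q').ofLp - (PD.lam p).ofLp))
            - -∑ i, (P.A i).mulVec (PD.x p i).ofLp := rfl
      apply (WithLp.ofLp_injective 2)
      rw [h2]
      have h3 : ∀ i, (P.A i).mulVec (PD.x (q' - p) i).ofLp
          = -(P.schur Z H i).mulVec (PD.lam q').ofLp
            - (P.Abar Z i).mulVec ((P.Hbar Z H i)⁻¹.mulVec (P.gbar Z (PD.x p) i)) := by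
        intro i
        rw [hx, backSub, schur, ← Matrix.mulVec_mulVec, ← Matrix.mulVec_mulVec,
          Matrix.mulVec_sub, Matrix.mulVec_neg, Abar, Matrix.mulVec_mulVec, Matrix.mulVec_sub,
          Matrix.mulVec_neg]
      simp only [h3, condensedResidual, svec, WithLp.ofLp_neg, Finset.sum_sub_distrib,
        Finset.sum_neg_distrib, Matrix.add_mulVec, Matrix.smul_mulVec, Matrix.one_mulVec,
        Matrix.sum_mulVec, smul_sub]
      abel
    rw [← e2]
    calc P.kktResidual μ H p q' = pd (PD.x (P.kktResidual μ H p q'))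
          (PD.lam (P.kktResidual μ H p q')) (PD.kap (P.kktResidual μ H p q')) := rfl
      _ = _ := by rw [e1, e3]
  rw [key]
  simp [pd]

/-- Coordination and update step with penalty `μ`, Hessian matrices `H` and tolerance `η`: the
condensed system is solved up to a residual bounded by `η ‖m(p)‖`. -/
def CoordStep (μ η : ℝ) (H : ∀ i, Matrix (Fin (P.n i)) (Fin (P.n i)) ℝ) (p q' : P.PD) : Prop :=
  ∃ (d : Fin P.N → ℕ) (Z : ∀ i, Matrix (Fin (P.n i)) (Fin (d i)) ℝ), P.Update Z H p q' ∧
    ‖P.condensedResidual Z H μ p (PD.lam q')‖ ≤ η * ‖P.mvec p‖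

/-- The symmetric matrices `H i` agree with the Hessians of the local Lagrangians at `p`, up to an
error of at most `e` in each entry (`e = 0`: exact Hessians). -/
def HessApprox (e : ℝ) (H : ∀ i, Matrix (Fin (P.n i)) (Fin (P.n i)) ℝ) (p : P.PD) : Prop :=
  ∀ i, (H i).IsSymm ∧ ∀ a b, |H i a b - P.hess i (PD.x p i) (PD.kap p i) a b| ≤ e

/-- `q^k`, `p^k` are the iterates of bi-level distributed ALADIN with parameters `Σ`, `ρ`, penalties
`μ^k`, Hessian matrices `H^k`, and tolerances `η^k` of the inexact coordination step. -/
def IsRun (Sig : ∀ i, Matrix (Fin (P.n i)) (Fin (P.n i)) ℝ) (ρ δ : ℝ) (μ η : ℕ → ℝ)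
    (H : ℕ → ∀ i, Matrix (Fin (P.n i)) (Fin (P.n i)) ℝ) (q p : ℕ → P.PD) : Prop :=
  ∀ k, 0 < μ k ∧ 0 ≤ η k ∧ P.LocalStep Sig ρ δ (q k) (p k) ∧
    P.CoordStep (μ k) (η k) (H k) (p k) (q (k + 1))

end SepProblem

end

/-! Stack all blocks into one nonlinear program in `x`. The consensus constraint enters the gradient
as the linear term `consensusDual λ`. Blockwise SOSC adds up to SOSC of the stacked program, because
the Hessians and the inequality constraints are separable. Everything then rests on one estimate per
iteration (`iteration_estimate`): `‖p - p⋆‖ ≤ χ ‖q - p⋆‖` and `‖q' - p⋆‖ ≤ (C₁ ‖q - p⋆‖ + C₀ η) ‖q -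
p⋆‖`. A small `η` makes this a contraction; `η` of order `‖q - p⋆‖` makes it quadratic.

The local step is a perturbed KKT problem (`proxKKT_estimate`). Only `‖x - z‖ < δ` is known
beforehand. Stationarity and independence of the active gradients then bring the multipliers close
to `κ⋆`, and strict complementarity identifies the active set. From there on `(x, κ)` solves a
square system of equations whose derivative at the solution is injective by SOSC and LICQ, so the
error is proportional to the perturbation of `z` and `λ`.

The coordination step is an inexact Newton step for the KKT system with this fixed active set
(`coordKKT_estimate`). Its operator is uniformly invertible near the solution, including in the
limit `1/μ = 0`. Applied to `q' - p⋆` it gives only a second-order Taylor remainder, the Hessian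
error times `‖x - x⋆‖`, the penalty shift `(1/μ) ‖λ - λ⋆‖` and the residual of the condensed system,
which is at most `η ‖m(p)‖ = O(η ‖p - p⋆‖)`. If `q = p⋆`, nothing bounds `1/μ`; there the step fixes
`p⋆` exactly.

For well-posedness, the inverse function theorem solves the local equations, and an augmented
Lagrangian shows that the solution is a local minimizer. The reduced Hessians stay positive definite
near `p⋆`, so the condensed matrix is positive definite for every `μ > 0`. -/

/-! ### Quadratic forms that are positive on a null space -/

section Coercive

set_option maxSynthPendingDepth 3

variable {X : Type*} [NormedAddCommGroup X] [NormedSpace ℝ X] {J : Type*}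

/-- The bilinear form `Q + T ∑ j ∈ s, D j ⊗ D j`. -/
noncomputable def penalizedForm (s : Finset J) (T : ℝ) (D : J → X →L[ℝ] ℝ) (Q : X →L[ℝ] X →L[ℝ] ℝ) :
    X →L[ℝ] X →L[ℝ] ℝ :=
  Q + T • ∑ j ∈ s, (D j).smulRight (D j)

theorem penalizedForm_apply (s : Finset J) (T : ℝ) (D : J → X →L[ℝ] ℝ) (Q : X →L[ℝ] X →L[ℝ] ℝ)
    (u v : X) : penalizedForm s T D Q u v = Q u v + T * ∑ j ∈ s, D j u * D j v := by
  simp [penalizedForm]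

/-- A bilinear form that is positive on the common null space of finitely many functionals becomes
positive definite once a large multiple of the sum of their squares is added. -/
theorem exists_penalizedForm_coercive [FiniteDimensional ℝ X] (s : Finset J) (D : J → X →L[ℝ] ℝ)
    (Q : X →L[ℝ] X →L[ℝ] ℝ) (hQ : ∀ v, v ≠ 0 → (∀ j ∈ s, D j v = 0) → 0 < Q v v) :
    ∃ T : ℝ, 0 ≤ T ∧ ∃ c > 0, ∀ v, c * ‖v‖ ^ 2 ≤ penalizedForm s T D Q v v := by
  have hcont : ∀ T : ℝ, Continuous fun v => penalizedForm s T D Q v v := fun T => by fun_prop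
  -- Compactness: if no integer `T` works, the sets of unit vectors where the form is nonpositive
  -- are nonempty, compact and decreasing in `T`, so they share a vector `v`. Either all `D j v`
  -- vanish, against positivity on the null space, or the penalty at `v` grows without bound.
  have hT : ∃ T : ℕ, ∀ v ∈ Metric.sphere (0 : X) 1, 0 < penalizedForm s T D Q v v := by
    by_contra! hcon
    let S : ℕ → Set X := fun T => Metric.sphere (0 : X) 1 ∩ {v | penalizedForm s T D Q v v ≤ 0}
    have hclosed : ∀ T, IsClosed {v | penalizedForm s (T : ℕ) D Q v v ≤ 0} := fun T =>
      isClosed_le (hcont T) continuous_const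
    have hmono : ∀ a b : ℕ, a ≤ b → S b ⊆ S a := by
      rintro a b hab v ⟨hv, hv'⟩
      refine ⟨hv, ?_⟩
      rw [Set.mem_ofPred_eq] at hv' ⊢
      refine le_trans ?_ hv'
      simp only [penalizedForm_apply]
      have : (0 : ℝ) ≤ ∑ j ∈ s, D j v * D j v := Finset.sum_nonneg fun j _ => mul_self_nonneg _
      have hab' : (a : ℝ) ≤ b := by exact_mod_cast hab
      nlinarith
    obtain ⟨v, hv⟩ := IsCompact.nonempty_iInter_of_directed_nonempty_isCompact_isClosed S
      (fun a b => ⟨max a b, hmono _ _ (le_max_left _ _), hmono _ _ (le_max_right _ _)⟩)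
      (fun T => by obtain ⟨v, h1, h2⟩ := hcon T; exact ⟨v, h1, h2⟩)
      (fun T => (isCompact_sphere _ _).inter_right (hclosed T))
      (fun T => Metric.isClosed_sphere.inter (hclosed T))
    rw [Set.mem_iInter] at hv
    have hv1 : ‖v‖ = 1 := by simpa using (hv 0).1
    have hv0 : v ≠ 0 := by rintro rfl; simp at hv1
    have hle : ∀ T : ℕ, Q v v + T * ∑ j ∈ s, D j v * D j v ≤ 0 := fun T => by
      have := (hv T).2
      rwa [Set.mem_ofPred_eq, penalizedForm_apply] at this
    have hsum : (0 : ℝ) ≤ ∑ j ∈ s, D j v * D j v := Finset.sum_nonneg fun j _ => mul_self_nonneg _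
    rcases hsum.eq_or_lt with h0 | hpos
    · have hD : ∀ j ∈ s, D j v = 0 := fun j hj => by
        have := (Finset.sum_eq_zero_iff_of_nonneg fun j _ => mul_self_nonneg (D j v)).1 h0.symm j hj
        simpa using this
      have h1 := hQ v hv0 hD
      have h2 := hle 0
      simp only [Nat.cast_zero, zero_mul, add_zero] at h2
      linarith
    · obtain ⟨T, hT⟩ := exists_nat_gt (-Q v v / ∑ j ∈ s, D j v * D j v)
      rw [div_lt_iff₀ hpos] at hT
      linarith [hle T]
  obtain ⟨T, hT⟩ := hT
  refine ⟨T, Nat.cast_nonneg T, ?_⟩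
  have hc : ∃ c > 0, ∀ v ∈ Metric.sphere (0 : X) 1, c ≤ penalizedForm s T D Q v v := by
    rcases (Metric.sphere (0 : X) 1).eq_empty_or_nonempty with he | hne
    · exact ⟨1, one_pos, by simp [he]⟩
    · obtain ⟨v, hv, hmin⟩ := (isCompact_sphere (0 : X) 1).exists_isMinOn hne (hcont T).continuousOn
      exact ⟨_, hT v hv, fun w hw => hmin hw⟩
  obtain ⟨c, hc0, hc⟩ := hc
  refine ⟨c, hc0, fun v => ?_⟩
  rcases eq_or_ne v 0 with rfl | hv
  · simp
  · have hn : ‖v‖ ≠ 0 := norm_ne_zero_iff.2 hv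
    have h1 := hc (‖v‖⁻¹ • v) (by simp [norm_smul, hn])
    simp only [map_smul, smul_apply, smul_eq_mul] at h1
    calc c * ‖v‖ ^ 2 ≤ (‖v‖⁻¹ * (‖v‖⁻¹ * penalizedForm s T D Q v v)) * ‖v‖ ^ 2 := by gcongr
      _ = _ := by field_simp

/-- Coercivity persists under small perturbations of the form. -/
theorem penalizedForm_pos_of_near (s : Finset J) {T c : ℝ} {D : J → X →L[ℝ] ℝ}
    {Q : X →L[ℝ] X →L[ℝ] ℝ} (hc : 0 < c) (h : ∀ v, c * ‖v‖ ^ 2 ≤ penalizedForm s T D Q v v) :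
    ∀ᶠ w : (J → X →L[ℝ] ℝ) × (X →L[ℝ] X →L[ℝ] ℝ) in 𝓝 (D, Q),
      ∀ v, c / 2 * ‖v‖ ^ 2 ≤ penalizedForm s T w.1 w.2 v v := by
  have hcont : Continuous fun w : (J → X →L[ℝ] ℝ) × (X →L[ℝ] X →L[ℝ] ℝ) =>
      penalizedForm s T w.1 w.2 := by
    have h1 : ∀ j, Continuous fun w : (J → X →L[ℝ] ℝ) × (X →L[ℝ] X →L[ℝ] ℝ) =>
        (w.1 j).smulRight (w.1 j) := fun j => by
      have h1 : Continuous fun w : (J → X →L[ℝ] ℝ) × (X →L[ℝ] X →L[ℝ] ℝ) => w.1 j := by fun_prop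
      exact (ContinuousLinearMap.smulRightL ℝ X (X →L[ℝ] ℝ)).continuous₂.comp (h1.prodMk h1)
    have h2 := continuous_finsetSum s fun j _ => h1 j
    have h3 := h2.const_smul T
    exact continuous_snd.add h3
  have := hcont.tendsto (D, Q) (Metric.ball_mem_nhds (penalizedForm s T D Q) (half_pos hc))
  filter_upwards [this] with w hw v
  replace hw : ‖penalizedForm s T w.1 w.2 - penalizedForm s T D Q‖ < c / 2 := mem_ball_iff_norm.1 hw
  have h1 := ((penalizedForm s T w.1 w.2 - penalizedForm s T D Q).le_opNorm₂ v v)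
  simp only [sub_apply, Real.norm_eq_abs] at h1
  have h2 := neg_abs_le (penalizedForm s T w.1 w.2 v v - penalizedForm s T D Q v v)
  have h3 : ‖penalizedForm s T w.1 w.2 - penalizedForm s T D Q‖ * ‖v‖ * ‖v‖ ≤ c / 2 * ‖v‖ * ‖v‖ := by
    gcongr
  nlinarith [h v]

end Coercive

/-! ### Calculus -/

section Calculus

set_option maxSynthPendingDepth 3

variable {X : Type*} [NormedAddCommGroup X] [NormedSpace ℝ X]

/-- Second-order sufficient condition for an unconstrained local minimum. -/
theorem isLocalMin_of_fderiv_fderiv_coercive {f : X → ℝ} {f' : X → X →L[ℝ] ℝ}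
    {f'' : X →L[ℝ] X →L[ℝ] ℝ} {x : X} (hf : ∀ y, HasFDerivAt f (f' y) y) (h0 : f' x = 0)
    (hf' : HasFDerivAt f' f'' x) {c : ℝ} (hc : 0 < c) (hpos : ∀ v, c * ‖v‖ ^ 2 ≤ f'' v v) :
    IsLocalMin f x := by
  have h1 := hf'.isLittleO.def hc
  rw [Metric.eventually_nhds_iff_ball] at h1
  obtain ⟨r, hr, h1⟩ := h1
  -- `f' y (y - x)` differs from `f'' (y - x) (y - x) ≥ c ‖y - x‖²` by at most `c ‖y - x‖²`, so `f`
  -- does not decrease along rays leaving `x`.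
  have h2 : ∀ y ∈ Metric.ball x r, 0 ≤ f' y (y - x) := fun y hy => by
    have h3 := h1 y hy
    rw [h0, sub_zero] at h3
    have h4 := (f' y - f'' (y - x)).le_opNorm (y - x)
    have h5 := hpos (y - x)
    simp only [sub_apply, Real.norm_eq_abs] at h4
    have h6 := neg_abs_le (f' y (y - x) - f'' (y - x) (y - x))
    have h7 : ‖f' y - f'' (y - x)‖ * ‖y - x‖ ≤ c * ‖y - x‖ * ‖y - x‖ := by gcongr
    nlinarith
  filter_upwards [Metric.ball_mem_nhds x hr] with y hy
  let g : ℝ → ℝ := fun t => f (x + t • (y - x))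
  have hg : ∀ t, HasDerivAt g (f' (x + t • (y - x)) (y - x)) t := fun t => by
    have ha : HasDerivAt (fun t : ℝ => x + t • (y - x)) (y - x) t := by
      simpa using ((hasDerivAt_id t).smul_const (y - x)).const_add x
    exact (hf (x + t • (y - x))).comp_hasDerivAt t ha
  have hmono : MonotoneOn g (Set.Icc 0 1) := by
    refine monotoneOn_of_deriv_nonneg (convex_Icc 0 1) (fun t _ => (hg t).continuousAt.continuousWithinAt)
      (fun t _ => (hg t).differentiableAt.differentiableWithinAt) fun t ht => ?_
    rw [interior_Icc] at ht
    rw [(hg t).deriv]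
    have h3 := h2 (x + t • (y - x)) (by
      rw [mem_ball_iff_norm] at hy ⊢
      rw [add_sub_cancel_left, norm_smul, Real.norm_eq_abs, abs_of_pos ht.1]
      nlinarith [ht.2, norm_nonneg (y - x)])
    rw [add_sub_cancel_left, map_smul, smul_eq_mul] at h3
    exact nonneg_of_mul_nonneg_right h3 ht.1
  have := hmono (Set.left_mem_Icc.2 zero_le_one) (Set.right_mem_Icc.2 zero_le_one) zero_le_one
  simpa [g] using this

/-- A linear map that is injective on a finite-dimensional space is bounded below. -/
theorem exists_norm_le_of_injective {E F : Type*} [NormedAddCommGroup E] [NormedSpace ℝ E]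
    [FiniteDimensional ℝ E] [NormedAddCommGroup F] [NormedSpace ℝ F] (L : E →L[ℝ] F)
    (hL : ∀ v, L v = 0 → v = 0) : ∃ M > 0, ∀ v, ‖v‖ ≤ M * ‖L v‖ := by
  obtain ⟨K, hK, h⟩ := LinearMap.exists_antilipschitzWith (L : E →ₗ[ℝ] F)
    ((LinearMap.ker_eq_bot').2 hL)
  refine ⟨K, hK, fun v => ?_⟩
  simpa using h.le_mul_dist v 0

end Calculus

/-! ### The Lagrangian of a nonlinear program and its derivatives -/

section Lagrangian

set_option maxSynthPendingDepth 3

variable {X : Type*} [NormedAddCommGroup X] [NormedSpace ℝ X] {J : Type*} [Fintype J]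

/-- Derivative in `x` of `f x + ∑ j, κ j * h j x`. -/
noncomputable def lagGrad (f : X → ℝ) (h : J → X → ℝ) (x : X) (κ : J → ℝ) : X →L[ℝ] ℝ :=
  fderiv ℝ f x + ∑ j, κ j • fderiv ℝ (h j) x

/-- Second derivative in `x` of `f x + ∑ j, κ j * h j x`. -/
noncomputable def lagHess (f : X → ℝ) (h : J → X → ℝ) (x : X) (κ : J → ℝ) : X →L[ℝ] X →L[ℝ] ℝ :=
  fderiv ℝ (fderiv ℝ f) x + ∑ j, κ j • fderiv ℝ (fderiv ℝ (h j)) x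

variable {f : X → ℝ} {h : J → X → ℝ}

theorem hasStrictFDerivAt_fderiv (hf : ContDiff ℝ 2 f) (x : X) :
    HasStrictFDerivAt (fderiv ℝ f) (fderiv ℝ (fderiv ℝ f) x) x :=
  ((hf.fderiv_right (m := 1) (by norm_num)).contDiffAt).hasStrictFDerivAt (by norm_num)

theorem hasFDerivAt_lagrangian (hf : ContDiff ℝ 2 f) (hh : ∀ j, ContDiff ℝ 2 (h j)) (κ : J → ℝ)
    (x : X) : HasFDerivAt (fun y => f y + ∑ j, κ j * h j y) (lagGrad f h x κ) x := by
  have h1 := ((hf.differentiable (by norm_num)) x).hasFDerivAt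
  have h2 := fun j => (((hh j).differentiable (by norm_num)) x).hasFDerivAt
  exact h1.fun_add (HasFDerivAt.fun_sum fun j _ => (h2 j).const_mul (κ j))

theorem hasFDerivAt_lagGrad (hf : ContDiff ℝ 2 f) (hh : ∀ j, ContDiff ℝ 2 (h j)) (κ : J → ℝ)
    (x : X) : HasFDerivAt (fun y => lagGrad f h y κ) (lagHess f h x κ) x := by
  have h1 := (hasStrictFDerivAt_fderiv hf x).hasFDerivAt
  have h2 := fun j => (hasStrictFDerivAt_fderiv (hh j) x).hasFDerivAt
  exact h1.fun_add (HasFDerivAt.fun_sum fun j _ => (h2 j).const_smul (κ j))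

theorem fderiv_fderiv_lagrangian (hf : ContDiff ℝ 2 f) (hh : ∀ j, ContDiff ℝ 2 (h j)) (κ : J → ℝ)
    (x : X) : fderiv ℝ (fderiv ℝ fun y => f y + ∑ j, κ j * h j y) x = lagHess f h x κ := by
  have : (fderiv ℝ fun y => f y + ∑ j, κ j * h j y) = fun y => lagGrad f h y κ :=
    funext fun y => (hasFDerivAt_lagrangian hf hh κ y).fderiv
  rw [this, (hasFDerivAt_lagGrad hf hh κ x).fderiv]

/-- Derivative of `lagGrad` in all variables. -/
theorem hasStrictFDerivAt_lagGrad (hf : ContDiff ℝ 2 f) (hh : ∀ j, ContDiff ℝ 2 (h j)) (x : X)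
    (κ : J → ℝ) : HasStrictFDerivAt (fun w : X × (J → ℝ) => lagGrad f h w.1 w.2)
      ((lagHess f h x κ).comp (ContinuousLinearMap.fst ℝ X (J → ℝ)) +
        ∑ j, ((ContinuousLinearMap.proj j).comp (ContinuousLinearMap.snd ℝ X (J → ℝ))).smulRight
          (fderiv ℝ (h j) x)) (x, κ) := by
  have h1 : HasStrictFDerivAt (fun w : X × (J → ℝ) => fderiv ℝ f w.1) _ (x, κ) :=
    (hasStrictFDerivAt_fderiv hf x).comp (x, κ) hasStrictFDerivAt_fst
  have h2 : ∀ j, HasStrictFDerivAt (fun w : X × (J → ℝ) => fderiv ℝ (h j) w.1) _ (x, κ) := fun j =>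
    (hasStrictFDerivAt_fderiv (hh j) x).comp (x, κ) hasStrictFDerivAt_fst
  have h3 : ∀ j, HasStrictFDerivAt (fun w : X × (J → ℝ) => w.2 j)
      ((ContinuousLinearMap.proj j).comp (ContinuousLinearMap.snd ℝ X (J → ℝ))) (x, κ) := fun j =>
    ((ContinuousLinearMap.proj (R := ℝ) (φ := fun _ : J => ℝ) j).comp
      (ContinuousLinearMap.snd ℝ X (J → ℝ))).hasStrictFDerivAt
  have h4 := h1.fun_add (HasStrictFDerivAt.fun_sum (u := Finset.univ) fun j _ => (h3 j).smul (h2 j))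
  refine h4.congr_fderiv ?_
  ext w v <;>
  simp [lagHess, Finset.sum_add_distrib]

theorem continuous_lagHess (hf : ContDiff ℝ 2 f) (hh : ∀ j, ContDiff ℝ 2 (h j)) :
    Continuous fun w : X × (J → ℝ) => lagHess f h w.1 w.2 := by
  have h1 := (hf.fderiv_right (m := 1) (by norm_num)).continuous_fderiv (by norm_num)
  have h2 := fun j => ((hh j).fderiv_right (m := 1) (by norm_num)).continuous_fderiv (by norm_num)
  unfold lagHess
  fun_prop

end Lagrangian

/-! ### Regular stationary points and the proximal local problem -/

section LocalProblem

set_option maxSynthPendingDepth 3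

variable {X : Type*} [NormedAddCommGroup X] [NormedSpace ℝ X] {J : Type*} [Fintype J]

/-- `x` is a stationary point of `f y + a y` subject to `h y ≤ 0` with multiplier `κ`, at which the
active gradients are linearly independent, strict complementarity holds, and the Hessian of the
Lagrangian is positive on the null space of the active constraints. -/
structure RegularPoint (f : X → ℝ) (h : J → X → ℝ) (x : X) (a : X →L[ℝ] ℝ) (κ : J → ℝ) : Prop where
  smooth_f : ContDiff ℝ 2 f
  smooth_h : ∀ j, ContDiff ℝ 2 (h j)
  stationary : lagGrad f h x κ + a = 0
  feasible : ∀ j, h j x ≤ 0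
  pos : ∀ j, h j x = 0 → 0 < κ j
  zero : ∀ j, h j x ≠ 0 → κ j = 0
  indep : ∀ k : J → ℝ, (∀ j, h j x ≠ 0 → k j = 0) → ∑ j, k j • fderiv ℝ (h j) x = 0 → k = 0
  sosc : ∀ v, v ≠ 0 → (∀ j, h j x = 0 → fderiv ℝ (h j) x v = 0) → 0 < lagHess f h x κ v v

/-- The KKT conditions of `min f y + a y + (1/2) B (y - z) (y - z)` subject to `h y ≤ 0`. -/
structure ProxKKT (f : X → ℝ) (h : J → X → ℝ) (B : X →L[ℝ] X →L[ℝ] ℝ) (z : X) (a : X →L[ℝ] ℝ)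
    (x : X) (κ : J → ℝ) : Prop where
  stationary : lagGrad f h x κ + a + B (x - z) = 0
  feasible : ∀ j, h j x ≤ 0
  nonneg : ∀ j, 0 ≤ κ j
  compl : ∀ j, κ j * h j x = 0

open Classical in
/-- The nonlinear map whose level sets describe stationary points with active set `s`. -/
noncomputable def kktMap (s : Finset J) (f : X → ℝ) (h : J → X → ℝ) (B : X →L[ℝ] X →L[ℝ] ℝ)
    (w : X × (J → ℝ)) : (X →L[ℝ] ℝ) × (J → ℝ) :=
  (lagGrad f h w.1 w.2 + B w.1, fun j => if j ∈ s then h j w.1 else w.2 j)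

open Classical in
/-- The derivative of `kktMap`. -/
noncomputable def kktDeriv (s : Finset J) (f : X → ℝ) (h : J → X → ℝ) (B : X →L[ℝ] X →L[ℝ] ℝ)
    (x : X) (κ : J → ℝ) : (X × (J → ℝ)) →L[ℝ] (X →L[ℝ] ℝ) × (J → ℝ) :=
  ((lagHess f h x κ).comp (ContinuousLinearMap.fst ℝ X (J → ℝ)) +
      ∑ j, ((ContinuousLinearMap.proj j).comp (ContinuousLinearMap.snd ℝ X (J → ℝ))).smulRight
        (fderiv ℝ (h j) x) + B.comp (ContinuousLinearMap.fst ℝ X (J → ℝ))).prod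
    (ContinuousLinearMap.pi fun j => if j ∈ s
      then (fderiv ℝ (h j) x).comp (ContinuousLinearMap.fst ℝ X (J → ℝ))
      else (ContinuousLinearMap.proj j).comp (ContinuousLinearMap.snd ℝ X (J → ℝ)))

variable {f : X → ℝ} {h : J → X → ℝ}

/-- Strictness yields both a lower Lipschitz bound near the solution (stability) and local
surjectivity (existence). The set `s` is fixed, so the choice of rows causes no loss of smoothness.
-/
theorem hasStrictFDerivAt_kktMap (hf : ContDiff ℝ 2 f) (hh : ∀ j, ContDiff ℝ 2 (h j))
    (s : Finset J) (B : X →L[ℝ] X →L[ℝ] ℝ) (x : X) (κ : J → ℝ) :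
    HasStrictFDerivAt (kktMap s f h B) (kktDeriv s f h B x κ) (x, κ) := by
  refine HasStrictFDerivAt.prodMk ((hasStrictFDerivAt_lagGrad hf hh x κ).fun_add
    (B.comp (ContinuousLinearMap.fst ℝ X (J → ℝ))).hasStrictFDerivAt) ?_
  rw [hasStrictFDerivAt_pi']
  intro j
  by_cases hj : j ∈ s
  · simp only [hj, if_true]
    have h1 : HasStrictFDerivAt (h j) (fderiv ℝ (h j) x) x :=
      (hh j).contDiffAt.hasStrictFDerivAt (by norm_num)
    refine (h1.comp (x, κ) hasStrictFDerivAt_fst).congr_fderiv ?_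
    ext <;> simp [hj]
  · simp only [hj, if_false]
    refine ((ContinuousLinearMap.proj (R := ℝ) (φ := fun _ : J => ℝ) j).comp
      (ContinuousLinearMap.snd ℝ X (J → ℝ))).hasStrictFDerivAt.congr_fderiv ?_
    ext <;> simp [hj]

variable {xs : X} {as : X →L[ℝ] ℝ} {κs : J → ℝ}

/-- Pair the first row with `v`. For every `j` either the constraint derivative at `v` or `k j` is
zero, so the multiplier terms drop out and the Hessian term plus `B v v ≥ 0` must vanish. SOSC gives
`v = 0`, and independence of the active gradients then gives `k = 0`. -/
theorem RegularPoint.kktDeriv_injective (R : RegularPoint f h xs as κs) {s : Finset J}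
    (hs : ∀ j, j ∈ s ↔ h j xs = 0) {B : X →L[ℝ] X →L[ℝ] ℝ} (hB : ∀ v, 0 ≤ B v v) :
    ∀ w, kktDeriv s f h B xs κs w = 0 → w = 0 := by
  classical
  rintro ⟨v, k⟩ hw
  have h1 : lagHess f h xs κs v + ∑ j, k j • fderiv ℝ (h j) xs + B v = 0 := by
    simpa [kktDeriv] using congrArg Prod.fst hw
  have h2 : ∀ j, (if j ∈ s then fderiv ℝ (h j) xs v else k j) = 0 := fun j => by
    have := congrFun (congrArg Prod.snd hw) j
    by_cases hj : j ∈ s <;> simpa [kktDeriv, hj] using this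
  have h3 : ∀ j, h j xs = 0 → fderiv ℝ (h j) xs v = 0 := fun j hj => by
    simpa [(hs j).2 hj] using h2 j
  have h4 : ∀ j, h j xs ≠ 0 → k j = 0 := fun j hj => by
    have : j ∉ s := fun h => hj ((hs j).1 h)
    simpa [this] using h2 j
  have hv : v = 0 := by
    by_contra hv
    have h5 := R.sosc v hv h3
    have h6 := congrArg (fun L : X →L[ℝ] ℝ => L v) h1
    have h7 : ∑ j, k j * fderiv ℝ (h j) xs v = 0 := Finset.sum_eq_zero fun j _ => by
      by_cases hj : h j xs = 0
      · simp [h3 j hj]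
      · simp [h4 j hj]
    simp only [add_apply, sum_apply, smul_apply, smul_eq_mul, h7, zero_apply] at h6
    linarith [hB v]
  subst hv
  have hk : k = 0 := R.indep k h4 (by simpa using h1)
  rw [hk]; rfl

/-- The dual of `X` has the dimension of `X`, so injectivity is enough for invertibility. -/
theorem RegularPoint.exists_kktDeriv_equiv [FiniteDimensional ℝ X] (R : RegularPoint f h xs as κs)
    {s : Finset J} (hs : ∀ j, j ∈ s ↔ h j xs = 0) {B : X →L[ℝ] X →L[ℝ] ℝ}
    (hB : ∀ v, 0 ≤ B v v) : ∃ e : (X × (J → ℝ)) ≃L[ℝ] (X →L[ℝ] ℝ) × (J → ℝ),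
      (e : (X × (J → ℝ)) →L[ℝ] (X →L[ℝ] ℝ) × (J → ℝ)) = kktDeriv s f h B xs κs := by
  have hdual : Module.finrank ℝ (X →L[ℝ] ℝ) = Module.finrank ℝ X := by
    rw [← (LinearMap.toContinuousLinearMap (𝕜 := ℝ) (E := X) (F' := ℝ)).finrank_eq]
    exact Subspace.dual_finrank_eq
  have hinj : Function.Injective (kktDeriv s f h B xs κs).toLinearMap := by
    rw [← LinearMap.ker_eq_bot]
    exact LinearMap.ker_eq_bot'.2 (R.kktDeriv_injective hs hB)
  refine ⟨(LinearMap.linearEquivOfInjective _ hinj (by simp [hdual])).toContinuousLinearEquiv, ?_⟩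
  exact ContinuousLinearMap.ext fun w => rfl

/-- Multipliers supported on the active set are controlled by the combination of gradients. -/
theorem RegularPoint.exists_multiplier_bound (R : RegularPoint f h xs as κs) :
    ∃ M > 0, ∀ᶠ x in 𝓝 xs, ∀ k : J → ℝ, (∀ j, h j xs ≠ 0 → k j = 0) →
      ‖k‖ ≤ M * ‖∑ j, k j • fderiv ℝ (h j) x‖ := by
  classical
  -- The second component records the inactive entries of `k`, which makes `L` injective on all of
  -- `J → ℝ`.
  let L : (J → ℝ) →L[ℝ] (X →L[ℝ] ℝ) × (J → ℝ) :=
    (∑ j, (ContinuousLinearMap.proj (R := ℝ) (φ := fun _ : J => ℝ) j).smulRight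
      (fderiv ℝ (h j) xs)).prod
      (ContinuousLinearMap.pi fun j => if h j xs = 0 then 0 else ContinuousLinearMap.proj j)
  have hL1 : ∀ k, (L k).1 = ∑ j, k j • fderiv ℝ (h j) xs := fun k => by simp [L]
  have hL2 : ∀ k j, (L k).2 j = if h j xs = 0 then 0 else k j := fun k j => by
    by_cases hj : h j xs = 0 <;> simp [L, hj]
  obtain ⟨M, hM, hMle⟩ := exists_norm_le_of_injective L fun k hk => by
    refine R.indep k (fun j hj => ?_) ?_
    · have := hL2 k j
      rw [hk] at this
      simpa [hj] using this.symm
    · rw [← hL1, hk]; rfl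
  -- Where the gradients have moved by less than `1 / (2 * M)` in total, the change costs at most
  -- `‖k‖ / 2`, which is absorbed on the left.
  refine ⟨2 * M, by positivity, ?_⟩
  have hcont : Tendsto (fun x => ∑ j, ‖fderiv ℝ (h j) x - fderiv ℝ (h j) xs‖) (𝓝 xs) (𝓝 0) := by
    have : Continuous fun x => ∑ j, ‖fderiv ℝ (h j) x - fderiv ℝ (h j) xs‖ := by
      have := fun j => (R.smooth_h j).continuous_fderiv (by norm_num)
      fun_prop
    simpa using this.tendsto xs
  filter_upwards [hcont.eventually (gt_mem_nhds (show (0 : ℝ) < 1 / (2 * M) by positivity))]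
    with x hx k hk
  have h1 : ‖L k‖ = ‖∑ j, k j • fderiv ℝ (h j) xs‖ := by
    have h2 : (L k).2 = 0 := funext fun j => by
      rw [hL2]; split_ifs with hj
      · rfl
      · exact hk j hj
    rw [Prod.norm_def, h2, hL1]
    simp
  have h3 : ‖∑ j, k j • fderiv ℝ (h j) xs‖ ≤ ‖∑ j, k j • fderiv ℝ (h j) x‖
      + ‖k‖ * ∑ j, ‖fderiv ℝ (h j) x - fderiv ℝ (h j) xs‖ := by
    have h4 : ∑ j, k j • fderiv ℝ (h j) xs = ∑ j, k j • fderiv ℝ (h j) x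
        - ∑ j, k j • (fderiv ℝ (h j) x - fderiv ℝ (h j) xs) := by
      rw [← Finset.sum_sub_distrib]
      exact Finset.sum_congr rfl fun j _ => by rw [smul_sub]; abel
    rw [h4]
    refine (norm_sub_le _ _).trans (add_le_add le_rfl ?_)
    rw [Finset.mul_sum]
    refine (norm_sum_le _ _).trans (Finset.sum_le_sum fun j _ => ?_)
    rw [norm_smul]
    exact mul_le_mul_of_nonneg_right (norm_le_pi_norm k j) (norm_nonneg _)
  have h5 := hMle k
  rw [h1] at h5
  have h6 : ‖k‖ * ∑ j, ‖fderiv ℝ (h j) x - fderiv ℝ (h j) xs‖ ≤ ‖k‖ * (1 / (2 * M)) := by gcongr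
  have h7 : M * (‖k‖ * (1 / (2 * M))) = ‖k‖ / 2 := by field_simp
  have h8 : M * ‖∑ j, k j • fderiv ℝ (h j) xs‖ ≤ M * (‖∑ j, k j • fderiv ℝ (h j) x‖
      + ‖k‖ * (1 / (2 * M))) := by gcongr; linarith
  rw [mul_add, h7] at h8
  linarith

/-- Near a regular point, the active set of a stationary point of the proximal problem is the one of
the regular point, and its distance to it is proportional to the perturbation. -/
theorem RegularPoint.proxKKT_estimate [FiniteDimensional ℝ X] (R : RegularPoint f h xs as κs)
    {B : X →L[ℝ] X →L[ℝ] ℝ} (hB : ∀ v, 0 ≤ B v v) :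
    ∃ δ > 0, ∃ χ > 0, ∀ z a x κ, ‖x - z‖ < δ → ‖z - xs‖ < δ → ‖a - as‖ < δ →
      ProxKKT f h B z a x κ →
      (∀ j, h j x = 0 ↔ h j xs = 0) ∧ ‖x - xs‖ ≤ χ * (‖z - xs‖ + ‖a - as‖) ∧
        ‖κ - κs‖ ≤ χ * (‖z - xs‖ + ‖a - as‖) := by
  classical
  let s : Finset J := Finset.univ.filter fun j => h j xs = 0
  have hs : ∀ j, j ∈ s ↔ h j xs = 0 := fun j => by simp [s]
  obtain ⟨e, he⟩ := R.exists_kktDeriv_equiv hs hB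
  have hG := hasStrictFDerivAt_kktMap R.smooth_f R.smooth_h s B xs κs
  -- A map that an invertible linear map approximates with constant below `‖e⁻¹‖⁻¹` is bounded
  -- below. On a trivial space this reciprocal is `0`, hence the separate case.
  obtain ⟨K, U, hU, hK⟩ : ∃ K : NNReal, ∃ U ∈ 𝓝 (xs, κs),
      AntilipschitzWith K (U.domRestrict (kktMap s f h B)) := by
    rw [← he] at hG
    by_cases hsub : Subsingleton (X × (J → ℝ))
    · obtain ⟨U, hU, hc⟩ := hG.approximates_deriv_on_nhds (c := 0) (Or.inl hsub)
      exact ⟨_, U, hU, hc.antilipschitz (Or.inl hsub)⟩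
    · have hpos : 0 < ‖(e.symm : ((X →L[ℝ] ℝ) × (J → ℝ)) →L[ℝ] (X × (J → ℝ)))‖₊⁻¹ := by
        have : Nontrivial (X × (J → ℝ)) := not_subsingleton_iff_nontrivial.1 hsub
        exact inv_pos.2 e.nnnorm_symm_pos
      obtain ⟨U, hU, hc⟩ := hG.approximates_deriv_on_nhds (Or.inr (half_pos hpos))
      exact ⟨_, U, hU, hc.antilipschitz (Or.inr (NNReal.half_lt_self hpos.ne'))⟩
  have hU' : ∀ᶠ w in 𝓝 (xs, κs), w ∈ U ∧ ∀ j, h j xs = 0 → 0 < w.2 j := by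
    refine (eventually_mem_set.2 hU).and ((eventually_all).2 fun j => ?_)
    by_cases hj : h j xs = 0
    · have : Continuous fun w : X × (J → ℝ) => w.2 j := by fun_prop
      filter_upwards [this.tendsto (xs, κs) (lt_mem_nhds (R.pos j hj))] with w hw _ using hw
    · exact Eventually.of_forall fun w h => absurd h hj
  obtain ⟨r, hr, hU'⟩ := Metric.eventually_nhds_iff.1 hU'
  obtain ⟨M, hM, hMx⟩ := R.exists_multiplier_bound
  have hinact : ∀ᶠ x in 𝓝 xs, ∀ j, h j xs ≠ 0 → h j x ≠ 0 := by
    refine eventually_all.2 fun j => ?_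
    by_cases hj : h j xs = 0
    · exact Eventually.of_forall fun w h => absurd hj h
    · filter_upwards [(R.smooth_h j).continuous.continuousAt.eventually_ne hj] with x hx _ using hx
  have hgrad : ∀ᶠ x in 𝓝 xs, ‖lagGrad f h x κs - lagGrad f h xs κs‖ < r / (4 * M) := by
    have hc := (hasFDerivAt_lagGrad R.smooth_f R.smooth_h κs xs).continuousAt
    have := hc.eventually (Metric.ball_mem_nhds _ (show 0 < r / (4 * M) by positivity))
    filter_upwards [this] with x hx using mem_ball_iff_norm.1 hx
  obtain ⟨δ₀, hδ₀, hnear⟩ := Metric.eventually_nhds_iff.1 (hMx.and (hinact.and hgrad))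
  -- Since `x` lies within `2 * δ` of `xs`, the first two entries keep it in the good neighbourhood.
  -- The last two keep `‖a - as‖` and `‖B (x - z)‖` below `r / (4 * M)`; with the gradient change
  -- `hgrad` the three terms leave the multiplier error below `3 / 4 * r`.
  let δ : ℝ := min (δ₀ / 2) (min (r / 2) (min (r / (4 * M)) (r / (4 * M * (‖B‖ + 1)))))
  have hδ : 0 < δ := by positivity
  have hd1 : δ ≤ δ₀ / 2 := min_le_left _ _
  have hd2 : δ ≤ r / 2 := (min_le_right _ _).trans (min_le_left _ _)
  have hd3 : δ ≤ r / (4 * M) := (min_le_right _ _).trans ((min_le_right _ _).trans (min_le_left _ _))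
  have hd4 : δ ≤ r / (4 * M * (‖B‖ + 1)) :=
    (min_le_right _ _).trans ((min_le_right _ _).trans (min_le_right _ _))
  refine ⟨δ, hδ, K * (‖B‖ + 1) + 1, by positivity, fun z a x κ hxz hz ha hkkt => ?_⟩
  have hx : ‖x - xs‖ < 2 * δ := by
    calc ‖x - xs‖ = ‖(x - z) + (z - xs)‖ := by congr 1; abel
      _ ≤ ‖x - z‖ + ‖z - xs‖ := norm_add_le _ _
      _ < 2 * δ := by linarith
  obtain ⟨hmul, hina, hgr⟩ := hnear (y := x) (by rw [dist_eq_norm]; linarith)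
  have hκ0 : ∀ j, h j xs ≠ 0 → κ j = 0 := fun j hj =>
    (mul_eq_zero.1 (hkkt.compl j)).resolve_right (hina j hj)
  -- No closeness of `κ` is assumed. The difference `κ - κs` is supported on the active set, and by
  -- the two stationarity conditions its combination of gradients is small.
  have hκ : ‖κ - κs‖ < r := by
    have h1 := hmul (κ - κs) fun j hj => by simp [hκ0 j hj, R.zero j hj]
    have h2 : ∑ j, (κ - κs) j • fderiv ℝ (h j) x
        = -(lagGrad f h x κs - lagGrad f h xs κs) - (a - as) - B (x - z) := by
      have h3 : ∑ j, (κ - κs) j • fderiv ℝ (h j) x = lagGrad f h x κ - lagGrad f h x κs := by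
        simp only [lagGrad, Pi.sub_apply, sub_smul, Finset.sum_sub_distrib]; abel
      have h4 : lagGrad f h x κ = -(a + B (x - z)) := eq_neg_of_add_eq_zero_left (by
        rw [← add_assoc]; exact hkkt.stationary)
      have h5 : lagGrad f h xs κs = -as := eq_neg_of_add_eq_zero_left R.stationary
      rw [h3, h4, h5]; abel
    have h3 : ‖B (x - z)‖ < r / (4 * M) := by
      refine (B.le_opNorm _).trans_lt ?_
      have h6 : ‖B‖ * ‖x - z‖ ≤ ‖B‖ * (r / (4 * M * (‖B‖ + 1))) := by gcongr; linarith
      have h7 : ‖B‖ * (r / (4 * M * (‖B‖ + 1))) < (‖B‖ + 1) * (r / (4 * M * (‖B‖ + 1))) := by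
        gcongr; linarith
      have h8 : (‖B‖ + 1) * (r / (4 * M * (‖B‖ + 1))) = r / (4 * M) := by field_simp
      linarith
    have h4 : ‖∑ j, (κ - κs) j • fderiv ℝ (h j) x‖ < 3 * (r / (4 * M)) := by
      rw [h2]
      refine (norm_sub_le _ _).trans_lt ?_
      have := norm_sub_le (-(lagGrad f h x κs - lagGrad f h xs κs)) (a - as)
      rw [norm_neg] at this
      linarith
    calc ‖κ - κs‖ ≤ _ := h1
      _ < M * (3 * (r / (4 * M))) := by gcongr
      _ = 3 / 4 * r := by field_simp
      _ < r := by linarith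
  have hdist : dist ((x, κ) : X × (J → ℝ)) (xs, κs) < r := by
    rw [Prod.dist_eq, max_lt_iff]
    exact ⟨by rw [dist_eq_norm]; linarith, by rw [dist_eq_norm]; exact hκ⟩
  obtain ⟨hmem, hpos⟩ := hU' hdist
  -- Strict complementarity at work: a multiplier near a positive one is positive, so
  -- complementarity makes its constraint active.
  have hact : ∀ j, h j xs = 0 → h j x = 0 := fun j hj =>
    (mul_eq_zero.1 (hkkt.compl j)).resolve_left (hpos j hj).ne'
  have hmems : ((xs, κs) : X × (J → ℝ)) ∈ U := mem_of_mem_nhds hU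
  have hGx : kktMap s f h B (x, κ) = (B z - a, 0) := by
    refine Prod.ext ?_ (funext fun j => ?_)
    · have := hkkt.stationary
      rw [map_sub] at this
      rw [← sub_eq_zero, ← this]
      simp only [kktMap]; abel
    · by_cases hj : h j xs = 0
      · simp [kktMap, (hs j).2 hj, hact j hj]
      · simp [kktMap, hs, hj, hκ0 j hj]
  have hGs : kktMap s f h B (xs, κs) = (B xs - as, 0) := by
    refine Prod.ext ?_ (funext fun j => ?_)
    · rw [← sub_eq_zero, ← R.stationary]
      simp only [kktMap]; abel
    · by_cases hj : h j xs = 0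
      · simp [kktMap, (hs j).2 hj, hj]
      · simp [kktMap, hs, hj, R.zero j hj]
  have hmain : ‖((x, κ) : X × (J → ℝ)) - (xs, κs)‖ ≤
      (K * (‖B‖ + 1) + 1) * (‖z - xs‖ + ‖a - as‖) := by
    have h1 := hK.le_mul_dist ⟨(x, κ), hmem⟩ ⟨(xs, κs), hmems⟩
    have h2 : dist (kktMap s f h B (x, κ)) (kktMap s f h B (xs, κs))
        ≤ (‖B‖ + 1) * (‖z - xs‖ + ‖a - as‖) := by
      rw [hGx, hGs, Prod.dist_eq, dist_self, max_eq_left dist_nonneg, dist_eq_norm]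
      calc ‖B z - a - (B xs - as)‖ = ‖B (z - xs) - (a - as)‖ := by
            congr 1; rw [map_sub]; abel
        _ ≤ ‖B‖ * ‖z - xs‖ + ‖a - as‖ := (norm_sub_le _ _).trans (by gcongr; exact B.le_opNorm _)
        _ ≤ _ := by nlinarith [norm_nonneg B, norm_nonneg (z - xs), norm_nonneg (a - as)]
    rw [← dist_eq_norm]
    calc dist ((x, κ) : X × (J → ℝ)) (xs, κs) ≤ K * ((‖B‖ + 1) * (‖z - xs‖ + ‖a - as‖)) :=
          h1.trans (mul_le_mul_of_nonneg_left h2 K.2)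
      _ ≤ _ := by nlinarith [norm_nonneg (z - xs), norm_nonneg (a - as)]
  refine ⟨fun j => ⟨fun hj => ?_, hact j⟩, ?_, ?_⟩
  · by_contra hne
    exact hina j hne hj
  · exact (norm_fst_le (((x, κ) : X × (J → ℝ)) - (xs, κs))).trans hmain
  · exact (norm_snd_le (((x, κ) : X × (J → ℝ)) - (xs, κs))).trans hmain

end LocalProblem

/-! ### Existence of solutions of the proximal local problem. -/

section ProxExistence

set_option maxSynthPendingDepth 3

variable {X : Type*} [NormedAddCommGroup X] [NormedSpace ℝ X] {J : Type*} [Fintype J]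
  {f : X → ℝ} {h : J → X → ℝ}

/-- Derivative of the proximal term. -/
theorem hasFDerivAt_proxTerm {B : X →L[ℝ] X →L[ℝ] ℝ} (hsymm : ∀ u v, B u v = B v u) (z y : X) :
    HasFDerivAt (fun y => 1 / 2 * B (y - z) (y - z)) (B (y - z)) y := by
  have h1 : HasFDerivAt (fun y => y - z) (ContinuousLinearMap.id ℝ X) y :=
    (hasFDerivAt_id y).sub_const z
  have h2 : HasFDerivAt (fun y => B (y - z)) B y :=
    (B.hasFDerivAt.comp y h1).congr_fderiv B.comp_id
  refine ((h2.clm_apply h1).const_mul (1 / 2)).congr_fderiv ?_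
  ext v
  simp [hsymm v]
  ring

/-- Second-order sufficient condition: a stationary point with strictly positive multipliers whose
penalized Hessian is coercive is a local minimizer. -/
theorem ProxKKT.isLocalMinOn (hf : ContDiff ℝ 2 f) (hh : ∀ j, ContDiff ℝ 2 (h j))
    {B : X →L[ℝ] X →L[ℝ] ℝ} (hsymm : ∀ u v, B u v = B v u) {z x : X} {a : X →L[ℝ] ℝ} {κ : J → ℝ}
    (hkkt : ProxKKT f h B z a x κ) {s : Finset J} (hs : ∀ j ∈ s, h j x = 0)
    (hpos : ∀ j ∈ s, 0 < κ j) {T c : ℝ} (hc : 0 < c)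
    (hcoer : ∀ v, c * ‖v‖ ^ 2 ≤
      penalizedForm s T (fun j => fderiv ℝ (h j) x) (lagHess f h x κ + B) v v) :
    IsLocalMinOn (fun y => f y + a y + 1 / 2 * B (y - z) (y - z)) {y | ∀ j, h j y ≤ 0} x := by
  classical
  have hdh : ∀ j y, HasFDerivAt (h j) (fderiv ℝ (h j) y) y := fun j y =>
    (((hh j).differentiable (by norm_num)) y).hasFDerivAt
  -- Augmented Lagrangian. As `h j x = 0` on `s`, the squares add exactly `T • D j ⊗ D j` to the
  -- Hessian at `x`, so `ψ` has an unconstrained local minimum there. At feasible points near `x` it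
  -- lies below the objective, with equality at `x`.
  let ψ : X → ℝ := fun y => (f y + ∑ j, κ j * h j y) + (a y + 1 / 2 * B (y - z) (y - z))
    + ∑ j ∈ s, T / 2 * (h j y * h j y)
  let ψ' : X → X →L[ℝ] ℝ := fun y => lagGrad f h y κ + (a + B (y - z))
    + ∑ j ∈ s, T • (h j y • fderiv ℝ (h j) y)
  have hψ : ∀ y, HasFDerivAt ψ (ψ' y) y := fun y => by
    refine ((hasFDerivAt_lagrangian hf hh κ y).fun_add
      (a.hasFDerivAt.fun_add (hasFDerivAt_proxTerm hsymm z y))).fun_add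
      (HasFDerivAt.fun_sum fun j _ => ?_)
    refine (((hdh j y).mul (hdh j y)).const_mul (T / 2)).congr_fderiv ?_
    ext v
    simp
    ring
  have hψ' : HasFDerivAt ψ'
      (penalizedForm s T (fun j => fderiv ℝ (h j) x) (lagHess f h x κ + B)) x := by
    have h1 : HasFDerivAt (fun y => a + B (y - z)) B x := by
      have h1 : HasFDerivAt (fun y => y - z) (ContinuousLinearMap.id ℝ X) x :=
        (hasFDerivAt_id x).sub_const z
      simpa using (B.hasFDerivAt.comp x h1).const_add a
    have h2 : ∀ j ∈ s, HasFDerivAt (fun y => T • (h j y • fderiv ℝ (h j) y))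
        (T • (fderiv ℝ (h j) x).smulRight (fderiv ℝ (h j) x)) x := fun j hj => by
      refine (((hdh j x).smul (hasStrictFDerivAt_fderiv (hh j) x).hasFDerivAt).const_smul
        T).congr_fderiv ?_
      rw [hs j hj, zero_smul, zero_add]
    refine (((hasFDerivAt_lagGrad hf hh κ x).fun_add h1).fun_add
      (HasFDerivAt.fun_sum h2)).congr_fderiv ?_
    rw [penalizedForm, Finset.smul_sum]
  have hψ0 : ψ' x = 0 := by
    have h1 : ∑ j ∈ s, T • (h j x • fderiv ℝ (h j) x) = 0 :=
      Finset.sum_eq_zero fun j hj => by rw [hs j hj, zero_smul, smul_zero]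
    simp only [ψ', h1, add_zero]
    rw [← add_assoc]
    exact hkkt.stationary
  have hmin := isLocalMin_of_fderiv_fderiv_coercive hψ hψ0 hψ' hc hcoer
  -- This makes `κ j + T / 2 * h j y` positive, so that its product with `h j y ≤ 0` is nonpositive.
  have hsmall : ∀ᶠ y in 𝓝 x, ∀ j ∈ s, |T / 2 * h j y| < κ j := by
    refine (Finset.eventually_all s).2 fun j hj => ?_
    have hcont : Continuous fun y => |T / 2 * h j y| := by
      have := (hh j).continuous
      fun_prop
    exact hcont.continuousAt.eventually (gt_mem_nhds (by simpa [hs j hj] using hpos j hj))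
  have hx : ψ x = f x + a x + 1 / 2 * B (x - z) (x - z) := by
    have h1 : ∑ j ∈ s, T / 2 * (h j x * h j x) = 0 :=
      Finset.sum_eq_zero fun j hj => by rw [hs j hj]; simp
    have h2 : ∑ j, κ j * h j x = 0 := Finset.sum_eq_zero fun j _ => hkkt.compl j
    simp only [ψ, h1, h2]; ring
  filter_upwards [nhdsWithin_le_nhds hmin, nhdsWithin_le_nhds hsmall, self_mem_nhdsWithin]
    with y h1 h2 h3
  rw [← hx]
  refine h1.trans ?_
  have h4 : ∑ j, κ j * h j y ≤ ∑ j ∈ s, κ j * h j y := by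
    rw [← Finset.sum_sdiff (Finset.subset_univ s)]
    have : ∑ j ∈ Finset.univ \ s, κ j * h j y ≤ 0 :=
      Finset.sum_nonpos fun j _ => mul_nonpos_of_nonneg_of_nonpos (hkkt.nonneg j) (h3 j)
    linarith
  have h5 : ∑ j ∈ s, κ j * h j y + ∑ j ∈ s, T / 2 * (h j y * h j y) ≤ 0 := by
    rw [← Finset.sum_add_distrib]
    refine Finset.sum_nonpos fun j hj => ?_
    have h6 := neg_abs_le (T / 2 * h j y)
    have h7 := h2 j hj
    have : κ j * h j y + T / 2 * (h j y * h j y) = (κ j + T / 2 * h j y) * h j y := by ring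
    rw [this]
    exact mul_nonpos_of_nonneg_of_nonpos (by linarith) (h3 j)
  simp only [ψ]
  linarith

/-- Near a regular point the proximal problem has a solution. -/
theorem RegularPoint.exists_proxKKT [FiniteDimensional ℝ X] {xs : X} {as : X →L[ℝ] ℝ} {κs : J → ℝ}
    (R : RegularPoint f h xs as κs) {B : X →L[ℝ] X →L[ℝ] ℝ} (hB : ∀ v, 0 ≤ B v v)
    (hsymm : ∀ u v, B u v = B v u) {δ : ℝ} (hδ : 0 < δ) :
    ∃ ε > 0, ∀ z a, ‖z - xs‖ < ε → ‖a - as‖ < ε → ∃ x κ, ProxKKT f h B z a x κ ∧ ‖x - z‖ < δ ∧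
      IsLocalMinOn (fun y => f y + a y + 1 / 2 * B (y - z) (y - z)) {y | ∀ j, h j y ≤ 0} x := by
  classical
  let s : Finset J := Finset.univ.filter fun j => h j xs = 0
  have hs : ∀ j, j ∈ s ↔ h j xs = 0 := fun j => by simp [s]
  obtain ⟨e, he⟩ := R.exists_kktDeriv_equiv hs hB
  have hG := hasStrictFDerivAt_kktMap R.smooth_f R.smooth_h s B xs κs
  rw [← he] at hG
  -- Neighbourhoods of `(xs, κs)` are mapped onto neighbourhoods of `(B xs - as, 0)`. For nearby
  -- data the value `(B z - a, 0)` is therefore attained at a point where the strict inequalities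
  -- and coercivity persist. Solving the equations for the guessed active set thus solves the whole
  -- KKT system.
  have hmap := hG.map_nhds_eq_of_equiv
  obtain ⟨T, -, c, hc, hcoer⟩ := exists_penalizedForm_coercive s (fun j => fderiv ℝ (h j) xs)
    (lagHess f h xs κs + B) fun v hv hv' => by
      have := R.sosc v hv fun j hj => hv' j ((hs j).2 hj)
      simp only [add_apply]
      linarith [hB v]
  have hcoer' : ∀ᶠ w : X × (J → ℝ) in 𝓝 (xs, κs), ∀ v, c / 2 * ‖v‖ ^ 2 ≤
      penalizedForm s T (fun j => fderiv ℝ (h j) w.1) (lagHess f h w.1 w.2 + B) v v := by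
    have h1 : Continuous fun w : X × (J → ℝ) =>
        ((fun j => fderiv ℝ (h j) w.1), lagHess f h w.1 w.2 + B) := by
      have h2 := continuous_lagHess R.smooth_f R.smooth_h
      have h3 : Continuous fun w : X × (J → ℝ) => fun j => fderiv ℝ (h j) w.1 :=
        continuous_pi fun j => ((R.smooth_h j).continuous_fderiv (by norm_num)).comp continuous_fst
      exact h3.prodMk (h2.add continuous_const)
    exact (h1.tendsto (xs, κs)).eventually (penalizedForm_pos_of_near s hc hcoer)
  have hpos : ∀ᶠ w : X × (J → ℝ) in 𝓝 (xs, κs), ∀ j, j ∈ s → 0 < w.2 j := by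
    refine eventually_all.2 fun j => ?_
    by_cases hj : j ∈ s
    · have : Continuous fun w : X × (J → ℝ) => w.2 j := by fun_prop
      filter_upwards [this.tendsto (xs, κs) (lt_mem_nhds (R.pos j ((hs j).1 hj)))] with w hw _ using hw
    · exact Eventually.of_forall fun w h => absurd h hj
  have hneg : ∀ᶠ w : X × (J → ℝ) in 𝓝 (xs, κs), ∀ j, j ∉ s → h j w.1 < 0 := by
    refine eventually_all.2 fun j => ?_
    by_cases hj : j ∈ s
    · exact Eventually.of_forall fun w h => absurd hj h
    · have h1 : Continuous fun w : X × (J → ℝ) => h j w.1 :=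
        (R.smooth_h j).continuous.comp continuous_fst
      have h2 : h j xs < 0 := lt_of_le_of_ne (R.feasible j) fun h => hj ((hs j).2 h)
      filter_upwards [h1.tendsto (xs, κs) (gt_mem_nhds h2)] with w hw _ using hw
  have hclose : ∀ᶠ w : X × (J → ℝ) in 𝓝 (xs, κs), ‖w.1 - xs‖ < δ / 2 := by
    have h1 : Continuous fun w : X × (J → ℝ) => ‖w.1 - xs‖ := by fun_prop
    exact h1.continuousAt.eventually (gt_mem_nhds (by simpa using half_pos hδ))
  have himg := image_mem_map (m := kktMap s f h B)
    (hcoer'.and (hpos.and (hneg.and hclose)))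
  have hGs : kktMap s f h B (xs, κs) = (B xs - as, 0) := by
    refine Prod.ext ?_ (funext fun j => ?_)
    · rw [← sub_eq_zero, ← R.stationary]
      simp only [kktMap]; abel
    · by_cases hj : h j xs = 0
      · simp [kktMap, (hs j).2 hj, hj]
      · simp [kktMap, hs, hj, R.zero j hj]
  rw [hmap, hGs] at himg
  have hcont : Continuous fun y : X × (X →L[ℝ] ℝ) => ((B y.1 - y.2, 0) : (X →L[ℝ] ℝ) × (J → ℝ)) := by
    fun_prop
  have hev := hcont.tendsto (xs, as) himg
  obtain ⟨ε, hε, hev⟩ := Metric.mem_nhds_iff.1 (mem_map.1 hev)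
  refine ⟨min ε (δ / 2), by positivity, fun z a hz ha => ?_⟩
  have hmem : ((z, a) : X × (X →L[ℝ] ℝ)) ∈ Metric.ball (xs, as) ε := by
    rw [Metric.mem_ball, Prod.dist_eq, max_lt_iff, dist_eq_norm, dist_eq_norm]
    exact ⟨hz.trans_le (min_le_left _ _), ha.trans_le (min_le_left _ _)⟩
  obtain ⟨⟨x, κ⟩, ⟨h1, h2, h3, h4⟩, h5⟩ := hev hmem
  have h6 : ∀ j, (if j ∈ s then h j x else κ j) = 0 := fun j => congrFun (congrArg Prod.snd h5) j
  have h7 : ∀ j ∈ s, h j x = 0 := fun j hj => by simpa [hj] using h6 j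
  have h8 : ∀ j, j ∉ s → κ j = 0 := fun j hj => by simpa [hj] using h6 j
  have hkkt : ProxKKT f h B z a x κ := by
    refine ⟨?_, fun j => ?_, fun j => ?_, fun j => ?_⟩
    · have h9 : lagGrad f h x κ + B x = B z - a := congrArg Prod.fst h5
      rw [map_sub, ← sub_eq_zero.2 h9]; abel
    · by_cases hj : j ∈ s
      exacts [(h7 j hj).le, (h3 j hj).le]
    · by_cases hj : j ∈ s
      exacts [(h2 j hj).le, (h8 j hj).ge]
    · by_cases hj : j ∈ s
      · simp [h7 j hj]
      · simp [h8 j hj]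
  refine ⟨x, κ, hkkt, ?_, hkkt.isLocalMinOn R.smooth_f R.smooth_h hsymm h7 h2 (half_pos hc) h1⟩
  calc ‖x - z‖ = ‖(x - xs) - (z - xs)‖ := by congr 1; abel
    _ ≤ ‖x - xs‖ + ‖z - xs‖ := norm_sub_le _ _
    _ < δ / 2 + δ / 2 := add_lt_add h4 (hz.trans_le (min_le_right _ _))
    _ = δ := by ring

end ProxExistence

/-! ### The coordination step -/

section Coordination

set_option maxSynthPendingDepth 3

variable {X : Type*} [NormedAddCommGroup X] [NormedSpace ℝ X] {J : Type*} [Fintype J]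
  {Λ : Type*} [NormedAddCommGroup Λ] [InnerProductSpace ℝ Λ]

open Classical in
/-- The KKT operator of the coordination problem, with the identity on inactive multipliers. -/
noncomputable def coordMap (s : Finset J) (A : X →L[ℝ] Λ) (At : Λ →L[ℝ] X →L[ℝ] ℝ)
    (D : J → X →L[ℝ] ℝ) (H : X →L[ℝ] X →L[ℝ] ℝ) (ν : ℝ) :
    (X × Λ × (J → ℝ)) →L[ℝ] (X →L[ℝ] ℝ) × Λ × (J → ℝ) :=
  let px := ContinuousLinearMap.fst ℝ X (Λ × (J → ℝ))
  let pl := (ContinuousLinearMap.fst ℝ Λ (J → ℝ)).comp (ContinuousLinearMap.snd ℝ X (Λ × (J → ℝ)))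
  let pk := (ContinuousLinearMap.snd ℝ Λ (J → ℝ)).comp (ContinuousLinearMap.snd ℝ X (Λ × (J → ℝ)))
  (H.comp px + At.comp pl + ∑ j, ((ContinuousLinearMap.proj j).comp pk).smulRight (D j)).prod
    ((A.comp px - ν • pl).prod (ContinuousLinearMap.pi fun j =>
      if j ∈ s then (D j).comp px else (ContinuousLinearMap.proj j).comp pk))

open Classical in
theorem coordMap_apply (s : Finset J) (A : X →L[ℝ] Λ) (At : Λ →L[ℝ] X →L[ℝ] ℝ)
    (D : J → X →L[ℝ] ℝ) (H : X →L[ℝ] X →L[ℝ] ℝ) (ν : ℝ) (v : X) (l : Λ) (k : J → ℝ) :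
    coordMap s A At D H ν (v, l, k) =
      (H v + At l + ∑ j, k j • D j, A v - ν • l, fun j => if j ∈ s then D j v else k j) := by
  refine Prod.ext ?_ (Prod.ext ?_ (funext fun j => ?_))
  · simp [coordMap]
  · simp [coordMap]
  · by_cases hj : j ∈ s <;> simp [coordMap, hj]

variable {f : X → ℝ} {h : J → X → ℝ} {xs : X} {as : X →L[ℝ] ℝ} {κs : J → ℝ}
  {A : X →L[ℝ] Λ} {At : Λ →L[ℝ] X →L[ℝ] ℝ}

/-- Pair the first row with `v`: the consensus row `A v = ν • l` turns the multiplier term into `ν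
‖l‖² ≥ 0`, so SOSC gives `v = 0` and full LICQ gives `l = 0` and `k = 0`. The case `ν = 0`, an
infinite penalty, is included and serves as the reference operator. -/
theorem RegularPoint.coordMap_injective (R : RegularPoint f h xs as κs)
    (hAt : ∀ l v, At l v = inner ℝ l (A v))
    (hlicq : ∀ (l : Λ) (k : J → ℝ), (∀ j, h j xs ≠ 0 → k j = 0) →
      At l + ∑ j, k j • fderiv ℝ (h j) xs = 0 → l = 0 ∧ k = 0)
    {s : Finset J} (hs : ∀ j, j ∈ s ↔ h j xs = 0) {ν : ℝ} (hν : 0 ≤ ν) :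
    ∀ w, coordMap s A At (fun j => fderiv ℝ (h j) xs) (lagHess f h xs κs) ν w = 0 → w = 0 := by
  classical
  rintro ⟨v, l, k⟩ hw
  rw [coordMap_apply] at hw
  have h1 : lagHess f h xs κs v + At l + ∑ j, k j • fderiv ℝ (h j) xs = 0 := congrArg Prod.fst hw
  have h2 : A v = ν • l := sub_eq_zero.1 (congrArg (fun w => w.2.1) hw)
  have h0 : ∀ j, (if j ∈ s then fderiv ℝ (h j) xs v else k j) = 0 := fun j =>
    congrFun (congrArg (fun w => w.2.2) hw) j
  have h3 : ∀ j, h j xs = 0 → fderiv ℝ (h j) xs v = 0 := fun j hj => by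
    simpa [(hs j).2 hj] using h0 j
  have h4 : ∀ j, h j xs ≠ 0 → k j = 0 := fun j hj => by
    have : j ∉ s := fun h => hj ((hs j).1 h)
    simpa [this] using h0 j
  have hv : v = 0 := by
    by_contra hv
    have h5 := R.sosc v hv h3
    have h6 := congrArg (fun L : X →L[ℝ] ℝ => L v) h1
    have h7 : ∑ j, k j * fderiv ℝ (h j) xs v = 0 := Finset.sum_eq_zero fun j _ => by
      by_cases hj : h j xs = 0
      · simp [h3 j hj]
      · simp [h4 j hj]
    have h8 : At l v = ν * ‖l‖ ^ 2 := by
      rw [hAt, h2, inner_smul_right, real_inner_self_eq_norm_sq]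
    simp only [add_apply, sum_apply, smul_apply, smul_eq_mul, h7, h8, zero_apply] at h6
    have : 0 ≤ ν * ‖l‖ ^ 2 := by positivity
    linarith
  subst hv
  obtain ⟨rfl, rfl⟩ := hlicq l k h4 (by simpa using h1)
  rfl

/-- The KKT operator of the coordination problem is bounded below, uniformly near a regular point. -/
theorem RegularPoint.exists_coordMap_bound [FiniteDimensional ℝ X] [FiniteDimensional ℝ Λ]
    (R : RegularPoint f h xs as κs) (hAt : ∀ l v, At l v = inner ℝ l (A v))
    (hlicq : ∀ (l : Λ) (k : J → ℝ), (∀ j, h j xs ≠ 0 → k j = 0) →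
      At l + ∑ j, k j • fderiv ℝ (h j) xs = 0 → l = 0 ∧ k = 0)
    {s : Finset J} (hs : ∀ j, j ∈ s ↔ h j xs = 0) :
    ∃ M > 0, ∃ θ > 0, ∀ (D : J → X →L[ℝ] ℝ) (H : X →L[ℝ] X →L[ℝ] ℝ) (ν : ℝ),
      (∀ j, ‖D j - fderiv ℝ (h j) xs‖ ≤ θ) → ‖H - lagHess f h xs κs‖ ≤ θ → |ν| ≤ θ →
      ∀ w, ‖w‖ ≤ M * ‖coordMap s A At D H ν w‖ := by
  classical
  obtain ⟨M, hM, hMle⟩ := exists_norm_le_of_injective _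
    (R.coordMap_injective hAt hlicq hs le_rfl)
  -- The first row changes by one Hessian term and `Fintype.card J` gradient terms, each at most `θ
  -- * ‖w‖`. This `θ` makes `M` times the total equal to `‖w‖ / 2`, which is absorbed.
  refine ⟨2 * M, by positivity, 1 / (2 * M * (1 + Fintype.card J)), by positivity,
    fun D H ν hD hH hν => ?_⟩
  set θ := 1 / (2 * M * (1 + Fintype.card J) : ℝ) with hθ
  have hθ0 : 0 < θ := by positivity
  rintro ⟨v, l, k⟩
  set w : X × Λ × (J → ℝ) := (v, l, k) with hw
  have hv : ‖v‖ ≤ ‖w‖ := norm_fst_le w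
  have hl : ‖l‖ ≤ ‖w‖ := (norm_fst_le w.2).trans (norm_snd_le w)
  have hk : ∀ j, ‖k j‖ ≤ ‖w‖ := fun j =>
    (norm_le_pi_norm k j).trans ((norm_snd_le w.2).trans (norm_snd_le w))
  have hone : θ * ‖w‖ ≤ θ * (1 + Fintype.card J) * ‖w‖ := by
    have : (0 : ℝ) ≤ θ * Fintype.card J * ‖w‖ := by positivity
    linarith
  have hdiff : ‖coordMap s A At (fun j => fderiv ℝ (h j) xs) (lagHess f h xs κs) 0 w
      - coordMap s A At D H ν w‖ ≤ θ * (1 + Fintype.card J) * ‖w‖ := by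
    rw [hw, coordMap_apply, coordMap_apply, ← hw, Prod.mk_sub_mk, Prod.mk_sub_mk,
      Prod.norm_mk, Prod.norm_mk]
    refine max_le ?_ (max_le ?_ ?_)
    · have h1 : lagHess f h xs κs v + At l + ∑ j, k j • fderiv ℝ (h j) xs
          - (H v + At l + ∑ j, k j • D j)
          = -((H - lagHess f h xs κs) v) - ∑ j, k j • (D j - fderiv ℝ (h j) xs) := by
        simp only [smul_sub, Finset.sum_sub_distrib, sub_apply]
        abel
      rw [h1]
      have h2 : ‖(H - lagHess f h xs κs) v‖ ≤ θ * ‖w‖ :=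
        ((H - lagHess f h xs κs).le_opNorm v).trans (by gcongr)
      have h3 : ‖∑ j, k j • (D j - fderiv ℝ (h j) xs)‖ ≤ Fintype.card J * (θ * ‖w‖) := by
        refine (norm_sum_le_of_le _ (fun j _ => ?_)).trans_eq
          (by rw [Finset.sum_const, nsmul_eq_mul]; rfl)
        rw [norm_smul, mul_comm]
        exact mul_le_mul (hD j) (hk j) (norm_nonneg _) hθ0.le
      refine (norm_sub_le _ _).trans ?_
      rw [norm_neg]
      linarith
    · have h1 : A v - (0 : ℝ) • l - (A v - ν • l) = ν • l := by simp
      rw [h1, norm_smul, Real.norm_eq_abs]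
      exact (mul_le_mul hν hl (norm_nonneg _) hθ0.le).trans hone
    · refine (pi_norm_le_iff_of_nonneg (by positivity)).2 fun j => ?_
      by_cases hj : j ∈ s
      · simp only [Pi.sub_apply, hj, if_true]
        rw [norm_sub_rev, ← sub_apply]
        exact (((D j - fderiv ℝ (h j) xs).le_opNorm v).trans
          (mul_le_mul (hD j) hv (norm_nonneg _) hθ0.le)).trans hone
      · simp only [Pi.sub_apply, hj, if_false, sub_self, norm_zero]
        positivity
  have h1 := hMle w
  have h2 := norm_le_norm_add_norm_sub (coordMap s A At D H ν w)
    (coordMap s A At (fun j => fderiv ℝ (h j) xs) (lagHess f h xs κs) 0 w)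
  have h3 : M * ‖coordMap s A At (fun j => fderiv ℝ (h j) xs) (lagHess f h xs κs) 0 w‖
      ≤ M * (‖coordMap s A At D H ν w‖ + θ * (1 + Fintype.card J) * ‖w‖) := by
    gcongr
    rw [norm_sub_rev] at h2
    linarith [norm_sub_rev (coordMap s A At D H ν w)
      (coordMap s A At (fun j => fderiv ℝ (h j) xs) (lagHess f h xs κs) 0 w)]
  have h4 : M * (θ * (1 + Fintype.card J) * ‖w‖) = ‖w‖ / 2 := by
    rw [hθ]; field_simp
  rw [mul_add, h4] at h3
  linarith

/-- `(z', l', κ')` solves the coordination problem at the point `x` with linearization data `H`, up to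
the consensus row. -/
structure CoordKKT (f : X → ℝ) (h : J → X → ℝ) (At : Λ →L[ℝ] X →L[ℝ] ℝ) (H : X →L[ℝ] X →L[ℝ] ℝ)
    (x z' : X) (l' : Λ) (κ' : J → ℝ) : Prop where
  stationary : H (z' - x) + lagGrad f h x κ' + At l' = 0
  active : ∀ j, h j x = 0 → fderiv ℝ (h j) x (z' - x) = 0
  inactive : ∀ j, h j x ≠ 0 → κ' j = 0

-- The error equation of the Newton step. The coordination system is linear in its unknowns, so
-- subtracting the solution leaves only the remainder of the gradient, the consensus residual with
-- the shift `ν • (l - ls)`, and the linearized active constraints. The old error `κ - κs` does not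
-- appear, because multipliers enter the Lagrangian linearly.
open Classical in
theorem CoordKKT.coordMap_sub {H : X →L[ℝ] X →L[ℝ] ℝ} {x z' : X} {l' : Λ} {κ' : J → ℝ}
    (hc : CoordKKT f h At H x z' l' κ') (hκ : ∀ j, h j xs ≠ 0 → κs j = 0) (hA : A xs = 0)
    (hact : ∀ j, h j x = 0 ↔ h j xs = 0)
    {s : Finset J} (hs : ∀ j, j ∈ s ↔ h j xs = 0) (ν : ℝ) (l ls : Λ) :
    coordMap s A At (fun j => fderiv ℝ (h j) x) H ν (z' - xs, l' - ls, κ' - κs) =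
      (H (x - xs) - (lagGrad f h x κs + At ls), (A z' - ν • (l' - l)) - ν • (l - ls),
        fun j => if j ∈ s then fderiv ℝ (h j) x (x - xs) else 0) := by
  rw [coordMap_apply]
  refine Prod.ext ?_ (Prod.ext ?_ (funext fun j => ?_))
  · have h1 := hc.stationary
    simp only [lagGrad] at h1 ⊢
    simp only [Pi.sub_apply, sub_smul, Finset.sum_sub_distrib, map_sub] at h1 ⊢
    rw [← sub_eq_zero, ← h1]
    abel
  · simp only [map_sub, hA, smul_sub]
    abel
  · by_cases hj : j ∈ s
    · have h1 := hc.active j ((hact j).2 ((hs j).1 hj))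
      simp only [hj, if_true]
      rw [map_sub] at h1 ⊢
      rw [map_sub]
      linarith
    · have h1 : h j xs ≠ 0 := fun h => hj ((hs j).2 h)
      have h2 : h j x ≠ 0 := fun h => h1 ((hact j).1 h)
      simp [hj, hκ j h1, hc.inactive j h2]

/-- At the regular point itself, with exact Hessian, the coordination problem returns the point. -/
theorem RegularPoint.coordKKT_fixed {ls : Λ} (R : RegularPoint f h xs (At ls) κs)
    (hAt : ∀ l v, At l v = inner ℝ l (A v))
    (hlicq : ∀ (l : Λ) (k : J → ℝ), (∀ j, h j xs ≠ 0 → k j = 0) →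
      At l + ∑ j, k j • fderiv ℝ (h j) xs = 0 → l = 0 ∧ k = 0)
    (hA : A xs = 0) {ν : ℝ} (hν : 0 ≤ ν) {z' : X} {l' : Λ} {κ' : J → ℝ}
    (hc : CoordKKT f h At (lagHess f h xs κs) xs z' l' κ') (hres : A z' - ν • (l' - ls) = 0) :
    z' = xs ∧ l' = ls ∧ κ' = κs := by
  classical
  let s : Finset J := Finset.univ.filter fun j => h j xs = 0
  have hs : ∀ j, j ∈ s ↔ h j xs = 0 := fun j => by simp [s]
  have h1 := hc.coordMap_sub R.zero hA (fun j => Iff.rfl) hs ν ls ls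
  rw [hres, R.stationary] at h1
  have h2 := R.coordMap_injective hAt hlicq hs hν _ (h1.trans (by
    refine Prod.ext (by simp) (Prod.ext (by simp) (funext fun j => by simp))))
  simp only [Prod.mk_eq_zero, sub_eq_zero] at h2
  exact h2

/-- Error of one coordination step near a regular point. -/
theorem RegularPoint.coordKKT_estimate [FiniteDimensional ℝ X] [FiniteDimensional ℝ Λ] {ls : Λ}
    (R : RegularPoint f h xs (At ls) κs) (hAt : ∀ l v, At l v = inner ℝ l (A v))
    (hlicq : ∀ (l : Λ) (k : J → ℝ), (∀ j, h j xs ≠ 0 → k j = 0) →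
      At l + ∑ j, k j • fderiv ℝ (h j) xs = 0 → l = 0 ∧ k = 0)
    (hA : A xs = 0) {K r₀ : ℝ} (hK : 0 ≤ K) (hr₀ : 0 < r₀)
    (hLip : ∀ x κ x' κ', ‖x - xs‖ < r₀ → ‖κ - κs‖ < r₀ → ‖x' - xs‖ < r₀ → ‖κ' - κs‖ < r₀ →
      ‖lagHess f h x κ - lagHess f h x' κ'‖ ≤ K * (‖x - x'‖ + ‖κ - κ'‖)) :
    ∃ C > 0, ∃ r > 0, ∀ (x : X) (l : Λ) (κ : J → ℝ) (z' : X) (l' : Λ) (κ' : J → ℝ)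
      (H : X →L[ℝ] X →L[ℝ] ℝ) (ν : ℝ), ‖x - xs‖ < r → ‖κ - κs‖ < r → ‖H - lagHess f h x κ‖ < r →
      |ν| < r → (∀ j, h j x = 0 ↔ h j xs = 0) → CoordKKT f h At H x z' l' κ' →
      ‖((z' - xs, l' - ls, κ' - κs) : X × Λ × (J → ℝ))‖ ≤
        C * ((‖x - xs‖ + ‖κ - κs‖) * ‖x - xs‖ + ‖H - lagHess f h x κ‖ * ‖x - xs‖
          + |ν| * ‖l - ls‖ + ‖A z' - ν • (l' - l)‖) := by
  classical
  let s : Finset J := Finset.univ.filter fun j => h j xs = 0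
  have hs : ∀ j, j ∈ s ↔ h j xs = 0 := fun j => by simp [s]
  obtain ⟨M, hM, θ, hθ, hbound⟩ := R.exists_coordMap_bound (A := A) hAt hlicq hs
  have hD : ∀ᶠ x in 𝓝 xs, ∀ j, ‖fderiv ℝ (h j) x - fderiv ℝ (h j) xs‖ ≤ θ := by
    refine eventually_all.2 fun j => ?_
    have hc : Continuous fun x => ‖fderiv ℝ (h j) x - fderiv ℝ (h j) xs‖ := by
      have := (R.smooth_h j).continuous_fderiv (by norm_num)
      fun_prop
    have h0 : ‖fderiv ℝ (h j) xs - fderiv ℝ (h j) xs‖ < θ := by simpa using hθ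
    filter_upwards [hc.continuousAt.eventually (gt_mem_nhds h0)] with x hx
    exact hx.le
  obtain ⟨r₁, hr₁, hD⟩ := Metric.eventually_nhds_iff.1 hD
  have hLh : ∃ L : ℝ, 0 ≤ L ∧ ∃ r₂ > 0, ∀ j x x', ‖x - xs‖ < r₂ → ‖x' - xs‖ < r₂ →
      ‖fderiv ℝ (h j) x - fderiv ℝ (h j) x'‖ ≤ L * ‖x - x'‖ := by
    have h1 : ∀ j, ∃ L : NNReal, ∃ t ∈ 𝓝 xs, LipschitzOnWith L (fderiv ℝ (h j)) t := fun j =>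
      ((R.smooth_h j).fderiv_right (m := 1) (by norm_num)).contDiffAt.exists_lipschitzOnWith
    choose L t ht hL using h1
    obtain ⟨r₂, hr₂, hball⟩ := Metric.mem_nhds_iff.1 (Filter.iInter_mem.2 ht)
    refine ⟨∑ j, (L j : ℝ), Finset.sum_nonneg fun j _ => (L j).2, r₂, hr₂, fun j x x' hx hx' => ?_⟩
    have h2 : x ∈ t j := Set.mem_iInter.1 (hball (mem_ball_iff_norm.2 hx)) j
    have h3 : x' ∈ t j := Set.mem_iInter.1 (hball (mem_ball_iff_norm.2 hx')) j
    refine ((hL j).norm_sub_le h2 h3).trans ?_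
    gcongr
    exact Finset.single_le_sum (f := fun j => (L j : ℝ)) (fun j _ => (L j).2) (Finset.mem_univ j)
  obtain ⟨L, hL0, r₂, hr₂, hLh⟩ := hLh
  -- Within this radius the exact Hessian moves by at most `θ / 2`; the other half of `θ` is left
  -- for the Hessian approximation.
  have hHr : 0 < θ / (2 * (2 * K + 1)) := by positivity
  refine ⟨M * (K + L + 1), by positivity,
    min r₀ (min r₁ (min r₂ (min (θ / 2) (θ / (2 * (2 * K + 1)))))), by positivity, ?_⟩
  intro x l κ z' l' κ' H ν hx hκ hH hν hact hc
  simp only [lt_min_iff] at hx hκ hH hν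
  have hseg : ∀ y ∈ segment ℝ x xs, ‖y - xs‖ ≤ ‖x - xs‖ ∧ ‖y - x‖ ≤ ‖x - xs‖ := fun y hy => by
    have h1 := dist_add_dist_of_mem_segment hy
    simp only [dist_eq_norm] at h1
    have h2 := norm_sub_rev x y
    constructor <;> linarith [norm_nonneg (x - y), norm_nonneg (y - xs)]
  have hself : ∀ w : J → ℝ, w = κs → ‖w - κs‖ < r₀ := fun w hw => by simpa [hw] using hr₀
  -- Mean value inequality on the segment. The gradient carries `κs` and the reference Hessian
  -- carries `κ`, which accounts for the mixed term in `‖κ - κs‖`.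
  have hE1 : ‖lagGrad f h x κs + At ls - lagHess f h x κ (x - xs)‖
      ≤ K * (‖x - xs‖ + ‖κ - κs‖) * ‖x - xs‖ := by
    have h1 := (convex_segment (𝕜 := ℝ) x xs).norm_image_sub_le_of_norm_hasFDerivWithin_le'
      (f := fun y => lagGrad f h y κs) (f' := fun y => lagHess f h y κs) (φ := lagHess f h x κ)
      (C := K * (‖x - xs‖ + ‖κ - κs‖)) (x := xs) (y := x)
      (fun y _ => (hasFDerivAt_lagGrad R.smooth_f R.smooth_h κs y).hasFDerivWithinAt)
      (fun y hy => by
        obtain ⟨h2, h3⟩ := hseg y hy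
        refine (hLip y κs x κ (h2.trans_lt hx.1) (hself _ rfl) hx.1 hκ.1).trans ?_
        rw [norm_sub_rev κs κ]
        gcongr) (right_mem_segment ℝ x xs) (left_mem_segment ℝ x xs)
    have h2 : At ls = -lagGrad f h xs κs := eq_neg_of_add_eq_zero_right R.stationary
    rw [h2, ← sub_eq_add_neg]
    exact h1
  -- An active constraint vanishes at both `x` and `xs`, so its linear term is itself a Taylor
  -- remainder.
  have hE2 : ∀ j ∈ s, ‖fderiv ℝ (h j) x (x - xs)‖ ≤ L * ‖x - xs‖ * ‖x - xs‖ := fun j hj => by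
    have hj' := (hs j).1 hj
    have h1 := (convex_segment (𝕜 := ℝ) x xs).norm_image_sub_le_of_norm_hasFDerivWithin_le'
      (f := h j) (f' := fderiv ℝ (h j)) (φ := fderiv ℝ (h j) x)
      (C := L * ‖x - xs‖) (x := xs) (y := x)
      (fun y _ => (((R.smooth_h j).differentiable (by norm_num)) y).hasFDerivAt.hasFDerivWithinAt)
      (fun y hy => by
        obtain ⟨h2, h3⟩ := hseg y hy
        refine (hLh j y x (h2.trans_lt hx.2.2.1) hx.2.2.1).trans ?_
        gcongr) (right_mem_segment ℝ x xs) (left_mem_segment ℝ x xs)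
    rwa [hj', (hact j).2 hj', sub_zero, zero_sub, norm_neg] at h1
  have hHs : ‖H - lagHess f h xs κs‖ ≤ θ := by
    have h1 := hLip x κ xs κs hx.1 hκ.1 (by simpa using hr₀) (hself _ rfl)
    have h2 : K * (‖x - xs‖ + ‖κ - κs‖) ≤ θ / 2 := by
      calc K * (‖x - xs‖ + ‖κ - κs‖)
          ≤ K * (θ / (2 * (2 * K + 1)) + θ / (2 * (2 * K + 1))) := by
            gcongr
            exacts [hx.2.2.2.2.le, hκ.2.2.2.2.le]
        _ = (2 * K) * (θ / (2 * (2 * K + 1))) := by ring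
        _ ≤ (2 * K + 1) * (θ / (2 * (2 * K + 1))) := by gcongr; linarith
        _ = θ / 2 := by field_simp
    have h3 := norm_sub_le_norm_sub_add_norm_sub H (lagHess f h x κ) (lagHess f h xs κs)
    linarith [hH.2.2.2.1]
  have h1 := hbound (fun j => fderiv ℝ (h j) x) H ν
    (fun j => hD (by rw [dist_eq_norm]; exact hx.2.1) j) hHs
    (by linarith [hν.2.2.2.1]) (z' - xs, l' - ls, κ' - κs)
  rw [hc.coordMap_sub R.zero hA hact hs ν l ls] at h1
  refine h1.trans ?_
  rw [mul_assoc]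
  refine mul_le_mul_of_nonneg_left ?_ hM.le
  set a := ‖x - xs‖
  set b := ‖κ - κs‖
  set e := ‖H - lagHess f h x κ‖
  set n := |ν| * ‖l - ls‖ with hn
  set t := ‖A z' - ν • (l' - l)‖
  have ha : 0 ≤ a := norm_nonneg _
  have hb : 0 ≤ b := norm_nonneg _
  have he : 0 ≤ e := norm_nonneg _
  have hn0 : 0 ≤ n := by positivity
  have ht : 0 ≤ t := norm_nonneg _
  have hKL : 0 ≤ K + L := by positivity
  have hexp : (K + L + 1) * ((a + b) * a + e * a + n + t) = K * (a + b) * a + L * a * a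
      + (L * b * a + (a + b) * a) + (K + L + 1) * (e * a + n + t) := by ring
  have hge : e * a + n + t ≤ (K + L + 1) * (e * a + n + t) := by
    have : 0 ≤ (K + L) * (e * a + n + t) := by positivity
    linarith
  have p1 : 0 ≤ K * (a + b) * a := by positivity
  have p2 : 0 ≤ L * a * a := by positivity
  have p3 : 0 ≤ L * b * a + (a + b) * a := by positivity
  have p4 : 0 ≤ e * a := by positivity
  rw [hexp, Prod.norm_mk, Prod.norm_mk]
  refine max_le ?_ (max_le ?_ ?_)
  · have h2 : H (x - xs) - (lagGrad f h x κs + At ls) = (H - lagHess f h x κ) (x - xs)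
        - (lagGrad f h x κs + At ls - lagHess f h x κ (x - xs)) := by
      rw [sub_apply]; abel
    rw [h2]
    refine (norm_sub_le _ _).trans ?_
    have h3 := (H - lagHess f h x κ).le_opNorm (x - xs)
    linarith
  · refine (norm_sub_le _ _).trans ?_
    rw [norm_smul, Real.norm_eq_abs]
    linarith
  · refine (pi_norm_le_iff_of_nonneg (by linarith)).2 fun j => ?_
    by_cases hj : j ∈ s
    · simp only [hj, if_true]
      linarith [hE2 j hj]
    · simp only [hj, if_false, norm_zero]
      linarith

end Coordination

/-! ### The separable problem as a single nonlinear program -/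

section Translation

set_option maxSynthPendingDepth 3

namespace SepProblem

variable (P : SepProblem)

/-- Index set of all inequality constraints. -/
abbrev Idx : Type := Σ i : Fin P.N, Fin (P.nh i)

/-- The overall objective. -/
noncomputable def totalObj (x : P.X) : ℝ := ∑ i, P.f i (x i)

/-- The family of all inequality constraints, as functions of the overall decision vector. -/
noncomputable def totalCon (s : P.Idx) (x : P.X) : ℝ := P.h s.1 (x s.1) s.2

/-- Projection onto the block `i`. -/
noncomputable def blockProj (i : Fin P.N) : P.X →L[ℝ] P.Xi i :=
  PiLp.proj 2 (fun i : Fin P.N => EuclideanSpace ℝ (Fin (P.n i))) i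

@[simp] theorem blockProj_apply (i : Fin P.N) (x : P.X) : P.blockProj i x = x i := rfl

/-- A single coordinate of the overall decision vector. -/
noncomputable def coord (i : Fin P.N) (a : Fin (P.n i)) : P.X →L[ℝ] ℝ :=
  (EuclideanSpace.proj a).comp (P.blockProj i)

@[simp] theorem coord_apply (i : Fin P.N) (a : Fin (P.n i)) (x : P.X) : P.coord i a x = x i a := rfl

theorem norm_coord_le (i : Fin P.N) (a : Fin (P.n i)) : ‖P.coord i a‖ ≤ 1 :=
  ContinuousLinearMap.opNorm_le_bound _ zero_le_one fun x => by
    rw [one_mul]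
    exact (PiLp.norm_apply_le (x i) a).trans (PiLp.norm_apply_le x i)

variable {P} in
/-- The bilinear form of a block diagonal matrix. -/
noncomputable def blockForm (H : ∀ i, Matrix (Fin (P.n i)) (Fin (P.n i)) ℝ) : P.X →L[ℝ] P.X →L[ℝ] ℝ :=
  ∑ i, ∑ a, ∑ b, H i a b • (P.coord i a).smulRight (P.coord i b)

theorem blockForm_apply (H : ∀ i, Matrix (Fin (P.n i)) (Fin (P.n i)) ℝ) (u v : P.X) :
    blockForm H u v = ∑ i, (u i).ofLp ⬝ᵥ (H i).mulVec (v i).ofLp := by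
  simp only [blockForm, sum_apply, smul_apply, ContinuousLinearMap.smulRight_apply, coord_apply,
    smul_eq_mul, dotProduct, Matrix.mulVec, Finset.mul_sum]
  refine Finset.sum_congr rfl fun i _ => Finset.sum_congr rfl fun a _ =>
    Finset.sum_congr rfl fun b _ => by ring

/-- Turns the entrywise Hessian tolerance into an operator norm: each of the `∑ n i * n i` entries
contributes a rank-one form of norm at most `e`. -/
theorem norm_blockForm_sub_le {H H' : ∀ i, Matrix (Fin (P.n i)) (Fin (P.n i)) ℝ} {e : ℝ}
    (he : ∀ i a b, |H i a b - H' i a b| ≤ e) :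
    ‖blockForm H - blockForm H'‖ ≤ (∑ i, (P.n i : ℝ) * P.n i) * e := by
  have h1 : blockForm H - blockForm H'
      = ∑ i, ∑ a, ∑ b, (H i a b - H' i a b) • (P.coord i a).smulRight (P.coord i b) := by
    simp only [blockForm, ← Finset.sum_sub_distrib, sub_smul]
  rw [h1, Finset.sum_mul]
  refine norm_sum_le_of_le _ fun i _ => ?_
  have h2 : ∀ a b, ‖(H i a b - H' i a b) • (P.coord i a).smulRight (P.coord i b)‖ ≤ e := fun a b => by
    rw [norm_smul, ContinuousLinearMap.norm_smulRight_apply]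
    have h3 := mul_le_mul (P.norm_coord_le i a) (P.norm_coord_le i b) (norm_nonneg _) zero_le_one
    have h4 := mul_le_mul (he i a b) h3 (by positivity) ((abs_nonneg _).trans (he i a b))
    simpa using h4
  calc _ ≤ ∑ a : Fin (P.n i), ∑ b : Fin (P.n i), e :=
        norm_sum_le_of_le _ fun a _ => norm_sum_le_of_le _ fun b _ => h2 a b
    _ = _ := by simp; ring

/-- The consensus constraint. -/
noncomputable def consensusMap : P.X →L[ℝ] P.Lam :=
  LinearMap.toContinuousLinearMap
    { toFun := fun v => WithLp.toLp 2 (∑ i, (P.A i).mulVec (v i).ofLp)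
      map_add' := fun u v => by
        ext c; simp [Matrix.mulVec_add, Finset.sum_add_distrib]
      map_smul' := fun t v => by
        ext c; simp [Matrix.mulVec_smul, Finset.mul_sum] }

theorem consensusMap_apply (v : P.X) :
    P.consensusMap v = WithLp.toLp 2 (∑ i, (P.A i).mulVec (v i).ofLp) := rfl

/-- The transpose of the consensus constraint, with values in the dual space. -/
noncomputable def consensusDual : P.Lam →L[ℝ] P.X →L[ℝ] ℝ :=
  ∑ i, ∑ c, ∑ a, P.A i c a • (EuclideanSpace.proj c : P.Lam →L[ℝ] ℝ).smulRight (P.coord i a)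

theorem consensusDual_apply (l : P.Lam) (v : P.X) :
    P.consensusDual l v = ∑ i, l.ofLp ⬝ᵥ (P.A i).mulVec (v i).ofLp := by
  simp only [consensusDual, sum_apply, smul_apply, ContinuousLinearMap.smulRight_apply, coord_apply,
    smul_eq_mul, dotProduct, Matrix.mulVec, Finset.mul_sum, PiLp.proj_apply]
  refine Finset.sum_congr rfl fun i _ => Finset.sum_congr rfl fun a _ =>
    Finset.sum_congr rfl fun b _ => by ring

theorem consensusDual_eq_inner (l : P.Lam) (v : P.X) :
    P.consensusDual l v = inner ℝ l (P.consensusMap v) := by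
  rw [consensusDual_apply, consensusMap_apply, EuclideanSpace.inner_eq_star_dotProduct]
  simp [dotProduct_sum, dotProduct_comm]

/-- Primal-dual vectors as triples, with the multipliers flattened. -/
noncomputable def pdEquiv : P.PD ≃L[ℝ] P.X × P.Lam × (P.Idx → ℝ) :=
  LinearEquiv.toContinuousLinearEquiv
    { toFun := fun p => (PD.x p, PD.lam p, fun s => PD.kap p s.1 s.2)
      map_add' := fun _ _ => rfl
      map_smul' := fun _ _ => rfl
      invFun := fun w => pd w.1 w.2.1 (WithLp.toLp 2 fun i => WithLp.toLp 2 fun j => w.2.2 ⟨i, j⟩)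
      left_inv := fun _ => rfl
      right_inv := fun _ => rfl }

/-- The flattened inequality multipliers. -/
def flatKap {P : SepProblem} (κ : P.Kap) : P.Idx → ℝ := fun s => κ s.1 s.2

theorem pdEquiv_apply (p : P.PD) : P.pdEquiv p = (PD.x p, PD.lam p, flatKap (PD.kap p)) := rfl

theorem gradient_dotProduct {n : ℕ} (g : EuclideanSpace ℝ (Fin n) → ℝ)
    (y v : EuclideanSpace ℝ (Fin n)) : (gradient g y).ofLp ⬝ᵥ v.ofLp = fderiv ℝ g y v := by
  have h1 : inner ℝ (gradient g y) v = fderiv ℝ g y v := by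
    rw [gradient, InnerProductSpace.toDual_symm_apply]
  rw [← h1, EuclideanSpace.inner_eq_star_dotProduct, dotProduct_comm]
  simp

variable {P}

theorem contDiff_con (hh : ∀ i, ContDiff ℝ 2 (P.h i)) (i : Fin P.N) (j : Fin (P.nh i)) :
    ContDiff ℝ 2 fun y => P.h i y j :=
  (EuclideanSpace.proj j : EuclideanSpace ℝ (Fin (P.nh i)) →L[ℝ] ℝ).contDiff.comp (hh i)

theorem contDiff_totalObj (hf : ∀ i, ContDiff ℝ 2 (P.f i)) : ContDiff ℝ 2 P.totalObj :=
  ContDiff.sum fun i _ => (hf i).comp (P.blockProj i).contDiff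

theorem contDiff_totalCon (hh : ∀ i, ContDiff ℝ 2 (P.h i)) (s : P.Idx) :
    ContDiff ℝ 2 (P.totalCon s) :=
  (contDiff_con hh s.1 s.2).comp (P.blockProj s.1).contDiff

theorem fderiv_separable {g : ∀ i, P.Xi i → ℝ} (hg : ∀ i, Differentiable ℝ (g i)) (x v : P.X) :
    fderiv ℝ (fun y : P.X => ∑ i, g i (y i)) x v = ∑ i, (gradient (g i) (x i)).ofLp ⬝ᵥ (v i).ofLp := by
  have h1 : HasFDerivAt (fun y : P.X => ∑ i, g i (y i))
      (∑ i, (fderiv ℝ (g i) (x i)).comp (P.blockProj i)) x :=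
    HasFDerivAt.fun_sum fun i _ => ((hg i (x i)).hasFDerivAt).comp x (P.blockProj i).hasFDerivAt
  rw [h1.fderiv]
  simp [gradient_dotProduct]

theorem fderiv_totalObj (hf : ∀ i, ContDiff ℝ 2 (P.f i)) (x v : P.X) :
    fderiv ℝ P.totalObj x v = ∑ i, (gradient (P.f i) (x i)).ofLp ⬝ᵥ (v i).ofLp :=
  fderiv_separable (fun i => (hf i).differentiable (by norm_num)) x v

theorem fderiv_totalCon (hh : ∀ i, ContDiff ℝ 2 (P.h i)) (s : P.Idx) (x v : P.X) :
    fderiv ℝ (P.totalCon s) x v = (P.gradh s.1 s.2 (x s.1)).ofLp ⬝ᵥ (v s.1).ofLp := by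
  have h1 : HasFDerivAt (P.totalCon s)
      ((fderiv ℝ (fun y => P.h s.1 y s.2) (x s.1)).comp (P.blockProj s.1)) x := by
    have h0 : HasFDerivAt (fun y => P.h s.1 y s.2) _ (P.blockProj s.1 x) :=
      (((contDiff_con hh s.1 s.2).differentiable (by norm_num)) (x s.1)).hasFDerivAt
    exact h0.comp x (P.blockProj s.1).hasFDerivAt
  rw [h1.fderiv, gradh, gradient_dotProduct]
  rfl

theorem lagGrad_total (hf : ∀ i, ContDiff ℝ 2 (P.f i)) (hh : ∀ i, ContDiff ℝ 2 (P.h i)) (x v : P.X)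
    (κ : P.Kap) : lagGrad P.totalObj P.totalCon x (flatKap κ) v =
      ∑ i, ((gradient (P.f i) (x i)).ofLp + ∑ j, κ i j • (P.gradh i j (x i)).ofLp) ⬝ᵥ (v i).ofLp := by
  simp only [lagGrad, add_apply, sum_apply, smul_apply, smul_eq_mul, fderiv_totalObj hf,
    fderiv_totalCon hh, add_dotProduct, sum_dotProduct, smul_dotProduct, Finset.sum_add_distrib]
  rw [Fintype.sum_sigma]
  rfl

/-- A bilinear form on Euclidean space in coordinates. -/
theorem bilin_eq_dotProduct {n : ℕ}
    (B : EuclideanSpace ℝ (Fin n) →L[ℝ] EuclideanSpace ℝ (Fin n) →L[ℝ] ℝ)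
    (u v : EuclideanSpace ℝ (Fin n)) :
    B u v = u.ofLp ⬝ᵥ (Matrix.of fun a b =>
      B (EuclideanSpace.single a 1) (EuclideanSpace.single b 1)).mulVec v.ofLp := by
  have hexp : ∀ w : EuclideanSpace ℝ (Fin n), w = ∑ a, w a • EuclideanSpace.single a (1 : ℝ) :=
    fun w => by simpa using ((EuclideanSpace.basisFun (Fin n) ℝ).sum_repr w).symm
  conv_lhs => rw [hexp u, hexp v]
  simp only [map_sum, map_smul, sum_apply, smul_apply, smul_eq_mul, dotProduct, Matrix.mulVec,
    Matrix.of_apply, Finset.mul_sum]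
  rw [Finset.sum_comm]
  exact Finset.sum_congr rfl fun a _ => Finset.sum_congr rfl fun b _ => by ring

/-- The stacked Lagrangian without its consensus term is a sum of functions of separate blocks, so
differentiating it twice gives a block diagonal form with the matrices `hess` as blocks. -/
theorem lagHess_total (hf : ∀ i, ContDiff ℝ 2 (P.f i)) (hh : ∀ i, ContDiff ℝ 2 (P.h i)) (x : P.X)
    (κ : P.Kap) : lagHess P.totalObj P.totalCon x (flatKap κ) =
      blockForm fun i => P.hess i (x i) (κ i) := by
  let φ : ∀ i, P.Xi i → ℝ := fun i w => P.f i w + (κ i).ofLp ⬝ᵥ (P.h i w).ofLp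
  have hφ : ∀ i, ContDiff ℝ 2 (φ i) := fun i =>
    (hf i).add (ContDiff.sum fun j _ => contDiff_const.mul (contDiff_con hh i j))
  have h1 : (fun y => P.totalObj y + ∑ s, flatKap κ s * P.totalCon s y) = fun y => ∑ i, φ i (y i) := by
    funext y
    rw [Fintype.sum_sigma, totalObj, ← Finset.sum_add_distrib]
    rfl
  have h2 : (fderiv ℝ fun y : P.X => ∑ i, φ i (y i)) = fun y =>
      ∑ i, (fderiv ℝ (φ i) (y i)).comp (P.blockProj i) := funext fun y =>
    (HasFDerivAt.fun_sum fun i _ => (((hφ i).differentiable (by norm_num) (y i)).hasFDerivAt).comp y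
      (P.blockProj i).hasFDerivAt).fderiv
  have h3 : HasFDerivAt (fun y : P.X => ∑ i, (fderiv ℝ (φ i) (y i)).comp (P.blockProj i))
      (∑ i, ((ContinuousLinearMap.compL ℝ P.X (P.Xi i) ℝ).flip (P.blockProj i)).comp
        ((fderiv ℝ (fderiv ℝ (φ i)) (x i)).comp (P.blockProj i))) x :=
    HasFDerivAt.fun_sum fun i _ =>
      (((ContinuousLinearMap.compL ℝ P.X (P.Xi i) ℝ).flip (P.blockProj i)).hasFDerivAt).comp x
        ((hasStrictFDerivAt_fderiv (hφ i) (x i)).hasFDerivAt.comp x (P.blockProj i).hasFDerivAt)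
  rw [← fderiv_fderiv_lagrangian (contDiff_totalObj hf) (contDiff_totalCon hh), h1, h2, h3.fderiv]
  refine ContinuousLinearMap.ext fun u => ContinuousLinearMap.ext fun v => ?_
  rw [blockForm_apply]
  simp only [sum_apply, ContinuousLinearMap.comp_apply, ContinuousLinearMap.flip_apply,
    ContinuousLinearMap.compL_apply, blockProj_apply]
  exact Finset.sum_congr rfl fun i _ => bilin_eq_dotProduct _ _ _

/-- The inclusion of the primal space. -/
noncomputable def primalIncl (P : SepProblem) : P.X →L[ℝ] P.PD :=
  (P.pdEquiv.symm : P.X × P.Lam × (P.Idx → ℝ) →L[ℝ] P.PD).comp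
    (ContinuousLinearMap.inl ℝ P.X (P.Lam × (P.Idx → ℝ)))

theorem contDiff_lagrangian (hf : ∀ i, ContDiff ℝ 2 (P.f i)) (hh : ∀ i, ContDiff ℝ 2 (P.h i)) :
    ContDiff ℝ 2 P.lagrangian := by
  have h1 : P.lagrangian = fun p => (P.totalObj (P.pdEquiv p).1
      + ∑ s, (P.pdEquiv p).2.2 s * P.totalCon s (P.pdEquiv p).1)
      + P.consensusDual (P.pdEquiv p).2.1 (P.pdEquiv p).1 := by
    funext p
    rw [consensusDual_apply, Fintype.sum_sigma, totalObj, ← Finset.sum_add_distrib,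
      ← Finset.sum_add_distrib]
    refine Finset.sum_congr rfl fun i _ => ?_
    simp only [pdEquiv_apply]
    rw [add_right_comm]
    rfl
  have hx : ContDiff ℝ 2 fun p => (P.pdEquiv p).1 := contDiff_fst.comp P.pdEquiv.contDiff
  have hl : ContDiff ℝ 2 fun p => (P.pdEquiv p).2.1 :=
    contDiff_fst.comp (contDiff_snd.comp P.pdEquiv.contDiff)
  have hk : ∀ s, ContDiff ℝ 2 fun p => (P.pdEquiv p).2.2 s := fun s =>
    (contDiff_apply ℝ ℝ s).comp (contDiff_snd.comp (contDiff_snd.comp P.pdEquiv.contDiff))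
  rw [h1]
  exact (((contDiff_totalObj hf).comp hx).add (ContDiff.sum fun s _ =>
    (hk s).mul ((contDiff_totalCon hh s).comp hx))).add
      ((P.consensusDual.contDiff.comp hl).clm_apply hx)

/-- The primal block of the Hessian of the Lagrangian. -/
theorem fderiv_fderiv_lagrangian_primal (hf : ∀ i, ContDiff ℝ 2 (P.f i))
    (hh : ∀ i, ContDiff ℝ 2 (P.h i)) (p : P.PD) (u v : P.X) :
    fderiv ℝ (fderiv ℝ P.lagrangian) p (P.primalIncl u) (P.primalIncl v) =
      lagHess P.totalObj P.totalCon (PD.x p) (flatKap (PD.kap p)) u v := by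
  have hL := contDiff_lagrangian hf hh
  -- Freeze the multipliers and restrict the Lagrangian to the affine slice `c + primalIncl y`. The
  -- consensus term is linear in `y` there and drops out of the second derivative.
  let c : P.PD := pd 0 (PD.lam p) (PD.kap p)
  have hin : ∀ y : P.X, c + P.primalIncl y = pd y (PD.lam p) (PD.kap p) := fun y => by
    have : P.primalIncl y = pd y 0 0 := rfl
    rw [this]
    simp [c, pd, ← WithLp.toLp_add]
  have haff : ∀ y, HasFDerivAt (fun y => c + P.primalIncl y) P.primalIncl y := fun y =>
    P.primalIncl.hasFDerivAt.const_add c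
  have hg : ∀ y, P.lagrangian (c + P.primalIncl y) = (P.totalObj y
      + ∑ s, flatKap (PD.kap p) s * P.totalCon s y) + P.consensusDual (PD.lam p) y := fun y => by
    rw [hin, consensusDual_apply, Fintype.sum_sigma, totalObj, ← Finset.sum_add_distrib,
      ← Finset.sum_add_distrib]
    refine Finset.sum_congr rfl fun i _ => ?_
    rw [add_right_comm]
    rfl
  have h1 : ∀ y, (fderiv ℝ P.lagrangian (c + P.primalIncl y)).comp P.primalIncl
      = lagGrad P.totalObj P.totalCon y (flatKap (PD.kap p)) + P.consensusDual (PD.lam p) := fun y => by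
    have h2 : HasFDerivAt (fun y => P.lagrangian (c + P.primalIncl y)) _ y :=
      ((hL.differentiable (by norm_num) _).hasFDerivAt).comp y (haff y)
    have h3 := (hasFDerivAt_lagrangian (contDiff_totalObj hf) (contDiff_totalCon hh)
      (flatKap (PD.kap p)) y).fun_add (P.consensusDual (PD.lam p)).hasFDerivAt
    rw [← funext hg] at h3
    exact h2.unique h3
  have h4 : HasFDerivAt (fun y => (fderiv ℝ P.lagrangian (c + P.primalIncl y)).comp P.primalIncl)
      (((ContinuousLinearMap.compL ℝ P.X P.PD ℝ).flip P.primalIncl).comp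
        ((fderiv ℝ (fderiv ℝ P.lagrangian) (c + P.primalIncl (PD.x p))).comp P.primalIncl))
      (PD.x p) :=
    (((ContinuousLinearMap.compL ℝ P.X P.PD ℝ).flip P.primalIncl).hasFDerivAt).comp (PD.x p)
      ((hasStrictFDerivAt_fderiv hL _).hasFDerivAt.comp (PD.x p) (haff (PD.x p)))
  have h5 := (hasFDerivAt_lagGrad (contDiff_totalObj hf) (contDiff_totalCon hh)
    (flatKap (PD.kap p)) (PD.x p)).add_const (P.consensusDual (PD.lam p))
  rw [funext h1] at h4
  have h6 := h4.unique h5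
  have h7 : c + P.primalIncl (PD.x p) = p := hin _
  rw [← h6, h7]
  rfl

/-- Lipschitz continuity of the Hessian of the Lagrangian passes to its primal block. -/
theorem exists_lagHess_lipschitz (hf : ∀ i, ContDiff ℝ 2 (P.f i)) (hh : ∀ i, ContDiff ℝ 2 (P.h i))
    {ps : P.PD} {U : Set P.PD} (hU : U ∈ 𝓝 ps) {K : NNReal}
    (hK : LipschitzOnWith K (fderiv ℝ (fderiv ℝ P.lagrangian)) U) :
    ∃ K' r : ℝ, 0 ≤ K' ∧ 0 < r ∧ ∀ (x : P.X) (κ : P.Idx → ℝ) (x' : P.X) (κ' : P.Idx → ℝ),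
      ‖x - PD.x ps‖ < r → ‖κ - flatKap (PD.kap ps)‖ < r → ‖x' - PD.x ps‖ < r →
      ‖κ' - flatKap (PD.kap ps)‖ < r →
      ‖lagHess P.totalObj P.totalCon x κ - lagHess P.totalObj P.totalCon x' κ'‖
        ≤ K' * (‖x - x'‖ + ‖κ - κ'‖) := by
  let e : (P.X × P.Lam × (P.Idx → ℝ)) →L[ℝ] P.PD := P.pdEquiv.symm
  have hpre : e ⁻¹' U ∈ 𝓝 (P.pdEquiv ps) := by
    refine e.continuous.continuousAt ?_
    have : e (P.pdEquiv ps) = ps := rfl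
    rwa [this]
  obtain ⟨r, hr, hball⟩ := Metric.mem_nhds_iff.1 hpre
  -- The consensus multiplier may stay at its value in `ps`, because the primal block of the Hessian
  -- does not depend on it.
  have hmem : ∀ (x : P.X) (κ : P.Idx → ℝ), ‖x - PD.x ps‖ < r → ‖κ - flatKap (PD.kap ps)‖ < r →
      e (x, PD.lam ps, κ) ∈ U := fun x κ hx hκ => by
    refine hball (mem_ball_iff_norm.2 ?_)
    rw [pdEquiv_apply, Prod.mk_sub_mk, Prod.mk_sub_mk, Prod.norm_mk, Prod.norm_mk, sub_self, norm_zero]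
    exact max_lt hx (max_lt hr hκ)
  refine ⟨K * ‖e‖ * ‖P.primalIncl‖ * ‖P.primalIncl‖, r, by positivity, hr,
    fun x κ x' κ' hx hκ hx' hκ' => ?_⟩
  have h1 := hK.norm_sub_le (hmem x κ hx hκ) (hmem x' κ' hx' hκ')
  have h2 : ‖e (x, PD.lam ps, κ) - e (x', PD.lam ps, κ')‖ ≤ ‖e‖ * (‖x - x'‖ + ‖κ - κ'‖) := by
    rw [← map_sub]
    refine (e.le_opNorm _).trans ?_
    gcongr
    rw [Prod.mk_sub_mk, Prod.mk_sub_mk, Prod.norm_mk, Prod.norm_mk, sub_self, norm_zero]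
    refine max_le ?_ (max_le ?_ ?_) <;> linarith [norm_nonneg (x - x'), norm_nonneg (κ - κ')]
  refine ContinuousLinearMap.opNorm_le_bound₂ _ (by positivity) fun u v => ?_
  have h3 : ∀ (x : P.X) (κ : P.Idx → ℝ), lagHess P.totalObj P.totalCon x κ u v
      = fderiv ℝ (fderiv ℝ P.lagrangian) (e (x, PD.lam ps, κ)) (P.primalIncl u) (P.primalIncl v) :=
    fun x κ => (fderiv_fderiv_lagrangian_primal hf hh (e (x, PD.lam ps, κ)) u v).symm
  rw [sub_apply, sub_apply, h3, h3, ← sub_apply, ← sub_apply]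
  refine (ContinuousLinearMap.le_opNorm₂ _ _ _).trans ?_
  calc _ ≤ (K * (‖e‖ * (‖x - x'‖ + ‖κ - κ'‖))) * (‖P.primalIncl‖ * ‖u‖) * (‖P.primalIncl‖ * ‖v‖) := by
        gcongr
        · exact h1.trans (by gcongr)
        · exact ContinuousLinearMap.le_opNorm _ _
        · exact ContinuousLinearMap.le_opNorm _ _
    _ = _ := by ring

end SepProblem

end Translation

/-! ### The steps of the algorithm as statements about the stacked program. -/

section StepTranslation

set_option maxSynthPendingDepth 3

namespace SepProblem

variable {P : SepProblem}

theorem transpose_mulVec_dotProduct {a b : ℕ} (M : Matrix (Fin a) (Fin b) ℝ) (l : Fin a → ℝ)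
    (v : Fin b → ℝ) : M.transpose.mulVec l ⬝ᵥ v = l ⬝ᵥ M.mulVec v := by
  rw [Matrix.mulVec_transpose, Matrix.dotProduct_mulVec]

theorem eq_zero_of_sum_dotProduct {w : ∀ i : Fin P.N, Fin (P.n i) → ℝ}
    (hw : ∀ v : P.X, ∑ i, w i ⬝ᵥ (v i).ofLp = 0) (i : Fin P.N) : w i = 0 := by
  have h1 : ∑ i, w i ⬝ᵥ w i = 0 := hw (WithLp.toLp 2 fun i => WithLp.toLp 2 (w i))
  have h2 := (Finset.sum_eq_zero_iff_of_nonneg fun i _ => Finset.sum_nonneg fun a _ =>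
    mul_self_nonneg (w i a)).1 h1 i (Finset.mem_univ i)
  exact dotProduct_self_eq_zero.1 h2

theorem Cact_mulVec_apply (i : Fin P.N) (y : P.Xi i) (v : Fin (P.n i) → ℝ) (j : Fin (P.nh i))
    (hj : P.h i y j = 0) : (P.Cact i y).mulVec v j = (P.gradh i j y).ofLp ⬝ᵥ v := by
  simp [Cact, Matrix.mulVec, hj, dotProduct]

theorem Cact_mulVec_eq_zero_iff (i : Fin P.N) (y : P.Xi i) (v : Fin (P.n i) → ℝ) :
    (P.Cact i y).mulVec v = 0 ↔ ∀ j, P.h i y j = 0 → (P.gradh i j y).ofLp ⬝ᵥ v = 0 := by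
  constructor
  · intro h j hj
    rw [← Cact_mulVec_apply i y v j hj, h]; rfl
  · intro h
    funext j
    by_cases hj : P.h i y j = 0
    · rw [Cact_mulVec_apply i y v j hj, h j hj]; rfl
    · simp [Cact, Matrix.mulVec, hj, dotProduct]

theorem Cact_transpose_mulVec (i : Fin P.N) (y : P.Xi i) (κ : Fin (P.nh i) → ℝ)
    (hκ : ∀ j, P.h i y j ≠ 0 → κ j = 0) :
    (P.Cact i y).transpose.mulVec κ = ∑ j, κ j • (P.gradh i j y).ofLp := by
  funext a
  simp only [Matrix.mulVec, dotProduct, Matrix.transpose_apply, Finset.sum_apply, Pi.smul_apply,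
    smul_eq_mul]
  refine Finset.sum_congr rfl fun j _ => ?_
  by_cases hj : P.h i y j = 0
  · simp [Cact, hj, mul_comm]
  · simp [hκ j hj]

/-! #### Regularity -/

/-- Pairing with an arbitrary `v` turns the identity between functionals into a vanishing
combination of the vectors in `LICQ`. Constraints missing from that family are inactive and have
coefficient zero. -/
theorem licq_total (hh : ∀ i, ContDiff ℝ 2 (P.h i)) {x : P.X} (hL : P.LICQ x) (l : P.Lam)
    (k : P.Idx → ℝ) (hk : ∀ s, P.totalCon s x ≠ 0 → k s = 0)
    (h0 : P.consensusDual l + ∑ s, k s • fderiv ℝ (P.totalCon s) x = 0) : l = 0 ∧ k = 0 := by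
  classical
  rw [LICQ, Fintype.linearIndependent_iff] at hL
  have key := hL (Sum.elim (fun c => l c) fun s => k ⟨s.1, s.2.1⟩) (by
    refine ext_inner_right ℝ fun v => ?_
    rw [inner_zero_left, ← zero_apply (F := P.X →L[ℝ] ℝ) v, ← h0, Fintype.sum_sum_type, inner_add_left,
      sum_inner, sum_inner]
    simp only [Sum.elim_inl, Sum.elim_inr, inner_smul_left, add_apply, sum_apply, smul_apply,
      smul_eq_mul, consensusDual_apply, fderiv_totalCon hh]
    congr 1
    · simp only [dotProduct, Matrix.mulVec, PiLp.inner_apply, Finset.mul_sum]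
      rw [Finset.sum_comm]
      simp [mul_comm]
    · rw [Fintype.sum_sigma, Fintype.sum_sigma]
      refine Finset.sum_congr rfl fun i _ => ?_
      have h1 : ∑ j, k ⟨i, j⟩ * ((P.gradh i j (x i)).ofLp ⬝ᵥ (v i).ofLp)
          = ∑ j with P.h i (x i) j = 0, k ⟨i, j⟩ * ((P.gradh i j (x i)).ofLp ⬝ᵥ (v i).ofLp) := by
        rw [Finset.sum_filter]
        refine Finset.sum_congr rfl fun j _ => ?_
        split_ifs with hj
        · rfl
        · rw [hk ⟨i, j⟩ hj, zero_mul]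
      rw [h1, Finset.sum_subtype (p := fun j => P.h i (x i) j = 0) _ (by simp)]
      refine Finset.sum_congr rfl fun j _ => ?_
      rw [PiLp.inner_apply, Finset.sum_eq_single i]
      · simp [EuclideanSpace.inner_eq_star_dotProduct, dotProduct_comm]
      · intro b _ hb
        simp [Pi.single_eq_of_ne hb]
      · simp)
  constructor
  · ext c
    exact key (Sum.inl c)
  · funext s
    by_cases hs : P.totalCon s x = 0
    · exact key (Sum.inr ⟨s.1, ⟨s.2, hs⟩⟩)
    · exact hk s hs

/-- A vector on which all active derivatives vanish has each block in the null space of its own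
Jacobian, and some block is nonzero; blockwise SOSC therefore sums to a positive value. -/
theorem regularPoint (hf : ∀ i, ContDiff ℝ 2 (P.f i)) (hh : ∀ i, ContDiff ℝ 2 (P.h i))
    {ps : P.PD} (hKKT : P.IsKKT ps) (hLICQ : P.LICQ (PD.x ps)) (hSCC : P.SCC ps)
    (hSOSC : P.SOSC ps) : RegularPoint P.totalObj P.totalCon (PD.x ps)
      (P.consensusDual (PD.lam ps)) (flatKap (PD.kap ps)) where
  smooth_f := contDiff_totalObj hf
  smooth_h := contDiff_totalCon hh
  stationary := ContinuousLinearMap.ext fun v => by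
    rw [add_apply, lagGrad_total hf hh, consensusDual_apply, ← Finset.sum_add_distrib]
    refine Finset.sum_eq_zero fun i _ => ?_
    rw [← transpose_mulVec_dotProduct, ← add_dotProduct, add_right_comm, hKKT.stationary i,
      zero_dotProduct]
  feasible s := hKKT.feasible s.1 s.2
  pos s hs := hSCC s.1 s.2 hs
  zero s hs := (mul_eq_zero.1 (hKKT.compl s.1 s.2)).resolve_right hs
  indep k hk h0 := (licq_total hh hLICQ 0 k hk (by simpa using h0)).2
  sosc v hv hact := by
    rw [lagHess_total hf hh, blockForm_apply]
    have hker : ∀ i, (P.Cact i (PD.x ps i)).mulVec (v i).ofLp = 0 := fun i =>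
      (Cact_mulVec_eq_zero_iff i _ _).2 fun j hj => by
        rw [← fderiv_totalCon hh ⟨i, j⟩]
        exact hact ⟨i, j⟩ hj
    have hpos : ∀ i, (v i).ofLp ≠ 0 →
        0 < (v i).ofLp ⬝ᵥ (P.hess i (PD.x ps i) (PD.kap ps i)).mulVec (v i).ofLp := fun i hi =>
      hSOSC i _ hi (hker i)
    obtain ⟨i, hi⟩ : ∃ i, (v i).ofLp ≠ 0 := by
      by_contra! hcon
      exact hv (by ext i a; exact congrFun (hcon i) a)
    refine Finset.sum_pos' (fun i _ => ?_) ⟨i, Finset.mem_univ i, hpos i hi⟩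
    by_cases h0 : (v i).ofLp = 0
    · rw [h0]; simp
    · exact (hpos i h0).le

/-! #### The local step -/

/-- The proximal form `ρ Σ`. -/
noncomputable def proxForm (Sig : ∀ i, Matrix (Fin (P.n i)) (Fin (P.n i)) ℝ) (ρ : ℝ) :
    P.X →L[ℝ] P.X →L[ℝ] ℝ :=
  blockForm fun i => ρ • Sig i

variable {Sig : ∀ i, Matrix (Fin (P.n i)) (Fin (P.n i)) ℝ} {ρ : ℝ}

theorem proxForm_apply (u v : P.X) :
    proxForm Sig ρ u v = ρ * ∑ i, (u i).ofLp ⬝ᵥ (Sig i).mulVec (v i).ofLp := by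
  simp [proxForm, blockForm_apply, Matrix.smul_mulVec, Finset.mul_sum]

theorem proxForm_nonneg (hSig : ∀ i, (Sig i).PosDef) (hρ : 0 < ρ) (v : P.X) :
    0 ≤ proxForm Sig ρ v v := by
  rw [proxForm_apply]
  refine mul_nonneg hρ.le (Finset.sum_nonneg fun i _ => ?_)
  simpa using (hSig i).posSemidef.dotProduct_mulVec_nonneg (v i).ofLp

theorem dotProduct_mulVec_comm_of_isSymm {n : ℕ} {M : Matrix (Fin n) (Fin n) ℝ} (hM : M.IsSymm)
    (u v : Fin n → ℝ) : u ⬝ᵥ M.mulVec v = M.mulVec u ⬝ᵥ v := by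
  rw [← transpose_mulVec_dotProduct, hM.eq]

theorem proxForm_symm (hSig : ∀ i, (Sig i).PosDef) (u v : P.X) :
    proxForm Sig ρ u v = proxForm Sig ρ v u := by
  rw [proxForm_apply, proxForm_apply]
  congr 1
  refine Finset.sum_congr rfl fun i _ => ?_
  have h1 : (Sig i).IsSymm := by simpa using (hSig i).isHermitian
  rw [dotProduct_mulVec_comm_of_isSymm h1, dotProduct_comm]

theorem sum_localObj (z : P.X) (l : P.Lam) (y : P.X) :
    ∑ i, P.localObj Sig ρ z l i (y i) = P.totalObj y + P.consensusDual l y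
      + 1 / 2 * proxForm Sig ρ (y - z) (y - z) := by
  simp only [localObj, Finset.sum_add_distrib, consensusDual_apply, proxForm_apply, totalObj,
    ← Finset.mul_sum]
  congr 1
  rw [← mul_assoc]
  congr 1
  ring

theorem differentiable_localObj (hf : ∀ i, ContDiff ℝ 2 (P.f i)) (z : P.X) (l : P.Lam)
    (i : Fin P.N) : Differentiable ℝ (P.localObj Sig ρ z l i) := by
  have h1 := (hf i).differentiable (by norm_num)
  unfold localObj
  simp only [dotProduct, Matrix.mulVec]
  fun_prop

/-- The derivative of `∑ i, localObj i` is computed once by blocks and once for the stacked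
objective. Testing against all `v` lets stationarity pass in both directions. -/
theorem localObj_stationary_dotProduct (hf : ∀ i, ContDiff ℝ 2 (P.f i))
    (hh : ∀ i, ContDiff ℝ 2 (P.h i)) (hSig : ∀ i, (Sig i).PosDef) (z x : P.X) (l : P.Lam) (κ : P.Kap)
    (v : P.X) :
    ∑ i, (gradient (P.localObj Sig ρ z l i) (x i)
        + ∑ j, κ i j • P.gradh i j (x i)).ofLp ⬝ᵥ (v i).ofLp
      = (lagGrad P.totalObj P.totalCon x (flatKap κ) + P.consensusDual l
        + proxForm Sig ρ (x - z)) v := by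
  have h1 : HasFDerivAt (fun y : P.X => ∑ i, P.localObj Sig ρ z l i (y i))
      (fderiv ℝ P.totalObj x + P.consensusDual l + proxForm Sig ρ (x - z)) x := by
    rw [funext fun y => sum_localObj (P := P) z l y]
    exact ((((contDiff_totalObj hf).differentiable (by norm_num) x).hasFDerivAt).fun_add
      (P.consensusDual l).hasFDerivAt).fun_add (hasFDerivAt_proxTerm (proxForm_symm hSig) z x)
  have h2 := fderiv_separable (fun i => differentiable_localObj (Sig := Sig) (ρ := ρ) hf z l i) x v
  rw [h1.fderiv] at h2
  have h3 := lagGrad_total hf hh x v κ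
  have h4 := fderiv_totalObj hf x v
  simp only [WithLp.ofLp_add, WithLp.ofLp_sum, WithLp.ofLp_smul, add_dotProduct, Finset.sum_add_distrib,
    add_apply] at h2 h3 ⊢
  linarith

theorem LocalStep.proxKKT (hf : ∀ i, ContDiff ℝ 2 (P.f i)) (hh : ∀ i, ContDiff ℝ 2 (P.h i))
    (hSig : ∀ i, (Sig i).PosDef) {δ : ℝ} {q p : P.PD} (hs : P.LocalStep Sig ρ δ q p) :
    ProxKKT P.totalObj P.totalCon (proxForm Sig ρ) (PD.x q) (P.consensusDual (PD.lam q)) (PD.x p)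
      (flatKap (PD.kap p)) where
  stationary := ContinuousLinearMap.ext fun v => by
    rw [← localObj_stationary_dotProduct hf hh hSig]
    exact Finset.sum_eq_zero fun i _ => by rw [hs.stationary i]; simp
  feasible s := hs.feasible s.1 s.2
  nonneg s := hs.nonneg s.1 s.2
  compl s := hs.compl s.1 s.2

/-- Local minimality of a separable function passes to the blocks. -/
theorem isLocalMinOn_block {g : ∀ i, P.Xi i → ℝ} {x : P.X}
    (hmin : IsLocalMinOn (fun y : P.X => ∑ i, g i (y i)) {y | ∀ s, P.totalCon s y ≤ 0} x)
    (hx : ∀ s, P.totalCon s x ≤ 0) (i : Fin P.N) :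
    IsLocalMinOn (g i) {y | ∀ j, P.h i y j ≤ 0} (x i) := by
  -- Vary block `i` alone: the other blocks remain feasible and their summands cancel.
  let u : P.Xi i → P.X := fun w => WithLp.toLp 2 (Function.update x.ofLp i w)
  have hux : u (x i) = x := by simp [u]
  have hcont : Continuous u := (PiLp.continuous_toLp 2 _).comp (continuous_const.update i continuous_id)
  have htend : Tendsto u (𝓝[{y | ∀ j, P.h i y j ≤ 0}] (x i))
      (𝓝[{y | ∀ s, P.totalCon s y ≤ 0}] x) := by
    refine tendsto_nhdsWithin_iff.2 ⟨?_, ?_⟩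
    · have := hcont.tendsto (x i)
      rw [hux] at this
      exact this.mono_left nhdsWithin_le_nhds
    · filter_upwards [self_mem_nhdsWithin] with w hw
      rintro ⟨k, j⟩
      rcases eq_or_ne k i with rfl | hk
      · simpa [totalCon, u] using hw j
      · simpa [totalCon, u, Function.update_of_ne hk] using hx ⟨k, j⟩
  filter_upwards [htend.eventually hmin] with w hw
  have h1 : ∀ y : P.X, ∑ k, g k (y k) = g i (y i) + ∑ k ∈ Finset.univ.erase i, g k (y k) := fun y =>
    (Finset.add_sum_erase _ _ (Finset.mem_univ i)).symm
  have h2 : ∑ k ∈ Finset.univ.erase i, g k (u w k) = ∑ k ∈ Finset.univ.erase i, g k (x k) :=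
    Finset.sum_congr rfl fun k hk => by simp [u, Function.update_of_ne (Finset.ne_of_mem_erase hk)]
  have h3 : u w i = w := by simp [u]
  rw [h1, h1, h2, h3] at hw
  linarith

/-- A solution of the overall proximal problem is a local step. -/
theorem localStep_of_proxKKT (hf : ∀ i, ContDiff ℝ 2 (P.f i)) (hh : ∀ i, ContDiff ℝ 2 (P.h i))
    (hSig : ∀ i, (Sig i).PosDef) {δ : ℝ} {q p : P.PD} (hlam : PD.lam p = PD.lam q)
    (hk : ProxKKT P.totalObj P.totalCon (proxForm Sig ρ) (PD.x q) (P.consensusDual (PD.lam q))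
      (PD.x p) (flatKap (PD.kap p))) (hδ : ‖PD.x p - PD.x q‖ < δ)
    (hmin : IsLocalMinOn (fun y => P.totalObj y + P.consensusDual (PD.lam q) y
      + 1 / 2 * proxForm Sig ρ (y - PD.x q) (y - PD.x q)) {y | ∀ s, P.totalCon s y ≤ 0} (PD.x p)) :
    P.LocalStep Sig ρ δ q p where
  lam_eq := hlam
  near i := by
    rw [dist_eq_norm]
    exact (PiLp.norm_apply_le (PD.x p - PD.x q) i).trans_lt hδ
  feasible i j := hk.feasible ⟨i, j⟩
  localMin i := by
    rw [← funext fun y => sum_localObj (P := P) (PD.x q) (PD.lam q) y] at hmin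
    exact isLocalMinOn_block hmin hk.feasible i
  stationary i := by
    have h1 := eq_zero_of_sum_dotProduct (P := P)
      (w := fun i => (gradient (P.localObj Sig ρ (PD.x q) (PD.lam q) i) (PD.x p i)
        + ∑ j, PD.kap p i j • P.gradh i j (PD.x p i)).ofLp) (fun v => by
          rw [localObj_stationary_dotProduct hf hh hSig, hk.stationary]; rfl) i
    exact WithLp.ofLp_injective 2 h1
  nonneg i j := hk.nonneg ⟨i, j⟩
  compl i j := hk.compl ⟨i, j⟩

/-! #### The coordination step -/

theorem IsNullBasis.mul_eq_zero {a b d : ℕ} {C : Matrix (Fin a) (Fin b) ℝ}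
    {Z : Matrix (Fin b) (Fin d) ℝ} (hZ : IsNullBasis C Z) : C * Z = 0 := by
  ext r c
  have hc : Z.col c ∈ LinearMap.ker C.mulVecLin := by
    rw [← hZ.2]
    exact Submodule.subset_span ⟨c, rfl⟩
  exact congrFun (LinearMap.mem_ker.1 hc) r

/-- Back substitution stays in the range of `Z i`, hence in the null space of the active Jacobian.
Symmetry of `H i` moves the matrix onto the displacement, which sits in the first slot of
`blockForm`. -/
theorem Update.coordKKT (hf : ∀ i, ContDiff ℝ 2 (P.f i)) (hh : ∀ i, ContDiff ℝ 2 (P.h i))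
    {d : Fin P.N → ℕ} {Z : ∀ i, Matrix (Fin (P.n i)) (Fin (d i)) ℝ}
    {H : ∀ i, Matrix (Fin (P.n i)) (Fin (P.n i)) ℝ} {p q' : P.PD} (hu : P.Update Z H p q')
    (hH : ∀ i, (H i).IsSymm) :
    CoordKKT P.totalObj P.totalCon P.consensusDual (blockForm H) (PD.x p) (PD.x q') (PD.lam q')
      (flatKap (PD.kap q')) where
  stationary := ContinuousLinearMap.ext fun v => by
    rw [add_apply, add_apply, blockForm_apply, lagGrad_total hf hh, consensusDual_apply,
      ← Finset.sum_add_distrib, ← Finset.sum_add_distrib]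
    refine Finset.sum_eq_zero fun i _ => ?_
    rw [dotProduct_mulVec_comm_of_isSymm (hH i), ← transpose_mulVec_dotProduct, ← add_dotProduct,
      ← add_dotProduct, ← Cact_transpose_mulVec i _ _ (hu.inactive i)]
    have h1 := hu.stationary i
    rw [add_right_comm] at h1
    rw [← add_assoc, PiLp.sub_apply, h1, zero_dotProduct]
  active := by
    rintro ⟨i, j⟩ hj
    rw [fderiv_totalCon hh]
    have h1 : (PD.x q' - PD.x p : P.X) i = WithLp.toLp 2 (P.backSub Z H (PD.x p) (PD.lam q') i) := by
      apply WithLp.ofLp_injective 2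
      rw [PiLp.sub_apply, WithLp.ofLp_sub, hu.primal i]
      simp
    rw [h1]
    refine (Cact_mulVec_eq_zero_iff i _ _).1 ?_ j hj
    rw [backSub, Matrix.mulVec_mulVec, (hu.basis i).mul_eq_zero, Matrix.zero_mulVec]
  inactive s hs := hu.inactive s.1 s.2 hs

theorem norm_lam_le (p : P.PD) : ‖PD.lam p‖ ≤ ‖p‖ :=
  (WithLp.norm_fst_le _ p.snd).trans (WithLp.norm_snd_le _ p)

/-- The consensus row is the one row that `CoordKKT` leaves free; here the tolerance on the
condensed system controls it. -/
theorem Update.norm_consensus_le {d : Fin P.N → ℕ} {Z : ∀ i, Matrix (Fin (P.n i)) (Fin (d i)) ℝ}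
    {H : ∀ i, Matrix (Fin (P.n i)) (Fin (P.n i)) ℝ} {p q' : P.PD} (hu : P.Update Z H p q') (μ : ℝ) :
    ‖P.consensusMap (PD.x q') - μ⁻¹ • (PD.lam q' - PD.lam p)‖
      ≤ ‖P.condensedResidual Z H μ p (PD.lam q')‖ := by
  rw [← P.norm_kktResidual μ hu]
  have h1 : P.consensusMap (PD.x q') - μ⁻¹ • (PD.lam q' - PD.lam p)
      = PD.lam (P.kktResidual μ H p q') := by
    have h2 : PD.lam (P.kktResidual μ H p q')
        = (P.consensusMap (PD.x q' - PD.x p) - μ⁻¹ • (PD.lam q' - PD.lam p))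
          - -P.consensusMap (PD.x p) := rfl
    rw [h2, map_sub]
    abel
  rw [h1]
  exact norm_lam_le _

/-- The right-hand side of the optimality system is bounded by the residual of the KKT conditions. -/
theorem norm_mvec_le (hf : ∀ i, ContDiff ℝ 2 (P.f i)) (hh : ∀ i, ContDiff ℝ 2 (P.h i)) {p : P.PD}
    (hκ : ∀ s, P.totalCon s (PD.x p) ≠ 0 → flatKap (PD.kap p) s = 0) :
    ‖P.mvec p‖ ≤ ‖(P.pdEquiv.symm : P.X × P.Lam × (P.Idx → ℝ) →L[ℝ] P.PD)‖ *
      (‖lagGrad P.totalObj P.totalCon (PD.x p) (flatKap (PD.kap p)) + P.consensusDual (PD.lam p)‖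
        + ‖P.consensusMap (PD.x p)‖) := by
  set w : P.X := PD.x (P.mvec p) with hw
  have hdot : ∀ v, inner ℝ w v = -(lagGrad P.totalObj P.totalCon (PD.x p) (flatKap (PD.kap p))
      + P.consensusDual (PD.lam p)) v := fun v => by
    rw [add_apply, lagGrad_total hf hh, consensusDual_apply, ← Finset.sum_add_distrib,
      ← Finset.sum_neg_distrib, PiLp.inner_apply]
    refine Finset.sum_congr rfl fun i _ => ?_
    rw [EuclideanSpace.inner_eq_star_dotProduct, star_trivial, dotProduct_comm,
      ← transpose_mulVec_dotProduct, ← add_dotProduct, ← neg_dotProduct,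
      ← Cact_transpose_mulVec i (PD.x p i) (PD.kap p i).ofLp fun j hj => hκ ⟨i, j⟩ hj]
    congr 1
    change -(gradient (P.f i) (PD.x p i)).ofLp - (P.Cact i (PD.x p i)).transpose.mulVec (PD.kap p i).ofLp
      - (P.A i).transpose.mulVec (PD.lam p).ofLp = _
    abel
  have hwn : ‖w‖ ≤ ‖lagGrad P.totalObj P.totalCon (PD.x p) (flatKap (PD.kap p))
      + P.consensusDual (PD.lam p)‖ := by
    rcases eq_or_ne w 0 with h0 | h0
    · rw [h0, norm_zero]; exact norm_nonneg _
    · have h1 := hdot w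
      rw [real_inner_self_eq_norm_sq] at h1
      have h2 := (lagGrad P.totalObj P.totalCon (PD.x p) (flatKap (PD.kap p))
        + P.consensusDual (PD.lam p)).le_opNorm w
      have h3 := (neg_le_abs _).trans h2
      rw [← h1, pow_two] at h3
      exact le_of_mul_le_mul_right h3 (norm_pos_iff.2 h0)
  have h1 : P.mvec p = (P.pdEquiv.symm : P.X × P.Lam × (P.Idx → ℝ) →L[ℝ] P.PD)
      (w, -P.consensusMap (PD.x p), 0) := rfl
  rw [h1]
  refine (ContinuousLinearMap.le_opNorm _ _).trans ?_
  gcongr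
  rw [Prod.norm_mk, Prod.norm_mk, norm_neg, norm_zero]
  refine max_le ?_ (max_le ?_ ?_) <;>
    linarith [norm_nonneg (P.consensusMap (PD.x p)), norm_nonneg (lagGrad P.totalObj P.totalCon
      (PD.x p) (flatKap (PD.kap p)) + P.consensusDual (PD.lam p))]

end SepProblem

end StepTranslation

/-! ### Solvability of the coordination step -/

section Solvability

set_option maxSynthPendingDepth 3

namespace SepProblem

theorem exists_isNullBasis {a b : ℕ} (C : Matrix (Fin a) (Fin b) ℝ) :
    ∃ (d : ℕ) (Z : Matrix (Fin b) (Fin d) ℝ), IsNullBasis C Z := by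
  let B := Module.finBasis ℝ (LinearMap.ker C.mulVecLin)
  refine ⟨_, Matrix.of fun r c => (B c : Fin b → ℝ) r, ?_, ?_⟩
  · exact B.linearIndependent.map' (LinearMap.ker C.mulVecLin).subtype (Submodule.ker_subtype _)
  · have h1 : (Matrix.of fun r c => (B c : Fin b → ℝ) r).col
        = (LinearMap.ker C.mulVecLin).subtype ∘ B := rfl
    rw [h1, Set.range_comp, Submodule.span_image, B.span_eq, Submodule.map_top,
      Submodule.range_subtype]

theorem IsNullBasis.exists_mulVec_eq {a b d : ℕ} {C : Matrix (Fin a) (Fin b) ℝ}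
    {Z : Matrix (Fin b) (Fin d) ℝ} (hZ : IsNullBasis C Z) {u : Fin b → ℝ} (hu : C.mulVec u = 0) :
    ∃ t, Z.mulVec t = u := by
  have h1 : u ∈ Submodule.span ℝ (Set.range Z.col) := by
    rw [hZ.2]
    exact LinearMap.mem_ker.2 hu
  rw [← Matrix.range_mulVecLin] at h1
  exact h1

theorem IsNullBasis.mulVec_eq_zero {a b d : ℕ} {C : Matrix (Fin a) (Fin b) ℝ}
    {Z : Matrix (Fin b) (Fin d) ℝ} (hZ : IsNullBasis C Z) {t : Fin d → ℝ} (ht : Z.mulVec t = 0) :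
    t = 0 := by
  have h1 := Matrix.mulVec_injective_iff.2 hZ.1
  exact h1 (by rw [ht, Matrix.mulVec_zero])

theorem isUnit_det_of_mulVec {ι : Type*} [Fintype ι] [DecidableEq ι] {M : Matrix ι ι ℝ}
    (hM : ∀ t, M.mulVec t = 0 → t = 0) : IsUnit M.det := by
  rw [isUnit_iff_ne_zero]
  intro h0
  obtain ⟨t, ht, ht'⟩ := Matrix.exists_mulVec_eq_zero_iff.2 h0
  exact ht (hM t ht')

/-- A vector orthogonal to the null space of `C` is a combination of the rows of `C`. -/
theorem exists_transpose_mulVec_eq {a b : ℕ} {C : Matrix (Fin a) (Fin b) ℝ} {w : Fin b → ℝ}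
    (hw : ∀ u, C.mulVec u = 0 → w ⬝ᵥ u = 0) : ∃ k, C.transpose.mulVec k = w := by
  have h1 : dotProductBilin ℝ ℝ w ∈ Submodule.span ℝ (Set.range fun j => dotProductBilin ℝ ℝ (C j)) := by
    refine mem_span_of_iInf_ker_le_ker fun u hu => ?_
    rw [Submodule.mem_iInf] at hu
    exact hw u (funext fun j => hu j)
  obtain ⟨k, hk⟩ := Submodule.mem_span_range_iff_exists_fun ℝ |>.1 h1
  refine ⟨k, funext fun c => ?_⟩
  have h2 := LinearMap.congr_fun hk (Pi.single c 1)
  simp only [LinearMap.sum_apply, LinearMap.smul_apply, dotProductBilin_apply_apply,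
    dotProduct_single, mul_one, smul_eq_mul] at h2
  rw [← h2]
  simp [Matrix.mulVec, dotProduct, mul_comm]

variable {P : SepProblem}

/-- If the matrices `H i` are positive definite on the null spaces of the active constraints, the
coordination step can be carried out exactly. -/
theorem exists_coordStep {p : P.PD} {H : ∀ i, Matrix (Fin (P.n i)) (Fin (P.n i)) ℝ}
    (hpos : ∀ i, ∀ v : Fin (P.n i) → ℝ, v ≠ 0 → (P.Cact i (PD.x p i)).mulVec v = 0 →
      0 < v ⬝ᵥ (H i).mulVec v) {μ : ℝ} (hμ : 0 < μ) : ∃ q' : P.PD, P.CoordStep μ 0 H p q' := by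
  classical
  choose d Z hZ using fun i => exists_isNullBasis (P.Cact i (PD.x p i))
  have hform : ∀ i t, t ⬝ᵥ (P.Hbar Z H i).mulVec t
      = (Z i).mulVec t ⬝ᵥ (H i).mulVec ((Z i).mulVec t) := fun i t => by
    rw [Hbar, ← Matrix.mulVec_mulVec, ← Matrix.mulVec_mulVec, dotProduct_comm,
      transpose_mulVec_dotProduct, dotProduct_comm]
  have hker : ∀ i t, (P.Cact i (PD.x p i)).mulVec ((Z i).mulVec t) = 0 := fun i t => by
    rw [Matrix.mulVec_mulVec, (hZ i).mul_eq_zero, Matrix.zero_mulVec]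
  have hnonneg : ∀ i t, 0 ≤ t ⬝ᵥ (P.Hbar Z H i).mulVec t := fun i t => by
    rw [hform]
    rcases eq_or_ne ((Z i).mulVec t) 0 with h0 | h0
    · rw [h0]; simp
    · exact (hpos i _ h0 (hker i t)).le
  have hHunit : ∀ i, IsUnit (P.Hbar Z H i).det := fun i => isUnit_det_of_mulVec fun t ht => by
    by_contra hne
    have h1 := hpos i ((Z i).mulVec t) (fun h => hne ((hZ i).mulVec_eq_zero h)) (hker i t)
    rw [← hform, ht, dotProduct_zero] at h1
    exact lt_irrefl _ h1
  have hinv : ∀ i t, (P.Hbar Z H i).mulVec ((P.Hbar Z H i)⁻¹.mulVec t) = t := fun i t => by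
    rw [Matrix.mulVec_mulVec, Matrix.mul_nonsing_inv _ (hHunit i), Matrix.one_mulVec]
  set S : Matrix (Fin P.nc) (Fin P.nc) ℝ :=
    μ⁻¹ • (1 : Matrix (Fin P.nc) (Fin P.nc) ℝ) + ∑ i, P.schur Z H i with hS
  -- With `u = Hbar⁻¹ Abarᵀ t`, each Schur complement satisfies `tᵀ S_i t = uᵀ Hbar u ≥ 0`, so `tᵀ S
  -- t ≥ μ⁻¹ tᵀ t`.
  have hSunit : IsUnit S.det := isUnit_det_of_mulVec fun t ht => by
    have h1 : ∀ i, 0 ≤ t ⬝ᵥ (P.schur Z H i).mulVec t := fun i => by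
      have h2 : t ⬝ᵥ (P.schur Z H i).mulVec t
          = (P.Hbar Z H i)⁻¹.mulVec ((P.Abar Z i).transpose.mulVec t) ⬝ᵥ (P.Hbar Z H i).mulVec
            ((P.Hbar Z H i)⁻¹.mulVec ((P.Abar Z i).transpose.mulVec t)) := by
        rw [hinv, schur, ← Matrix.mulVec_mulVec, ← Matrix.mulVec_mulVec,
          ← transpose_mulVec_dotProduct, dotProduct_comm]
      rw [h2]
      exact hnonneg i _
    have h2 : t ⬝ᵥ S.mulVec t = μ⁻¹ * (t ⬝ᵥ t) + ∑ i, t ⬝ᵥ (P.schur Z H i).mulVec t := by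
      rw [hS, Matrix.add_mulVec, Matrix.smul_mulVec, Matrix.one_mulVec, dotProduct_add,
        dotProduct_smul, Matrix.sum_mulVec, dotProduct_sum, smul_eq_mul]
    rw [ht, dotProduct_zero] at h2
    have h3 : 0 ≤ ∑ i, t ⬝ᵥ (P.schur Z H i).mulVec t := Finset.sum_nonneg fun i _ => h1 i
    have h4 : 0 ≤ t ⬝ᵥ t := Finset.sum_nonneg fun a _ => mul_self_nonneg (t a)
    have h5 : μ⁻¹ * (t ⬝ᵥ t) = 0 :=
      le_antisymm (by linarith) (mul_nonneg (inv_pos.2 hμ).le h4)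
    exact dotProduct_self_eq_zero.1 ((mul_eq_zero.1 h5).resolve_left (inv_pos.2 hμ).ne')
  set l' : P.Lam := WithLp.toLp 2
    (S⁻¹.mulVec (μ⁻¹ • (PD.lam p).ofLp + ∑ i, P.svec Z H (PD.x p) i)) with hl'
  have hres : P.condensedResidual Z H μ p l' = 0 := by
    rw [condensedResidual, ← hS, hl', Matrix.mulVec_mulVec, Matrix.mul_nonsing_inv _ hSunit,
      Matrix.one_mulVec]
    simp
  -- Back substitution makes `Zᵀ` annihilate the right-hand side. It is thus orthogonal to the null
  -- space of the active Jacobian, hence a combination of its rows.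
  have hmult : ∀ i, ∃ k : Fin (P.nh i) → ℝ, (P.Cact i (PD.x p i)).transpose.mulVec k
      = -((H i).mulVec (P.backSub Z H (PD.x p) l' i) + (gradient (P.f i) (PD.x p i)).ofLp
        + (P.A i).transpose.mulVec l'.ofLp) := fun i => by
    refine exists_transpose_mulVec_eq fun u hu => ?_
    obtain ⟨t, rfl⟩ := (hZ i).exists_mulVec_eq hu
    have h1 := hinv i (-(P.Abar Z i).transpose.mulVec l'.ofLp - P.gbar Z (PD.x p) i)
    have h2 : (Z i).transpose.mulVec ((H i).mulVec (P.backSub Z H (PD.x p) l' i))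
        = -(P.Abar Z i).transpose.mulVec l'.ofLp - P.gbar Z (PD.x p) i := by
      rw [← h1, backSub]
      nth_rw 2 [Hbar]
      simp only [Matrix.mulVec_mulVec, Matrix.mul_assoc]
    have h3 : (Z i).transpose.mulVec ((P.A i).transpose.mulVec l'.ofLp)
        = (P.Abar Z i).transpose.mulVec l'.ofLp := by
      rw [Abar, Matrix.transpose_mul, Matrix.mulVec_mulVec]
    rw [← transpose_mulVec_dotProduct (Z i), Matrix.mulVec_neg, Matrix.mulVec_add, Matrix.mulVec_add,
      h2, h3, gbar, sub_add_cancel, neg_add_cancel, neg_zero, zero_dotProduct]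
  choose k hk using hmult
  refine ⟨pd (WithLp.toLp 2 fun i => WithLp.toLp 2
      ((PD.x p i).ofLp + P.backSub Z H (PD.x p) l' i)) l'
      (WithLp.toLp 2 fun i => WithLp.toLp 2 fun j => if P.h i (PD.x p i) j = 0 then k i j else 0),
    d, Z, ⟨hZ, fun i => rfl, fun i => ?_, fun i j hj => ?_⟩, ?_⟩
  · change (H i).mulVec (((PD.x p i).ofLp + P.backSub Z H (PD.x p) l' i) - (PD.x p i).ofLp)
      + (gradient (P.f i) (PD.x p i)).ofLp + (P.A i).transpose.mulVec l'.ofLp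
      + (P.Cact i (PD.x p i)).transpose.mulVec
        (fun j => if P.h i (PD.x p i) j = 0 then k i j else 0) = 0
    -- Rows of inactive constraints are stored as zero, so truncating `k` there changes nothing.
    have h1 : (P.Cact i (PD.x p i)).transpose.mulVec
        (fun j => if P.h i (PD.x p i) j = 0 then k i j else 0)
        = (P.Cact i (PD.x p i)).transpose.mulVec (k i) := by
      funext a
      simp only [Matrix.mulVec, dotProduct]
      refine Finset.sum_congr rfl fun j _ => ?_
      by_cases hj : P.h i (PD.x p i) j = 0 <;> simp [Cact, hj]
    rw [h1, hk i, add_sub_cancel_left]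
    abel
  · exact if_neg hj
  · change ‖P.condensedResidual Z H μ p l'‖ ≤ _
    rw [hres, norm_zero, zero_mul]

end SepProblem

end Solvability

/-! ### Error estimates for one iteration -/

section Iteration

set_option maxSynthPendingDepth 3

theorem exists_lagGrad_lipschitz {X : Type*} [NormedAddCommGroup X] [NormedSpace ℝ X] {J : Type*}
    [Fintype J] {f : X → ℝ} {h : J → X → ℝ} (hf : ContDiff ℝ 2 f) (hh : ∀ j, ContDiff ℝ 2 (h j))
    (xs : X) (κs : J → ℝ) : ∃ L r : ℝ, 0 ≤ L ∧ 0 < r ∧ ∀ x κ, ‖x - xs‖ < r → ‖κ - κs‖ < r →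
      ‖lagGrad f h x κ - lagGrad f h xs κs‖ ≤ L * (‖x - xs‖ + ‖κ - κs‖) := by
  obtain ⟨L, U, hU, hL⟩ := (hasStrictFDerivAt_lagGrad hf hh xs κs).exists_lipschitzOnWith
  obtain ⟨r, hr, hball⟩ := Metric.mem_nhds_iff.1 hU
  refine ⟨L, r, L.2, hr, fun x κ hx hκ => ?_⟩
  have hmem : ((x, κ) : X × (J → ℝ)) ∈ U := hball (by
    rw [Metric.mem_ball, Prod.dist_eq, max_lt_iff, dist_eq_norm, dist_eq_norm]
    exact ⟨hx, hκ⟩)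
  refine (hL.norm_sub_le hmem (mem_of_mem_nhds hU)).trans ?_
  gcongr
  rw [Prod.mk_sub_mk, Prod.norm_mk]
  exact max_le (by linarith [norm_nonneg (κ - κs)]) (by linarith [norm_nonneg (x - xs)])

namespace SepProblem

variable {P : SepProblem} {Sig : ∀ i, Matrix (Fin (P.n i)) (Fin (P.n i)) ℝ} {ρ : ℝ} {ps : P.PD}

theorem norm_x_sub_le (p q : P.PD) : ‖PD.x p - PD.x q‖ ≤ ‖p - q‖ :=
  WithLp.norm_fst_le _ (p - q)

theorem norm_lam_sub_le (p q : P.PD) : ‖PD.lam p - PD.lam q‖ ≤ ‖p - q‖ :=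
  norm_lam_le (p - q)

theorem norm_flatKap_sub_le (p q : P.PD) :
    ‖flatKap (PD.kap p) - flatKap (PD.kap q)‖ ≤ ‖p - q‖ := by
  refine (pi_norm_le_iff_of_nonneg (norm_nonneg _)).2 fun s => ?_
  have h1 : ‖PD.kap (p - q)‖ ≤ ‖p - q‖ :=
    (WithLp.norm_snd_le _ (p - q).snd).trans (WithLp.norm_snd_le _ (p - q))
  exact ((PiLp.norm_apply_le (PD.kap (p - q) s.1) s.2).trans
    (PiLp.norm_apply_le (PD.kap (p - q)) s.1)).trans h1

theorem norm_sub_le_pdEquiv (p q : P.PD) :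
    ‖p - q‖ ≤ ‖(P.pdEquiv.symm : P.X × P.Lam × (P.Idx → ℝ) →L[ℝ] P.PD)‖ *
      ‖(PD.x p - PD.x q, PD.lam p - PD.lam q, flatKap (PD.kap p) - flatKap (PD.kap q))‖ :=
  (P.pdEquiv.symm : P.X × P.Lam × (P.Idx → ℝ) →L[ℝ] P.PD).le_opNorm (P.pdEquiv (p - q))

/-- The local step identifies the active set and is Lipschitz at the solution. -/
theorem localStep_estimate (hf : ∀ i, ContDiff ℝ 2 (P.f i)) (hh : ∀ i, ContDiff ℝ 2 (P.h i))
    (hSig : ∀ i, (Sig i).PosDef) (hρ : 0 < ρ)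
    (R : RegularPoint P.totalObj P.totalCon (PD.x ps) (P.consensusDual (PD.lam ps))
      (flatKap (PD.kap ps))) :
    ∃ δ > 0, ∃ χ > 0, ∃ ε > 0, ∀ q p, P.LocalStep Sig ρ δ q p → ‖q - ps‖ < ε →
      ‖p - ps‖ ≤ χ * ‖q - ps‖ ∧ ∀ s, P.totalCon s (PD.x p) = 0 ↔ P.totalCon s (PD.x ps) = 0 := by
  obtain ⟨δ, hδ, χ, hχ, hest⟩ := R.proxKKT_estimate (proxForm_nonneg hSig hρ)
  set D := ‖P.consensusDual‖ with hD
  have hD0 : 0 ≤ D := norm_nonneg _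
  set a := ‖(P.pdEquiv.symm : P.X × P.Lam × (P.Idx → ℝ) →L[ℝ] P.PD)‖ with ha
  have ha0 : 0 ≤ a := norm_nonneg _
  -- `LocalStep` bounds each block separately; `N` bounds of `δ / (N + 1)` add up to less than `δ`.
  -- The radius `δ / (D + 1)` keeps the change of the linear term below `δ` as well.
  refine ⟨δ / (P.N + 1), by positivity, a * (χ * (1 + D) + 1) + 1, by positivity, δ / (D + 1),
    by positivity, fun q p hstep hq => ?_⟩
  have hqd : (D + 1) * ‖q - ps‖ < δ := by
    rw [lt_div_iff₀ (by positivity)] at hq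
    linarith
  have hqδ : ‖q - ps‖ < δ := by nlinarith [norm_nonneg (q - ps)]
  have hnear : ‖PD.x p - PD.x q‖ < δ := by
    have h1 : ‖PD.x p - PD.x q‖ ≤ ∑ i, ‖(PD.x p - PD.x q) i‖ := by
      rw [PiLp.norm_eq_of_L2]
      exact (Real.sqrt_le_iff).2 ⟨Finset.sum_nonneg fun i _ => norm_nonneg _,
        Finset.sum_sq_le_sq_sum_of_nonneg fun i _ => norm_nonneg _⟩
    have h2 : ∑ i, ‖(PD.x p - PD.x q) i‖ ≤ ∑ i : Fin P.N, δ / (P.N + 1) :=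
      Finset.sum_le_sum fun i _ => by
        have := hstep.near i
        rw [dist_eq_norm] at this
        exact this.le
    refine (h1.trans h2).trans_lt ?_
    rw [Finset.sum_const, Finset.card_univ, Fintype.card_fin, nsmul_eq_mul, ← mul_div_assoc,
      div_lt_iff₀ (by positivity)]
    nlinarith
  have hdual : ‖P.consensusDual (PD.lam q) - P.consensusDual (PD.lam ps)‖ ≤ D * ‖q - ps‖ := by
    rw [← map_sub]
    exact (P.consensusDual.le_opNorm _).trans (by gcongr; exact norm_lam_sub_le q ps)
  obtain ⟨hact, hx, hκ⟩ := hest (PD.x q) (P.consensusDual (PD.lam q)) (PD.x p) (flatKap (PD.kap p))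
    hnear ((norm_x_sub_le q ps).trans_lt hqδ)
    (hdual.trans_lt (by linarith [norm_nonneg (q - ps)])) (hstep.proxKKT hf hh hSig)
  refine ⟨?_, hact⟩
  have hsum : χ * (‖PD.x q - PD.x ps‖ + ‖P.consensusDual (PD.lam q) - P.consensusDual (PD.lam ps)‖)
      ≤ χ * (1 + D) * ‖q - ps‖ := by
    rw [mul_assoc]
    gcongr
    linarith [norm_x_sub_le q ps]
  have hq0 := norm_nonneg (q - ps)
  have hc0 : 0 ≤ χ * (1 + D) * ‖q - ps‖ := by positivity
  have htriple : ‖(PD.x p - PD.x ps, PD.lam p - PD.lam ps, flatKap (PD.kap p) - flatKap (PD.kap ps))‖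
      ≤ (χ * (1 + D) + 1) * ‖q - ps‖ := by
    rw [Prod.norm_mk, Prod.norm_mk, hstep.lam_eq]
    refine max_le ?_ (max_le ?_ ?_) <;> linarith [norm_lam_sub_le q ps]
  calc ‖p - ps‖ ≤ a * ((χ * (1 + D) + 1) * ‖q - ps‖) :=
        (norm_sub_le_pdEquiv p ps).trans (by gcongr)
    _ ≤ _ := by linarith

/-- The right-hand side of the optimality system is Lipschitz at the solution. -/
theorem mvec_estimate (hf : ∀ i, ContDiff ℝ 2 (P.f i)) (hh : ∀ i, ContDiff ℝ 2 (P.h i))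
    (hcons : P.consensusMap (PD.x ps) = 0)
    (R : RegularPoint P.totalObj P.totalCon (PD.x ps) (P.consensusDual (PD.lam ps))
      (flatKap (PD.kap ps))) :
    ∃ Cm r : ℝ, 0 ≤ Cm ∧ 0 < r ∧ ∀ p : P.PD, ‖p - ps‖ < r →
      (∀ s, P.totalCon s (PD.x p) ≠ 0 → flatKap (PD.kap p) s = 0) → ‖P.mvec p‖ ≤ Cm * ‖p - ps‖ := by
  obtain ⟨L, r₂, hL, hr₂, hgrad⟩ := exists_lagGrad_lipschitz (contDiff_totalObj hf)
    (contDiff_totalCon hh) (PD.x ps) (flatKap (PD.kap ps))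
  set a := ‖(P.pdEquiv.symm : P.X × P.Lam × (P.Idx → ℝ) →L[ℝ] P.PD)‖ with ha
  have ha0 : 0 ≤ a := norm_nonneg _
  set D := ‖P.consensusDual‖
  have hD0 : 0 ≤ D := norm_nonneg _
  set E := ‖P.consensusMap‖
  have hE0 : 0 ≤ E := norm_nonneg _
  refine ⟨a * (2 * L + D + E), r₂, by positivity, hr₂, fun p hp hκ => ?_⟩
  set t := ‖p - ps‖ with ht
  have hx : ‖PD.x p - PD.x ps‖ ≤ t := norm_x_sub_le p ps
  have hl : ‖PD.lam p - PD.lam ps‖ ≤ t := norm_lam_sub_le p ps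
  have hk : ‖flatKap (PD.kap p) - flatKap (PD.kap ps)‖ ≤ t := norm_flatKap_sub_le p ps
  refine (norm_mvec_le hf hh hκ).trans ?_
  rw [mul_assoc]
  refine mul_le_mul_of_nonneg_left ?_ ha0
  have h1 : lagGrad P.totalObj P.totalCon (PD.x p) (flatKap (PD.kap p))
      + P.consensusDual (PD.lam p)
      = (lagGrad P.totalObj P.totalCon (PD.x p) (flatKap (PD.kap p))
        - lagGrad P.totalObj P.totalCon (PD.x ps) (flatKap (PD.kap ps)))
        + P.consensusDual (PD.lam p - PD.lam ps) := by
    rw [map_sub, ← sub_eq_zero, ← R.stationary]; abel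
  have h2 := hgrad (PD.x p) (flatKap (PD.kap p)) (hx.trans_lt hp) (hk.trans_lt hp)
  have h3 : ‖P.consensusDual (PD.lam p - PD.lam ps)‖ ≤ D * t :=
    (P.consensusDual.le_opNorm _).trans (by gcongr)
  have h4 : ‖P.consensusMap (PD.x p)‖ ≤ E * t := by
    have : P.consensusMap (PD.x p) = P.consensusMap (PD.x p - PD.x ps) := by
      rw [map_sub, hcons, sub_zero]
    rw [this]
    exact (P.consensusMap.le_opNorm _).trans (by gcongr)
  have h5 : L * (‖PD.x p - PD.x ps‖ + ‖flatKap (PD.kap p) - flatKap (PD.kap ps)‖) ≤ L * (t + t) := by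
    gcongr
  rw [h1]
  have h6 := norm_add_le (lagGrad P.totalObj P.totalCon (PD.x p) (flatKap (PD.kap p))
        - lagGrad P.totalObj P.totalCon (PD.x ps) (flatKap (PD.kap ps)))
        (P.consensusDual (PD.lam p - PD.lam ps))
  linarith

/-- Error of the inexact coordination step. -/
theorem coordStep_estimate (hf : ∀ i, ContDiff ℝ 2 (P.f i)) (hh : ∀ i, ContDiff ℝ 2 (P.h i))
    (hLICQ : P.LICQ (PD.x ps)) (hcons : P.consensusMap (PD.x ps) = 0)
    (R : RegularPoint P.totalObj P.totalCon (PD.x ps) (P.consensusDual (PD.lam ps))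
      (flatKap (PD.kap ps)))
    (hLip : ∃ U ∈ 𝓝 ps, ∃ K : NNReal, LipschitzOnWith K (fderiv ℝ (fderiv ℝ P.lagrangian)) U) :
    ∃ C > 0, ∃ r > 0, ∀ (p q' : P.PD) (μ η e : ℝ) (H : ∀ i, Matrix (Fin (P.n i)) (Fin (P.n i)) ℝ),
      ‖p - ps‖ < r → e < r → |μ⁻¹| < r → 0 ≤ e → 0 ≤ η →
      (∀ s, P.totalCon s (PD.x p) = 0 ↔ P.totalCon s (PD.x ps) = 0) →
      (∀ s, P.totalCon s (PD.x p) ≠ 0 → flatKap (PD.kap p) s = 0) →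
      P.HessApprox e H p → P.CoordStep μ η H p q' →
      ‖q' - ps‖ ≤ C * (‖p - ps‖ + e + |μ⁻¹| + η) * ‖p - ps‖ := by
  obtain ⟨U, hU, K, hK⟩ := hLip
  obtain ⟨K', r₀, hK', hr₀, hLip'⟩ := exists_lagHess_lipschitz hf hh hU hK
  obtain ⟨C, hC, r₁, hr₁, hest⟩ := R.coordKKT_estimate (A := P.consensusMap)
    P.consensusDual_eq_inner (licq_total hh hLICQ) hcons hK' hr₀ hLip'
  obtain ⟨Cm, r₂, hCm0, hr₂, hmvec⟩ := mvec_estimate hf hh hcons R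
  set a := ‖(P.pdEquiv.symm : P.X × P.Lam × (P.Idx → ℝ) →L[ℝ] P.PD)‖ with ha
  have ha0 : 0 ≤ a := norm_nonneg _
  set n2 : ℝ := ∑ i, (P.n i : ℝ) * P.n i with hn2
  have hn0 : 0 ≤ n2 := Finset.sum_nonneg fun i _ => by positivity
  refine ⟨a * C * (2 + n2 + 1 + Cm) + 1, by positivity, min r₁ (min r₂ (r₁ / (n2 + 1))), by positivity,
    fun p q' μ η e H hp he hμ he0 hη hact hκ hH hstep => ?_⟩
  obtain ⟨d, Z, hu, hres⟩ := hstep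
  simp only [lt_min_iff] at hp he hμ
  set t := ‖p - ps‖ with ht
  have ht0 : 0 ≤ t := norm_nonneg _
  have hx : ‖PD.x p - PD.x ps‖ ≤ t := norm_x_sub_le p ps
  have hl : ‖PD.lam p - PD.lam ps‖ ≤ t := norm_lam_sub_le p ps
  have hk : ‖flatKap (PD.kap p) - flatKap (PD.kap ps)‖ ≤ t := norm_flatKap_sub_le p ps
  have hHe : ‖blockForm H - lagHess P.totalObj P.totalCon (PD.x p) (flatKap (PD.kap p))‖ ≤ n2 * e := by
    rw [lagHess_total hf hh]
    exact P.norm_blockForm_sub_le fun i => (hH i).2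
  have hHr : ‖blockForm H - lagHess P.totalObj P.totalCon (PD.x p) (flatKap (PD.kap p))‖ < r₁ := by
    refine hHe.trans_lt ?_
    have := he.2.2
    rw [lt_div_iff₀ (by positivity)] at this
    linarith
  have hmv : ‖P.mvec p‖ ≤ Cm * t := hmvec p hp.2.1 hκ
  have hmain := hest (PD.x p) (PD.lam p) (flatKap (PD.kap p)) (PD.x q') (PD.lam q')
    (flatKap (PD.kap q')) (blockForm H) μ⁻¹ (hx.trans_lt hp.1) (hk.trans_lt hp.1) hHr hμ.1 hact
    (hu.coordKKT hf hh fun i => (hH i).1)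
  have hr : ‖P.consensusMap (PD.x q') - μ⁻¹ • (PD.lam q' - PD.lam p)‖ ≤ η * (Cm * t) :=
    ((hu.norm_consensus_le μ).trans hres).trans (by gcongr)
  have hbr : (‖PD.x p - PD.x ps‖ + ‖flatKap (PD.kap p) - flatKap (PD.kap ps)‖) * ‖PD.x p - PD.x ps‖
      + ‖blockForm H - lagHess P.totalObj P.totalCon (PD.x p) (flatKap (PD.kap p))‖
        * ‖PD.x p - PD.x ps‖ + |μ⁻¹| * ‖PD.lam p - PD.lam ps‖
      + ‖P.consensusMap (PD.x q') - μ⁻¹ • (PD.lam q' - PD.lam p)‖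
      ≤ (t + t) * t + n2 * e * t + |μ⁻¹| * t + η * (Cm * t) := by gcongr
  set m := |μ⁻¹|
  have hm0 : 0 ≤ m := abs_nonneg _
  have hfin : (t + t) * t + n2 * e * t + m * t + η * (Cm * t)
      ≤ (2 + n2 + 1 + Cm) * ((t + e + m + η) * t) := by
    have p1 : 0 ≤ t * t := by positivity
    have p2 : 0 ≤ e * t := by positivity
    have p3 : 0 ≤ m * t := by positivity
    have p4 : 0 ≤ η * t := by positivity
    have : (2 + n2 + 1 + Cm) * ((t + e + m + η) * t) - ((t + t) * t + n2 * e * t + m * t + η * (Cm * t))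
        = (1 + n2 + Cm) * (t * t) + (3 + Cm) * (e * t) + (2 + n2 + Cm) * (m * t)
          + (3 + n2) * (η * t) := by ring
    have : 0 ≤ (1 + n2 + Cm) * (t * t) + (3 + Cm) * (e * t) + (2 + n2 + Cm) * (m * t)
          + (3 + n2) * (η * t) := by positivity
    linarith
  have hnn : 0 ≤ (t + e + m + η) * t := by positivity
  have hq := (norm_sub_le_pdEquiv q' ps).trans
    (mul_le_mul_of_nonneg_left (hmain.trans (mul_le_mul_of_nonneg_left (hbr.trans hfin) hC.le)) ha0)
  calc ‖q' - ps‖ ≤ a * (C * ((2 + n2 + 1 + Cm) * ((t + e + m + η) * t))) := hq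
    _ ≤ (a * C * (2 + n2 + 1 + Cm) + 1) * ((t + e + m + η) * t) := by linarith
    _ = _ := by ring

/-- With exact Hessian, the coordination step fixes the solution. -/
theorem coordStep_fixed (hf : ∀ i, ContDiff ℝ 2 (P.f i)) (hh : ∀ i, ContDiff ℝ 2 (P.h i))
    (hLICQ : P.LICQ (PD.x ps)) (hcons : P.consensusMap (PD.x ps) = 0)
    (R : RegularPoint P.totalObj P.totalCon (PD.x ps) (P.consensusDual (PD.lam ps))
      (flatKap (PD.kap ps)))
    {q' : P.PD} {μ η : ℝ} (hμ : 0 < μ) {H : ∀ i, Matrix (Fin (P.n i)) (Fin (P.n i)) ℝ}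
    (hH : P.HessApprox 0 H ps) (hstep : P.CoordStep μ η H ps q') : q' = ps := by
  obtain ⟨d, Z, hu, hres⟩ := hstep
  have hH' : blockForm H = lagHess P.totalObj P.totalCon (PD.x ps) (flatKap (PD.kap ps)) := by
    have h1 := P.norm_blockForm_sub_le fun i => (hH i).2
    rw [mul_zero] at h1
    rw [lagHess_total hf hh]
    exact sub_eq_zero.1 (norm_le_zero_iff.1 h1)
  -- The right-hand side vanishes at a KKT point, so the condensed system is solved exactly whatever
  -- `η` is.
  have hm : ‖P.mvec ps‖ ≤ 0 := by
    have h1 := norm_mvec_le hf hh (p := ps) R.zero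
    rwa [R.stationary, hcons, norm_zero, norm_zero, add_zero, mul_zero] at h1
  have hres0 : P.consensusMap (PD.x q') - μ⁻¹ • (PD.lam q' - PD.lam ps) = 0 := by
    have h1 := (hu.norm_consensus_le μ).trans hres
    rw [le_antisymm hm (norm_nonneg _), mul_zero] at h1
    exact norm_le_zero_iff.1 h1
  have hc := hu.coordKKT hf hh fun i => (hH i).1
  rw [hH'] at hc
  obtain ⟨h1, h2, h3⟩ := R.coordKKT_fixed P.consensusDual_eq_inner (licq_total hh hLICQ) hcons
    (inv_pos.2 hμ).le hc hres0
  apply P.pdEquiv.injective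
  rw [pdEquiv_apply, pdEquiv_apply, h1, h2, h3]

/-- Positive definiteness of approximate Hessians on the null spaces of the active constraints. -/
theorem exists_hess_pos (hf : ∀ i, ContDiff ℝ 2 (P.f i)) (hh : ∀ i, ContDiff ℝ 2 (P.h i))
    (R : RegularPoint P.totalObj P.totalCon (PD.x ps) (P.consensusDual (PD.lam ps))
      (flatKap (PD.kap ps))) :
    ∃ r > 0, ∀ (p : P.PD) (e : ℝ) (H : ∀ i, Matrix (Fin (P.n i)) (Fin (P.n i)) ℝ),
      ‖p - ps‖ < r → e < r →
      (∀ s, P.totalCon s (PD.x p) = 0 ↔ P.totalCon s (PD.x ps) = 0) → P.HessApprox e H p →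
      ∀ i, ∀ v : Fin (P.n i) → ℝ, v ≠ 0 → (P.Cact i (PD.x p i)).mulVec v = 0 →
        0 < v ⬝ᵥ (H i).mulVec v := by
  classical
  let s : Finset P.Idx := Finset.univ.filter fun j => P.totalCon j (PD.x ps) = 0
  have hs : ∀ j, j ∈ s ↔ P.totalCon j (PD.x ps) = 0 := fun j => by simp [s]
  obtain ⟨T, -, c, hc, hcoer⟩ := exists_penalizedForm_coercive s
    (fun j => fderiv ℝ (P.totalCon j) (PD.x ps))
    (lagHess P.totalObj P.totalCon (PD.x ps) (flatKap (PD.kap ps))) fun v hv hv' =>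
      R.sosc v hv fun j hj => hv' j ((hs j).2 hj)
  have hev := penalizedForm_pos_of_near s hc hcoer
  -- The second argument is the deviation of the approximate Hessian from the exact one at the
  -- current point, so closeness to `0` is what `HessApprox` provides.
  let g : (P.X × P.Lam × (P.Idx → ℝ)) × (P.X →L[ℝ] P.X →L[ℝ] ℝ) →
      (P.Idx → P.X →L[ℝ] ℝ) × (P.X →L[ℝ] P.X →L[ℝ] ℝ) := fun w =>
    (fun j => fderiv ℝ (P.totalCon j) w.1.1, w.2 + lagHess P.totalObj P.totalCon w.1.1 w.1.2.2)
  have hg : Continuous g := by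
    have h1 := continuous_lagHess (contDiff_totalObj hf) (contDiff_totalCon hh)
    have h2 : Continuous fun w : (P.X × P.Lam × (P.Idx → ℝ)) × (P.X →L[ℝ] P.X →L[ℝ] ℝ) =>
        fun j => fderiv ℝ (P.totalCon j) w.1.1 :=
      continuous_pi fun j => ((contDiff_totalCon hh j).continuous_fderiv (by norm_num)).comp
        (continuous_fst.comp continuous_fst)
    have h3 : Continuous fun w : (P.X × P.Lam × (P.Idx → ℝ)) × (P.X →L[ℝ] P.X →L[ℝ] ℝ) =>
        lagHess P.totalObj P.totalCon w.1.1 w.1.2.2 :=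
      h1.comp ((continuous_fst.comp continuous_fst).prodMk
        (continuous_snd.comp (continuous_snd.comp continuous_fst)))
    exact h2.prodMk (continuous_snd.add h3)
  have hev' : ∀ᶠ w in 𝓝 ((PD.x ps, PD.lam ps, flatKap (PD.kap ps)),
      (0 : P.X →L[ℝ] P.X →L[ℝ] ℝ)), ∀ v, c / 2 * ‖v‖ ^ 2 ≤ penalizedForm s T (g w).1 (g w).2 v v := by
    have h0 : g ((PD.x ps, PD.lam ps, flatKap (PD.kap ps)), 0) = (fun j => fderiv ℝ (P.totalCon j)
        (PD.x ps), lagHess P.totalObj P.totalCon (PD.x ps) (flatKap (PD.kap ps))) := by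
      simp [g]
    have ht := hg.tendsto ((PD.x ps, PD.lam ps, flatKap (PD.kap ps)), 0)
    rw [h0] at ht
    exact ht.eventually hev
  obtain ⟨r, hr, hball⟩ := Metric.eventually_nhds_iff.1 hev'
  set n2 : ℝ := ∑ i, (P.n i : ℝ) * P.n i with hn2
  have hn0 : 0 ≤ n2 := Finset.sum_nonneg fun i _ => by positivity
  refine ⟨min r (r / (n2 + 1)), by positivity, fun p e H hp he hact hH i v hv hv0 => ?_⟩
  rw [lt_min_iff] at hp he
  have hHe : ‖blockForm H - lagHess P.totalObj P.totalCon (PD.x p) (flatKap (PD.kap p))‖ < r := by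
    rw [lagHess_total hf hh]
    refine (P.norm_blockForm_sub_le fun i => (hH i).2).trans_lt ?_
    have := he.2
    rw [lt_div_iff₀ (by positivity)] at this
    rcases le_or_gt 0 e with h0 | h0
    · linarith
    · nlinarith
  have hdist : dist (((PD.x p, PD.lam p, flatKap (PD.kap p)),
      blockForm H - lagHess P.totalObj P.totalCon (PD.x p) (flatKap (PD.kap p))) :
        (P.X × P.Lam × (P.Idx → ℝ)) × (P.X →L[ℝ] P.X →L[ℝ] ℝ))
      ((PD.x ps, PD.lam ps, flatKap (PD.kap ps)), 0) < r := by
    rw [Prod.dist_eq, Prod.dist_eq, Prod.dist_eq]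
    simp only [max_lt_iff, dist_eq_norm, sub_zero]
    exact ⟨⟨(norm_x_sub_le p ps).trans_lt hp.1, (norm_lam_sub_le p ps).trans_lt hp.1,
      (norm_flatKap_sub_le p ps).trans_lt hp.1⟩, hHe⟩
  -- On a vector supported in block `i` and annihilated by the active gradients, the penalty
  -- vanishes and the stacked form reduces to `H i`.
  let V : P.X := WithLp.toLp 2 (Pi.single i (WithLp.toLp 2 v))
  have hVi : (V i).ofLp = v := by simp [V]
  have hVk : ∀ k, k ≠ i → (V k).ofLp = 0 := fun k hk => by simp [V, Pi.single_eq_of_ne hk]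
  have h1 := hball hdist V
  have hD : ∀ j ∈ s, fderiv ℝ (P.totalCon j) (PD.x p) V = 0 := by
    rintro ⟨k, j⟩ hj
    rw [fderiv_totalCon hh]
    rcases eq_or_ne k i with rfl | hk
    · change (P.gradh k j (PD.x p k)).ofLp ⬝ᵥ (V k).ofLp = 0
      rw [hVi]
      exact (Cact_mulVec_eq_zero_iff k _ _).1 hv0 j ((hact ⟨k, j⟩).2 ((hs _).1 hj))
    · change (P.gradh k j (PD.x p k)).ofLp ⬝ᵥ (V k).ofLp = 0
      rw [hVk k hk, dotProduct_zero]
  have h2 : (g ((PD.x p, PD.lam p, flatKap (PD.kap p)),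
      blockForm H - lagHess P.totalObj P.totalCon (PD.x p) (flatKap (PD.kap p))))
      = (fun j => fderiv ℝ (P.totalCon j) (PD.x p), blockForm H) := by
    simp [g]
  rw [h2, penalizedForm_apply, Finset.sum_eq_zero fun j hj => by rw [hD j hj, zero_mul], mul_zero,
    add_zero, blockForm_apply, Finset.sum_eq_single i (fun k _ hk => by rw [hVk k hk, zero_dotProduct])
      (by simp), hVi] at h1
  have hV : V ≠ 0 := fun h => hv (by rw [← hVi, h]; rfl)
  have : 0 < c / 2 * ‖V‖ ^ 2 := by
    have := norm_pos_iff.2 hV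
    positivity
  linarith

/-- Error of one full iteration. -/
theorem iteration_estimate (hf : ∀ i, ContDiff ℝ 2 (P.f i)) (hh : ∀ i, ContDiff ℝ 2 (P.h i))
    (hSig : ∀ i, (Sig i).PosDef) (hρ : 0 < ρ) (hLICQ : P.LICQ (PD.x ps))
    (hcons : P.consensusMap (PD.x ps) = 0)
    (R : RegularPoint P.totalObj P.totalCon (PD.x ps) (P.consensusDual (PD.lam ps))
      (flatKap (PD.kap ps)))
    (hLip : ∃ U ∈ 𝓝 ps, ∃ K : NNReal, LipschitzOnWith K (fderiv ℝ (fderiv ℝ P.lagrangian)) U) :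
    ∃ δ > 0, ∃ χ > 0, ∃ C₀ > 0, ∀ cμ > 0, ∀ cH ≥ 0, ∃ C₁ > 0, ∃ ε > 0,
      (∀ q : P.PD, ‖q - ps‖ < ε → ∃ p : P.PD, P.LocalStep Sig ρ δ q p ∧
        ∀ H, P.HessApprox (cH * ‖q - ps‖) H p → ∀ μ > 0, ∃ q' : P.PD, P.CoordStep μ 0 H p q') ∧
      ∀ (q p q' : P.PD) (μ η : ℝ) (H : ∀ i, Matrix (Fin (P.n i)) (Fin (P.n i)) ℝ),
        ‖q - ps‖ < ε → 0 < μ → 0 ≤ η → P.LocalStep Sig ρ δ q p → P.CoordStep μ η H p q' →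
        (q ≠ ps → 1 / μ ≤ cμ * ‖q - ps‖) → P.HessApprox (cH * ‖q - ps‖) H p →
        ‖p - ps‖ ≤ χ * ‖q - ps‖ ∧ ‖q' - ps‖ ≤ (C₁ * ‖q - ps‖ + C₀ * η) * ‖q - ps‖ := by
  obtain ⟨δ, hδ, χ, hχ, ε₁, hε₁, hloc⟩ := localStep_estimate hf hh hSig hρ R
  obtain ⟨C, hC, r, hr, hcoord⟩ := coordStep_estimate hf hh hLICQ hcons R hLip
  obtain ⟨r', hr', hposdef⟩ := exists_hess_pos hf hh R
  obtain ⟨ε₂, hε₂, hex⟩ := R.exists_proxKKT (proxForm_nonneg hSig hρ) (proxForm_symm hSig) hδ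
  -- `C₀ = C * χ` is free of `cμ` and `cH`, which makes a uniform tolerance threshold possible.
  -- Dividing by `χ + cH + cμ` keeps `‖p - ps‖`, the Hessian error and `1 / μ` (for `q ≠ ps`) below
  -- `min r r'`.
  refine ⟨δ, hδ, χ, hχ, C * χ, by positivity, fun cμ hcμ cH hcH =>
    ⟨C * (χ + cH + cμ) * χ, by positivity, min ε₁ (min (min r r' / (χ + cH + cμ))
      (ε₂ / (‖P.consensusDual‖ + 1))), by positivity, ?_, ?_⟩⟩
  all_goals
    have hsmall : ∀ t : ℝ, 0 ≤ t → t < min r r' / (χ + cH + cμ) →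
        χ * t < min r r' ∧ cH * t < min r r' ∧ cμ * t < min r r' := fun t ht0 ht => by
      rw [lt_div_iff₀ (by positivity)] at ht
      have p1 : 0 ≤ χ * t := by positivity
      have p2 : 0 ≤ cH * t := by positivity
      have p3 : 0 ≤ cμ * t := by positivity
      refine ⟨?_, ?_, ?_⟩ <;> linarith
  · intro q hq
    simp only [lt_min_iff (a := ‖q - ps‖)] at hq
    have hq3 := hq.2.2
    rw [lt_div_iff₀ (by positivity)] at hq3
    have hD0 := norm_nonneg P.consensusDual
    have hq0 := norm_nonneg (q - ps)
    have hdual : ‖P.consensusDual (PD.lam q) - P.consensusDual (PD.lam ps)‖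
        ≤ ‖P.consensusDual‖ * ‖q - ps‖ := by
      rw [← map_sub]
      exact (P.consensusDual.le_opNorm _).trans (by gcongr; exact norm_lam_sub_le q ps)
    have p1 : 0 ≤ ‖P.consensusDual‖ * ‖q - ps‖ := by positivity
    obtain ⟨x, κ, hkkt, hnear, hmin⟩ := hex (PD.x q) (P.consensusDual (PD.lam q))
      ((norm_x_sub_le q ps).trans_lt (by linarith)) (hdual.trans_lt (by linarith))
    let p : P.PD := P.pdEquiv.symm (x, PD.lam q, κ)
    have hstep : P.LocalStep Sig ρ δ q p :=
      localStep_of_proxKKT (p := p) hf hh hSig rfl hkkt hnear hmin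
    obtain ⟨hp, hact⟩ := hloc q p hstep hq.1
    obtain ⟨h1, h2, -⟩ := hsmall _ hq0 hq.2.1
    refine ⟨p, hstep, fun H hH μ hμ => exists_coordStep ?_ hμ⟩
    exact hposdef p (cH * ‖q - ps‖) H (hp.trans_lt (h1.trans_le (min_le_right _ _)))
      (h2.trans_le (min_le_right _ _)) hact hH
  · intro q p q' μ η H hq hμ hη hstep hcs hμq hH
    simp only [lt_min_iff (a := ‖q - ps‖)] at hq
    have hq0 := norm_nonneg (q - ps)
    obtain ⟨hp, hact⟩ := hloc q p hstep hq.1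
    refine ⟨hp, ?_⟩
    -- At `q = ps` nothing bounds `1 / μ`, but then `p = ps` and the Hessian is exact, so the
    -- fixed-point lemma applies for every `μ > 0`.
    rcases eq_or_ne q ps with rfl | hne
    · have hpq : p = q := by
        rw [sub_self, norm_zero, mul_zero] at hp
        exact sub_eq_zero.1 (norm_le_zero_iff.1 hp)
      subst hpq
      rw [sub_self, norm_zero, mul_zero] at hH
      rw [coordStep_fixed hf hh hLICQ hcons R hμ hH hcs]
      simp
    · obtain ⟨h1, h2, h3⟩ := hsmall _ hq0 hq.2.1
      have hμ1 : |μ⁻¹| ≤ cμ * ‖q - ps‖ := by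
        rw [abs_of_pos (inv_pos.2 hμ), ← one_div]
        exact hμq hne
      have h4 := hcoord p q' μ η (cH * ‖q - ps‖) H (hp.trans_lt (h1.trans_le (min_le_left _ _)))
        (h2.trans_le (min_le_left _ _)) (hμ1.trans_lt (h3.trans_le (min_le_left _ _)))
        (by positivity) hη hact
        (fun s hs => (mul_eq_zero.1 (hstep.compl s.1 s.2)).resolve_right hs) hH hcs
      calc ‖q' - ps‖ ≤ C * (χ * ‖q - ps‖ + cH * ‖q - ps‖ + cμ * ‖q - ps‖ + η) * (χ * ‖q - ps‖) := by
            refine h4.trans ?_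
            gcongr
        _ = _ := by ring

end SepProblem

/-- A sequence that contracts in a ball around `a` converges to `a`. -/
theorem tendsto_of_contraction {E : Type*} [NormedAddCommGroup E] {q p : ℕ → E} {a : E}
    {ε χ : ℝ} (h0 : ‖q 0 - a‖ < ε)
    (hq : ∀ k, ‖q k - a‖ < ε → ‖q (k + 1) - a‖ ≤ 1 / 2 * ‖q k - a‖ ∧ ‖p k - a‖ ≤ χ * ‖q k - a‖) :
    (∀ k, ‖q k - a‖ < ε) ∧ Tendsto q atTop (𝓝 a) ∧ Tendsto p atTop (𝓝 a) := by
  have hball : ∀ k, ‖q k - a‖ < ε := fun k => by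
    induction k with
    | zero => exact h0
    | succ k ih => linarith [(hq k ih).1, norm_nonneg (q k - a)]
  have hgeo : ∀ k, ‖q k - a‖ ≤ (1 / 2) ^ k * ‖q 0 - a‖ := fun k => by
    induction k with
    | zero => simp
    | succ k ih =>
      calc _ ≤ 1 / 2 * ‖q k - a‖ := (hq k (hball k)).1
        _ ≤ 1 / 2 * ((1 / 2) ^ k * ‖q 0 - a‖) := by gcongr
        _ = _ := by ring
  have hlim : Tendsto (fun k => ‖q k - a‖) atTop (𝓝 0) := by
    refine squeeze_zero (fun k => norm_nonneg _) hgeo ?_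
    simpa using (tendsto_pow_atTop_nhds_zero_of_lt_one (by norm_num : (0 : ℝ) ≤ 1 / 2)
      (by norm_num)).mul_const ‖q 0 - a‖
  refine ⟨hball, tendsto_iff_norm_sub_tendsto_zero.2 hlim, tendsto_iff_norm_sub_tendsto_zero.2 ?_⟩
  refine squeeze_zero (fun k => norm_nonneg _) (fun k => (hq k (hball k)).2) ?_
  simpa using hlim.const_mul χ

end Iteration

/-! ### The convergence theorem. -/

theorem mainTheorem1 (P : SepProblem)
    (hf : ∀ i, ContDiff ℝ 2 (P.f i)) (hh : ∀ i, ContDiff ℝ 2 (P.h i))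
    (Sig : ∀ i, Matrix (Fin (P.n i)) (Fin (P.n i)) ℝ) (hSig : ∀ i, (Sig i).PosDef)
    (ρ : ℝ) (hρ : 0 < ρ)
    (ps : P.PD) (hKKT : P.IsKKT ps) (hLICQ : P.LICQ (SepProblem.PD.x ps))
    (hSCC : P.SCC ps) (hSOSC : P.SOSC ps)
    (hLip : ∃ U ∈ 𝓝 ps, ∃ K : NNReal, LipschitzOnWith K (fderiv ℝ P.lagrangian) U ∧
      LipschitzOnWith K (fderiv ℝ (fderiv ℝ P.lagrangian)) U) :
    ∃ δ > 0, ∃ χ > 0, ∃ ηbar > 0, ∃ c > 0, c < 1 ∧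
      ∀ cμ > 0, ∀ cH ≥ 0,
        -- the steps can be carried out near the solution
        (∃ ε > 0, ∀ q : P.PD, ‖q - ps‖ < ε → ∃ p : P.PD, P.LocalStep Sig ρ δ q p ∧
          ∀ H, P.HessApprox (cH * ‖q - ps‖) H p → ∀ μ > 0, ∃ q' : P.PD, P.CoordStep μ 0 H p q') ∧
        -- local convergence at a linear rate
        (∃ ε > 0, ∀ (μ η : ℕ → ℝ) (H : ℕ → ∀ i, Matrix (Fin (P.n i)) (Fin (P.n i)) ℝ)
          (q p : ℕ → P.PD), P.IsRun Sig ρ δ μ η H q p → ‖q 0 - ps‖ < ε →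
          (∀ k, q k ≠ ps → 1 / μ k ≤ cμ * ‖q k - ps‖) →
          (∀ k, P.HessApprox (cH * ‖q k - ps‖) (H k) (p k)) →
          (∀ k, η k < ηbar) →
            Tendsto q atTop (𝓝 ps) ∧ Tendsto p atTop (𝓝 ps) ∧
            ∀ k, ‖q (k + 1) - ps‖ ≤ c * ‖q k - ps‖ ∧ ‖p k - ps‖ ≤ χ * ‖q k - ps‖) ∧
        -- local convergence at a quadratic rate
        (∀ cη > 0, ∃ ε > 0, ∃ C > 0,
          ∀ (μ η : ℕ → ℝ) (H : ℕ → ∀ i, Matrix (Fin (P.n i)) (Fin (P.n i)) ℝ)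
          (q p : ℕ → P.PD), P.IsRun Sig ρ δ μ η H q p → ‖q 0 - ps‖ < ε →
          (∀ k, q k ≠ ps → 1 / μ k ≤ cμ * ‖q k - ps‖) →
          (∀ k, P.HessApprox (cH * ‖q k - ps‖) (H k) (p k)) →
          (∀ k, η k ≤ cη * ‖q k - ps‖) →
            Tendsto q atTop (𝓝 ps) ∧ Tendsto p atTop (𝓝 ps) ∧
            ∀ k, ‖q (k + 1) - ps‖ ≤ C * ‖q k - ps‖ ^ 2 ∧ ‖p k - ps‖ ≤ χ * ‖q k - ps‖) := by
  have hcons : P.consensusMap (SepProblem.PD.x ps) = 0 := by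
    rw [SepProblem.consensusMap_apply, hKKT.consensus]
    rfl
  obtain ⟨U, hU, K, -, hK⟩ := hLip
  obtain ⟨δ, hδ, χ, hχ, C₀, hC₀, hiter⟩ := SepProblem.iteration_estimate hf hh hSig hρ hLICQ hcons
    (SepProblem.regularPoint hf hh hKKT hLICQ hSCC hSOSC) ⟨U, hU, K, hK⟩
  -- With `η < 1 / (4 * C₀)` and radius at most `1 / (4 * C₁)`, each part of `C₁ ‖q - ps‖ + C₀ η` is
  -- below `1 / 4`, so the rate is `1 / 2`.
  refine ⟨δ, hδ, χ, hχ, 1 / (4 * C₀), by positivity, 1 / 2, by norm_num, by norm_num,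
    fun cμ hcμ cH hcH => ?_⟩
  obtain ⟨C₁, hC₁, ε, hε, hwell, hest⟩ := hiter cμ hcμ cH hcH
  refine ⟨⟨ε, hε, hwell⟩, ⟨min ε (1 / (4 * C₁)), by positivity, ?_⟩, fun cη hcη =>
    ⟨min ε (1 / (2 * (C₁ + C₀ * cη))), by positivity, C₁ + C₀ * cη, by positivity, ?_⟩⟩
  · intro μ η H q p hrun h0 hμ hH hη
    have hstep : ∀ k, ‖q k - ps‖ < min ε (1 / (4 * C₁)) →
        ‖q (k + 1) - ps‖ ≤ 1 / 2 * ‖q k - ps‖ ∧ ‖p k - ps‖ ≤ χ * ‖q k - ps‖ := fun k hk => by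
      rw [lt_min_iff, lt_div_iff₀ (by positivity)] at hk
      obtain ⟨h1, h2, h3, h4⟩ := hrun k
      obtain ⟨h5, h6⟩ := hest (q k) (p k) (q (k + 1)) (μ k) (η k) (H k) hk.1 h1 h2 h3 h4 (hμ k) (hH k)
      have h7 := hη k
      rw [lt_div_iff₀ (by positivity)] at h7
      refine ⟨h6.trans ?_, h5⟩
      gcongr
      linarith
    obtain ⟨hball, hq, hp⟩ := tendsto_of_contraction h0 hstep
    exact ⟨hq, hp, fun k => hstep k (hball k)⟩
  · intro μ η H q p hrun h0 hμ hH hη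
    have hquad : ∀ k, ‖q k - ps‖ < min ε (1 / (2 * (C₁ + C₀ * cη))) →
        ‖q (k + 1) - ps‖ ≤ (C₁ + C₀ * cη) * ‖q k - ps‖ ^ 2 ∧ ‖p k - ps‖ ≤ χ * ‖q k - ps‖ :=
        fun k hk => by
      obtain ⟨h1, h2, h3, h4⟩ := hrun k
      obtain ⟨h5, h6⟩ := hest (q k) (p k) (q (k + 1)) (μ k) (η k) (H k)
        (hk.trans_le (min_le_left _ _)) h1 h2 h3 h4 (hμ k) (hH k)
      refine ⟨?_, h5⟩
      calc _ ≤ (C₁ * ‖q k - ps‖ + C₀ * (cη * ‖q k - ps‖)) * ‖q k - ps‖ := h6.trans (by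
            gcongr
            exact hη k)
        _ = _ := by ring
    -- Within radius `1 / (2 * (C₁ + C₀ * cη))` the quadratic bound is also a contraction by `1 /
    -- 2`, which keeps the iterates in the ball.
    obtain ⟨hball, hq, hp⟩ := tendsto_of_contraction h0 fun k hk => by
      obtain ⟨h1, h2⟩ := hquad k hk
      refine ⟨h1.trans ?_, h2⟩
      rw [lt_min_iff, lt_div_iff₀ (by positivity)] at hk
      rw [pow_two, ← mul_assoc]
      gcongr
      linarith
    exact ⟨hq, hp, fun k => hquad k (hball k)⟩
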